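/- Let $n,p,m,q$ be nonnegative integers, $A\in\mathbb C^{n\times p}$, $B\in\mathbb C^{m\times q}$, $C\in\mathbb C^{n\times q}$, and let $D\in\mathbb C^{n\times n}$ and $M\in\mathbb C^{q\times q}$ be Hermitian. Assume $A\neq 0$ and $BMB^*\neq 0$. For $X\in\mathbb C^{p\times m}$ put $$\phi(X)=(AXB+C)M(AXB+C)^*+D .$$ Write $r$ for rank, $\mathscr R$ for column space, and $i_+(H)$, $i_-(H)$ for the numbers of positive and negative eigenvalues, counted with multiplicity, of a Hermitian matrix $H$; $\succ0,\succcurlyeq0,\prec0,\preccurlyeq0$ mean Hermitian positive definite, positive semidefinite, negative definite, negative semidefinite. Put $P=D+CMC^*$, $N_0=[\,P,\ CMB^*,\ A\,]$ and $$N_1=\begin{bmatrix}P&A\\A^*&0\end{bmatrix},\quad N_2=\begin{bmatrix}P&CMB^*&A\\A^*&0&0\end{bmatrix},\quad N_3=\begin{bmatrix}P&CMB^*\\BMC^*&BMB^*\end{bmatrix},\quad N_4=\begin{bmatrix}P&CMB^*&A\\BMC^*&BMB^*&0\end{bmatrix}.$$ Then the following hold, where $X$ ranges over $\mathbb C^{p\times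 m}$. (a) There is an $X$ with $\phi(X)$ nonsingular if and only if $r(N_0)=n$, $r(N_1)\ge n$ and $r(N_3)\ge n$. (b) $\phi(X)$ is nonsingular for all $X$ if and only if $r(P)=n$ and at least one of the following holds: (i) $BMC^*P^{-1}A=0$ and $A^*P^{-1}A=0$; (ii) $BMC^*P^{-1}A=0$ and $BMC^*P^{-1}CMB^*=BMB^*$; (iii) $A^*P^{-1}A\succcurlyeq0$, $BMB^*-BMC^*P^{-1}CMB^*\succcurlyeq0$, $\mathscr R(A^*P^{-1}CMB^*)\subseteq\mathscr R(A^*P^{-1}A)$ and $\mathscr R(BMC^*P^{-1}A)\subseteq\mathscr R(BMB^*-BMC^*P^{-1}CMB^*)$; (iv) $A^*P^{-1}A\preccurlyeq0$, $BMB^*-BMC^*P^{-1}CMB^*\preccurlyeq0$, $\mathscr R(A^*P^{-1}CMB^*)\subseteq\mathscr R(A^*P^{-1}A)$ and $\mathscr R(BMC^*P^{-1}A)\subseteq\mathscr R(BMB^*-BMC^*P^{-1}CMB^*)$. (c) There is an $X$ with $\phi(X)=0$ if and only if $\mathscr R(P)\subseteq\mathscr R[\,A,\ CMB^*\,]$,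 $r(N_1)=2r(A)$, $2r[\,A,\ CMB^*\,]+r(N_3)-2r(N_4)\le0$, $r[\,A,\ CMB^*\,]+i_+(N_3)-r(N_4)\le0$ and $r[\,A,\ CMB^*\,]+i_-(N_3)-r(N_4)\le0$. (d) There is an $X$ with $\phi(X)\succ0$ if and only if either $i_+(N_1)=n$ and $i_+(N_3)\ge n$, or $i_+(N_1)\ge n$ and $i_+(N_3)=n$. (e) There is an $X$ with $\phi(X)\prec0$ if and only if either $i_-(N_1)=n$ and $i_-(N_3)\ge n$, or $i_-(N_1)\ge n$ and $i_-(N_3)=n$. (f) $\phi(X)\succ0$ for all $X$ if and only if $P\succ0$, $N_3\succcurlyeq0$ and $\mathscr R\begin{bmatrix}A\\0\end{bmatrix}\subseteq\mathscr R(N_3)$. (g) $\phi(X)\prec0$ for all $X$ if and only if $P\prec0$, $N_3\preccurlyeq0$ and $\mathscr R\begin{bmatrix}A\\0\end{bmatrix}\subseteq\mathscr R(N_3)$. (h) There is an $X$ with $\phi(X)\succcurlyeq0$ if and only if $r(N_0)+i_-(N_1)\le r(N_2)$ and $r(N_0)+i_-(N_3)\le r(N_4)$. (i) There is an $X$ with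 $\phi(X)\preccurlyeq0$ if and only if $r(N_0)+i_+(N_1)\le r(N_2)$ and $r(N_0)+i_+(N_3)\le r(N_4)$. (j) $\phi(X)\succcurlyeq0$ for all $X$ if and only if $N_3\succcurlyeq0$. (k) $\phi(X)\preccurlyeq0$ for all $X$ if and only if $N_3\preccurlyeq0$. -/

import Mathlib

open scoped Matrix ComplexOrder

namespace QuadMat

/-- The positive partial inertia `i₊(H)`: the number of positive eigenvalues of the Hermitian
matrix `H`, counted with multiplicity. -/
noncomputable def posInertia {ι : Type*} [Fintype ι] [DecidableEq ι] {H : Matrix ι ι ℂ}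
    (hH : H.IsHermitian) : ℕ :=
  (Finset.univ.filter fun i => 0 < hH.eigenvalues i).card

/-- The negative partial inertia `i₋(H)`: the number of negative eigenvalues of the Hermitian
matrix `H`, counted with multiplicity. -/
noncomputable def negInertia {ι : Type*} [Fintype ι] [DecidableEq ι] {H : Matrix ι ι ℂ}
    (hH : H.IsHermitian) : ℕ :=
  (Finset.univ.filter fun i => hH.eigenvalues i < 0).card

/-- The column space of a complex matrix. -/
def colSpace {ι κ : Type*} [Fintype κ] (S : Matrix ι κ ℂ) : Submodule ℂ (ι → ℂ) :=
  LinearMap.range S.mulVecLin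

/-- `S ≻ 0`. -/
abbrev IsPD {ι : Type*} (S : Matrix ι ι ℂ) : Prop := S.PosDef

/-- `S ≽ 0`. -/
abbrev IsPSD {ι : Type*} (S : Matrix ι ι ℂ) : Prop := S.PosSemidef

/-- `S ≺ 0`. -/
abbrev IsND {ι : Type*} (S : Matrix ι ι ℂ) : Prop := (-S).PosDef

/-- `S ≼ 0`. -/
abbrev IsNSD {ι : Type*} (S : Matrix ι ι ℂ) : Prop := (-S).PosSemidef

variable {n p m q : ℕ}

/-- The quadratic matrix-valued function `φ(X) = (AXB + C) M (AXB + C)* + D`. -/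
def phi (A : Matrix (Fin n) (Fin p) ℂ) (B : Matrix (Fin m) (Fin q) ℂ)
    (C : Matrix (Fin n) (Fin q) ℂ) (D : Matrix (Fin n) (Fin n) ℂ) (M : Matrix (Fin q) (Fin q) ℂ)
    (X : Matrix (Fin p) (Fin m) ℂ) : Matrix (Fin n) (Fin n) ℂ :=
  (A * X * B + C) * M * (A * X * B + C)ᴴ + D

/-- The row block matrix `[D + CMC*, CMB*, A]`. -/
def N0 (A : Matrix (Fin n) (Fin p) ℂ) (B : Matrix (Fin m) (Fin q) ℂ)
    (C : Matrix (Fin n) (Fin q) ℂ) (D : Matrix (Fin n) (Fin n) ℂ) (M : Matrix (Fin q) (Fin q) ℂ) :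
    Matrix (Fin n) ((Fin n ⊕ Fin m) ⊕ Fin p) ℂ :=
  Matrix.fromCols (Matrix.fromCols (D + C * M * Cᴴ) (C * M * Bᴴ)) A

/-- `N₁ = [[D + CMC*, A], [A*, 0]]`. -/
def N1 (A : Matrix (Fin n) (Fin p) ℂ) (C : Matrix (Fin n) (Fin q) ℂ)
    (D : Matrix (Fin n) (Fin n) ℂ) (M : Matrix (Fin q) (Fin q) ℂ) :
    Matrix (Fin n ⊕ Fin p) (Fin n ⊕ Fin p) ℂ :=
  Matrix.fromBlocks (D + C * M * Cᴴ) A Aᴴ 0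

/-- `N₂ = [[D + CMC*, CMB*, A], [A*, 0, 0]]`. -/
def N2 (A : Matrix (Fin n) (Fin p) ℂ) (B : Matrix (Fin m) (Fin q) ℂ)
    (C : Matrix (Fin n) (Fin q) ℂ) (D : Matrix (Fin n) (Fin n) ℂ) (M : Matrix (Fin q) (Fin q) ℂ) :
    Matrix (Fin n ⊕ Fin p) ((Fin n ⊕ Fin m) ⊕ Fin p) ℂ :=
  Matrix.fromRows (N0 A B C D M) (Matrix.fromCols (Matrix.fromCols Aᴴ 0) 0)

/-- `N₃ = [[D + CMC*, CMB*], [BMC*, BMB*]]`. -/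
def N3 (B : Matrix (Fin m) (Fin q) ℂ) (C : Matrix (Fin n) (Fin q) ℂ)
    (D : Matrix (Fin n) (Fin n) ℂ) (M : Matrix (Fin q) (Fin q) ℂ) :
    Matrix (Fin n ⊕ Fin m) (Fin n ⊕ Fin m) ℂ :=
  Matrix.fromBlocks (D + C * M * Cᴴ) (C * M * Bᴴ) (B * M * Cᴴ) (B * M * Bᴴ)

/-- `N₄ = [[D + CMC*, CMB*, A], [BMC*, BMB*, 0]]`. -/
def N4 (A : Matrix (Fin n) (Fin p) ℂ) (B : Matrix (Fin m) (Fin q) ℂ)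
    (C : Matrix (Fin n) (Fin q) ℂ) (D : Matrix (Fin n) (Fin n) ℂ) (M : Matrix (Fin q) (Fin q) ℂ) :
    Matrix (Fin n ⊕ Fin m) ((Fin n ⊕ Fin m) ⊕ Fin p) ℂ :=
  Matrix.fromRows (N0 A B C D M)
    (Matrix.fromCols (Matrix.fromCols (B * M * Cᴴ) (B * M * Bᴴ)) 0)

theorem isHermitian_N1 (A : Matrix (Fin n) (Fin p) ℂ) (C : Matrix (Fin n) (Fin q) ℂ)
    {D : Matrix (Fin n) (Fin n) ℂ} {M : Matrix (Fin q) (Fin q) ℂ}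
    (hD : D.IsHermitian) (hM : M.IsHermitian) : (N1 A C D M).IsHermitian :=
  Matrix.IsHermitian.fromBlocks (hD.add (Matrix.isHermitian_mul_mul_conjTranspose C hM)) rfl
    Matrix.isHermitian_zero

theorem isHermitian_N3 (B : Matrix (Fin m) (Fin q) ℂ) (C : Matrix (Fin n) (Fin q) ℂ)
    {D : Matrix (Fin n) (Fin n) ℂ} {M : Matrix (Fin q) (Fin q) ℂ}
    (hD : D.IsHermitian) (hM : M.IsHermitian) : (N3 B C D M).IsHermitian :=
  Matrix.IsHermitian.fromBlocks (hD.add (Matrix.isHermitian_mul_mul_conjTranspose C hM))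
    (by simp [Matrix.conjTranspose_mul, hM.eq, Matrix.mul_assoc])
    (Matrix.isHermitian_mul_mul_conjTranspose B hM)

end QuadMat

open QuadMat

set_option linter.unusedSectionVars false

/-! ### Hermitian forms: orthogonality, definiteness and dimension counts. -/

namespace QuadMat

open Module

variable {V : Type*} [AddCommGroup V] [Module ℂ V]

/-! Write `P = D + CMC*`, `R = CMB*`, `Q = BMB*`. Then `φ(X) = P + AXR* + RX*A* + AXQX*A*` equals
`[I; (AX)*]* N₃ [I; (AX)*]` (`graphMat_congr`): it is the Hermitian form of `N₃` restricted to the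
graph of `(AX)*`. As `X` varies, these graphs are exactly the complements of `W = {(0, w)}` that
contain `K = {(v, 0) : A*v = 0}` (`spaceK_le_graph`, `graph_inf_spaceW`, `exists_graph`). So (c),
(d), (e), (h), (i) ask when such a complement exists on which a given form is zero, definite or
semidefinite.

Definite: `K` must be definite and the inertia of `N₃` large enough; then `K` can be enlarged one
vector at a time (`exists_posOn_complement`). Semidefinite or zero: one first splits off `K` by
passing to its orthogonal subspace, then cuts by hyperplanes `u^⊥`, with `u` negative or isotropic
and not orthogonal to `W`, until `W` is used up (`exists_nonnegOn_complement_rel`,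
`exists_isoOn_complement_rel`).

The conditions become ranks and inertias because inertia is the largest dimension of a definite
subspace, and because the ranks of `N₀`, `N₂`, `N₄` measure the intersections of `K` and `K + W`
with orthogonal subspaces. In `N₁` the vectors `(0, y)` form an isotropic subspace whose orthogonal
subspace is `{A*v = 0}`, so its inertia records the sign of `P` on the kernel of `A*`.

For (f), (g), (j), (k), every `x` with `A*` nonzero on its first component lies on some graph, and
since `A ≠ 0` the other vectors are limits of such `x`.

For (a), `X` and `X*` are decoupled into independent `X`, `Y`. The matrix is then affine in `X`, and
`exists_fullRowRank_add` applies repeatedly. A determinant that is a nonzero polynomial in one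
parameter brings back `Y = X*` (`exists_isUnit_quadMap_of_sesqMap`). For (b), eliminating the kernel
vector through `P⁻¹` leaves a system in `A*P⁻¹A`, `Q - R*P⁻¹R` and `A*P⁻¹R`; an energy identity and
rank-two choices of `X` settle it (`isUnit_quadMap_iff`, `forall_isUnit_iff`). -/

/-- A sesquilinear form is Hermitian. -/
def IsHerm (h : V →ₗ⋆[ℂ] V →ₗ[ℂ] ℂ) : Prop := ∀ x y, star (h x y) = h y x

/-- The orthogonal subspace of `S` with respect to `h`. -/
def perp (h : V →ₗ⋆[ℂ] V →ₗ[ℂ] ℂ) (S : Submodule ℂ V) : Submodule ℂ V where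
  carrier := {x | ∀ s ∈ S, h s x = 0}
  add_mem' ha hb s hs := by simp [ha s hs, hb s hs]
  zero_mem' s _ := by simp
  smul_mem' c x hx s hs := by simp [hx s hs]

/-- `h` is positive definite on `S`. -/
def PosOn (h : V →ₗ⋆[ℂ] V →ₗ[ℂ] ℂ) (S : Submodule ℂ V) : Prop := ∀ x ∈ S, x ≠ 0 → 0 < (h x x).re

/-- `h` is positive semidefinite on `S`. -/
def NonnegOn (h : V →ₗ⋆[ℂ] V →ₗ[ℂ] ℂ) (S : Submodule ℂ V) : Prop := ∀ x ∈ S, 0 ≤ (h x x).re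

variable {h : V →ₗ⋆[ℂ] V →ₗ[ℂ] ℂ}

theorem mem_perp {S : Submodule ℂ V} {x : V} : x ∈ perp h S ↔ ∀ s ∈ S, h s x = 0 := Iff.rfl

theorem IsHerm.neg (hs : IsHerm h) : IsHerm (-h) := fun x y => by simp [← hs y x]

theorem IsHerm.eq_zero_comm (hs : IsHerm h) {x y : V} (H : h x y = 0) : h y x = 0 := by
  rw [← hs, H, star_zero]

theorem IsHerm.re_comm (hs : IsHerm h) (x y : V) : (h x y).re = (h y x).re := by
  rw [← hs x y]; simp

theorem IsHerm.self_eq (hs : IsHerm h) (x : V) : h x x = ((h x x).re : ℂ) := by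
  have := hs x x
  exact (Complex.conj_eq_iff_real.1 this).elim fun r hr => by rw [hr]; simp

theorem perp_neg : perp (-h) = perp h := by
  funext S; ext x; simp [mem_perp]

theorem perp_anti {S T : Submodule ℂ V} (H : S ≤ T) : perp h T ≤ perp h S :=
  fun _ hx s hs => hx s (H hs)

theorem perp_sup (S T : Submodule ℂ V) : perp h (S ⊔ T) = perp h S ⊓ perp h T := by
  apply le_antisymm (le_inf (perp_anti le_sup_left) (perp_anti le_sup_right))
  rintro x ⟨h1, h2⟩ s hs
  obtain ⟨a, ha, b, hb, rfl⟩ := Submodule.mem_sup.1 hs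
  simp [h1 a ha, h2 b hb]

theorem mem_perp_span {u x : V} : x ∈ perp h (ℂ ∙ u) ↔ h u x = 0 := by
  refine ⟨fun H => H u (Submodule.mem_span_singleton_self u), fun H s hs => ?_⟩
  obtain ⟨c, rfl⟩ := Submodule.mem_span_singleton.1 hs
  simp [H]

theorem IsHerm.le_perp_comm (hs : IsHerm h) {S T : Submodule ℂ V} (H : S ≤ perp h T) :
    T ≤ perp h S := fun _ ht _ hs' => hs.eq_zero_comm (H hs' _ ht)

theorem IsHerm.re_add (hs : IsHerm h) (x y : V) :
    (h (x + y) (x + y)).re = (h x x).re + 2 * (h x y).re + (h y y).re := by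
  have := hs.re_comm x y
  simp only [map_add, LinearMap.add_apply, Complex.add_re]
  linarith

theorem re_real_smul (t : ℝ) (x y : V) : (h x ((t : ℂ) • y)).re = t * (h x y).re := by
  simp

theorem IsHerm.re_add_smul (hs : IsHerm h) (x y : V) (t : ℝ) :
    (h (x + (t : ℂ) • y) (x + (t : ℂ) • y)).re
      = (h x x).re + 2 * t * (h x y).re + t ^ 2 * (h y y).re := by
  rw [hs.re_add, re_real_smul, re_real_smul, hs.re_comm ((t : ℂ) • y) y, re_real_smul]
  ring

theorem PosOn.nonnegOn {S : Submodule ℂ V} (H : PosOn h S) : NonnegOn h S := fun x hx => by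
  by_cases h0 : x = 0
  · simp [h0]
  · exact (H x hx h0).le

theorem PosOn.mono {S T : Submodule ℂ V} (H : PosOn h T) (hST : S ≤ T) : PosOn h S :=
  fun x hx => H x (hST hx)

theorem NonnegOn.mono {S T : Submodule ℂ V} (H : NonnegOn h T) (hST : S ≤ T) : NonnegOn h S :=
  fun x hx => H x (hST hx)

theorem PosOn.inf_eq_bot {S T : Submodule ℂ V} (H : PosOn h S) (H' : NonnegOn (-h) T) :
    S ⊓ T = ⊥ := by
  rw [eq_bot_iff]
  rintro x ⟨h1, h2⟩
  by_contra h0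
  have := H x h1 h0
  have := H' x h2
  simp at this
  linarith

/-- The equality case of Cauchy–Schwarz: if `h x y` were nonzero, moving `x` slightly in the
direction of a multiple of `y` would make the form negative. -/
theorem NonnegOn.apply_eq_zero (hs : IsHerm h) {S : Submodule ℂ V} (H : NonnegOn h S) {x y : V}
    (hx : x ∈ S) (hy : y ∈ S) (h0 : (h x x).re = 0) : h x y = 0 := by
  by_contra hc
  set c := h x y
  have hq := H y hy
  have hpos : 0 < Complex.normSq c := Complex.normSq_pos.2 hc
  set q := (h y y).re
  have key : ∀ ε : ℝ, 0 ≤ -2 * ε * Complex.normSq c + ε ^ 2 * Complex.normSq c * q := by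
    intro ε
    have := H (x + (-(ε : ℂ) * star c) • y) (S.add_mem hx (S.smul_mem _ hy))
    rw [hs.re_add, h0] at this
    have e1 : (h x ((-(ε : ℂ) * star c) • y)).re = - ε * Complex.normSq c := by
      simp [c, Complex.normSq_apply]; ring
    have e2 : (h ((-(ε : ℂ) * star c) • y) ((-(ε : ℂ) * star c) • y)).re
        = ε ^ 2 * Complex.normSq c * q := by
      simp only [map_smulₛₗ, LinearMap.smul_apply, smul_eq_mul]
      rw [hs.self_eq y]
      simp [Complex.normSq_apply, q]; ring
    rw [e1, e2] at this
    linarith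
  -- With this `ε` the factor `-2ε + ε²q` equals `-(2 + q)/(1 + q)²`, which is negative since `q ≥
  -- 0`.
  have h1 := key (1 / (1 + q))
  have : 0 < 1 + q := by linarith
  have e : -2 * (1 / (1 + q)) * Complex.normSq c + (1 / (1 + q)) ^ 2 * Complex.normSq c * q
      = Complex.normSq c / (1 + q) ^ 2 * (-2 - q) := by field_simp; ring
  rw [e] at h1
  have : 0 < Complex.normSq c / (1 + q) ^ 2 := by positivity
  nlinarith

theorem PosOn.sup (hs : IsHerm h) {S T : Submodule ℂ V} (HS : PosOn h S) (HT : PosOn h T)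
    (hp : T ≤ perp h S) : PosOn h (S ⊔ T) := by
  intro x hx h0
  obtain ⟨a, ha, b, hb, rfl⟩ := Submodule.mem_sup.1 hx
  rw [hs.re_add, hp hb a ha]
  by_cases ha0 : a = 0
  · subst ha0
    simpa using HT b hb (by simpa using h0)
  · have := HS a ha ha0
    have := HT.nonnegOn b hb
    simp; linarith

theorem NonnegOn.sup (hs : IsHerm h) {S T : Submodule ℂ V} (HS : NonnegOn h S) (HT : NonnegOn h T)
    (hp : T ≤ perp h S) : NonnegOn h (S ⊔ T) := by
  intro x hx
  obtain ⟨a, ha, b, hb, rfl⟩ := Submodule.mem_sup.1 hx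
  rw [hs.re_add, hp hb a ha]
  have := HS a ha
  have := HT b hb
  simp; linarith

theorem PosOn.inf_perp {S : Submodule ℂ V} (HS : PosOn h S) : S ⊓ perp h S = ⊥ := by
  rw [eq_bot_iff]
  rintro x ⟨h1, h2⟩
  by_contra h0
  have := HS x h1 h0
  rw [h2 x h1] at this
  simp at this

theorem posOn_span (hs : IsHerm h) {u : V} (hu : 0 < (h u u).re) : PosOn h (ℂ ∙ u) := by
  intro x hx h0
  obtain ⟨c, rfl⟩ := Submodule.mem_span_singleton.1 hx
  have hc : c ≠ 0 := by rintro rfl; simp at h0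
  have e : (h (c • u) (c • u)).re = Complex.normSq c * (h u u).re := by
    simp only [map_smulₛₗ, LinearMap.smul_apply, smul_eq_mul]
    rw [hs.self_eq u]
    simp [Complex.normSq_apply]; ring
  rw [e]
  exact mul_pos (Complex.normSq_pos.2 hc) hu

theorem exists_relative_complement {A K : Submodule ℂ V} (hAK : A ≤ K) :
    ∃ K' ≤ K, A ⊓ K' = ⊥ ∧ A ⊔ K' = K := by
  obtain ⟨C, hC⟩ := exists_isCompl A
  refine ⟨K ⊓ C, inf_le_left, ?_, ?_⟩
  · rw [eq_bot_iff, ← hC.inf_eq_bot]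
    exact inf_le_inf_left _ inf_le_right
  · rw [inf_comm, ← sup_inf_assoc_of_le _ hAK, hC.sup_eq_top, top_inf_eq]

variable [FiniteDimensional ℂ V]

theorem finrank_sup_of_inf_eq_bot {S T : Submodule ℂ V} (H : S ⊓ T = ⊥) :
    finrank ℂ ↥(S ⊔ T) = finrank ℂ S + finrank ℂ T := by
  have := Submodule.finrank_sup_add_finrank_inf_eq S T
  rwa [H, finrank_bot, add_zero] at this

theorem finrank_add_le_of_inf_eq_bot {S T : Submodule ℂ V} (H : S ⊓ T = ⊥) :
    finrank ℂ S + finrank ℂ T ≤ finrank ℂ V := by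
  rw [← finrank_sup_of_inf_eq_bot H]; exact Submodule.finrank_le _

/-- The pairing of `S` with `K` has one rank, whether computed from the left or from the right; this
is one inequality, and exchanging `S` and `K` gives the other. -/
theorem finrank_inf_perp_ge (hs : IsHerm h) (S K : Submodule ℂ V) :
    finrank ℂ S + finrank ℂ ↥(K ⊓ perp h S) ≤ finrank ℂ ↥(S ⊓ perp h K) + finrank ℂ K := by
  obtain ⟨K', hK', hinf, hsup⟩ := exists_relative_complement (inf_le_left : K ⊓ perp h S ≤ K)
  have hd := finrank_sup_of_inf_eq_bot hinf
  rw [hsup] at hd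
  -- The part of `K` orthogonal to `S` imposes no condition on `S`, so `dim K'` equations already
  -- cut out `S ⊓ perp h K`.
  let b := Module.finBasis ℂ K'
  let f : S →ₗ[ℂ] (Fin (finrank ℂ K') → ℂ) :=
    LinearMap.pi fun i => (h (b i : V)).comp S.subtype
  have hf := f.finrank_range_add_finrank_ker
  have hr : finrank ℂ (LinearMap.range f) ≤ finrank ℂ K' := by
    simpa using Submodule.finrank_le (LinearMap.range f)
  have hk : finrank ℂ (LinearMap.ker f) ≤ finrank ℂ ↥(S ⊓ perp h K) := by
    rw [(LinearEquiv.finrank_eq (Submodule.equivMapOfInjective S.subtype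
      S.injective_subtype (LinearMap.ker f)) :)]
    apply Submodule.finrank_mono
    rintro _ ⟨x, hx, rfl⟩
    refine ⟨x.2, ?_⟩
    have h1 : ∀ i, h (b i : V) x = 0 := fun i => congrFun (LinearMap.mem_ker.1 hx) i
    have h2 : K' ≤ perp h (ℂ ∙ (x : V)) := by
      have : K' = (⊤ : Submodule ℂ K').map K'.subtype := by simp
      rw [this, ← b.span_eq, Submodule.map_span, Submodule.span_le]
      rintro _ ⟨_, ⟨i, rfl⟩, rfl⟩
      exact mem_perp_span.2 (hs.eq_zero_comm (h1 i))
    rw [← hsup, perp_sup]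
    refine ⟨fun k hk => hs.eq_zero_comm (hk.2 x x.2), fun k hk => ?_⟩
    exact hs.eq_zero_comm (mem_perp_span.1 (h2 hk))
  omega

theorem finrank_inf_perp (hs : IsHerm h) (S K : Submodule ℂ V) :
    finrank ℂ ↥(S ⊓ perp h K) + finrank ℂ K = finrank ℂ S + finrank ℂ ↥(K ⊓ perp h S) :=
  le_antisymm (by have := finrank_inf_perp_ge hs K S; omega) (finrank_inf_perp_ge hs S K)

theorem finrank_perp (hs : IsHerm h) (K : Submodule ℂ V) :
    finrank ℂ ↥(perp h K) + finrank ℂ K = finrank ℂ V + finrank ℂ ↥(K ⊓ perp h ⊤) := by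
  have := finrank_inf_perp hs ⊤ K
  rwa [top_inf_eq, finrank_top] at this

theorem perp_perp (hs : IsHerm h) (K : Submodule ℂ V) : perp h (perp h K) = K ⊔ perp h ⊤ := by
  symm
  apply Submodule.eq_of_le_of_finrank_eq
  · exact sup_le (hs.le_perp_comm le_rfl) (perp_anti le_top)
  · have h1 := finrank_perp hs K
    have h2 := finrank_perp hs (perp h K)
    have h3 := Submodule.finrank_sup_add_finrank_inf_eq K (perp h ⊤)
    have h4 : perp h K ⊓ perp h ⊤ = perp h ⊤ := inf_eq_right.2 (perp_anti le_top)
    rw [h4] at h2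
    omega

theorem finrank_inf_perp_span (hs : IsHerm h) {S : Submodule ℂ V} {u : V} (hu : u ∉ perp h S) :
    finrank ℂ ↥(S ⊓ perp h (ℂ ∙ u)) + 1 = finrank ℂ S := by
  have h1 := finrank_inf_perp hs S (ℂ ∙ u)
  have hu0 : u ≠ 0 := by rintro rfl; exact hu (Submodule.zero_mem _)
  have h2 : (ℂ ∙ u) ⊓ perp h S = ⊥ := by
    rw [eq_bot_iff]
    rintro x ⟨h1, h2⟩
    obtain ⟨c, rfl⟩ := Submodule.mem_span_singleton.1 h1
    by_cases hc : c = 0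
    · simp [hc]
    · exact absurd ((Submodule.smul_mem_iff _ hc).1 h2) hu
  rw [h2, finrank_bot, finrank_span_singleton hu0] at h1
  omega

/-- A subspace on which `h` is positive definite extends to one that also accounts for an isotropic
subspace orthogonal to it. -/
theorem exists_posOn_of_isotropic (hs : IsHerm h) {Z U I : Submodule ℂ V} (hU : U ≤ Z)
    (hpos : PosOn h U) (hI : I ≤ Z) (hiso : ∀ x ∈ I, (h x x).re = 0) (hIU : I ≤ perp h U) :
    ∃ T ≤ Z, PosOn h T ∧
      finrank ℂ U + finrank ℂ I ≤ finrank ℂ T + finrank ℂ ↥(I ⊓ perp h Z) := by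
  classical
  -- `T` is taken of maximal dimension among positive definite subspaces between `U` and `Z`.
  let p : ℕ → Prop := fun d => ∃ T ≤ Z, U ≤ T ∧ PosOn h T ∧ finrank ℂ T = d
  have hbd : ∀ d, p d → d ≤ finrank ℂ V := by
    rintro _ ⟨T, _, _, _, rfl⟩; exact Submodule.finrank_le T
  have hp0 : p (finrank ℂ U) := ⟨U, hU, le_rfl, hpos, rfl⟩
  obtain ⟨T, hTZ, hUT, hT, hTd⟩ := Nat.findGreatest_spec (hbd _ hp0) hp0
  have hmax : ∀ T', T' ≤ Z → U ≤ T' → PosOn h T' → finrank ℂ T' ≤ finrank ℂ T := by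
    intro T' h1 h2 h3
    rw [hTd]
    exact Nat.le_findGreatest (hbd _ ⟨T', h1, h2, h3, rfl⟩) ⟨T', h1, h2, h3, rfl⟩
  refine ⟨T, hTZ, hT, ?_⟩
  -- A positive vector here could be added to `T`, against maximality.
  have hneg : NonnegOn (-h) (Z ⊓ perp h T) := by
    rintro x ⟨hxZ, hxT⟩
    by_contra hx
    simp only [LinearMap.neg_apply, Complex.neg_re, not_le, Left.neg_neg_iff] at hx
    have hle : (ℂ ∙ x) ≤ perp h T := by simpa using hxT
    have h1 := hmax (T ⊔ ℂ ∙ x) (sup_le hTZ (by simpa using hxZ)) (hUT.trans le_sup_left)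
      (hT.sup hs (posOn_span hs hx) hle)
    have hx0 : x ≠ 0 := by rintro rfl; simp at hx
    rw [finrank_sup_of_inf_eq_bot, finrank_span_singleton hx0] at h1
    · omega
    · rw [eq_bot_iff, ← hT.inf_perp]; exact inf_le_inf_left _ hle
  -- An isotropic vector of the semidefinite space `Z ⊓ perp h T` is orthogonal to that space; being
  -- orthogonal to `T` too, it is orthogonal to `Z = T ⊔ (Z ⊓ perp h T)`.
  have hker : I ⊓ perp h T ≤ I ⊓ perp h Z := by
    rintro x ⟨hxI, hxT⟩
    refine ⟨hxI, fun z hz => ?_⟩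
    apply hs.eq_zero_comm
    have hd := finrank_inf_perp hs Z T
    have hTZ' : T ⊓ perp h Z = ⊥ := by
      rw [eq_bot_iff, ← hT.inf_perp]; exact inf_le_inf_left _ (perp_anti hTZ)
    have hinf : T ⊓ (Z ⊓ perp h T) = ⊥ := by
      rw [eq_bot_iff, ← hT.inf_perp]; exact inf_le_inf_left _ inf_le_right
    have hsup : T ⊔ (Z ⊓ perp h T) = Z := by
      apply Submodule.eq_of_le_of_finrank_eq (sup_le hTZ inf_le_left)
      rw [finrank_sup_of_inf_eq_bot hinf]
      rw [hTZ', finrank_bot] at hd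
      omega
    rw [← hsup] at hz
    obtain ⟨a, ha, b, hb, rfl⟩ := Submodule.mem_sup.1 hz
    have h1 := hneg.apply_eq_zero hs.neg (x := x) (y := b) ⟨hI hxI, hxT⟩ hb
      (by simp [hiso x hxI])
    simp only [LinearMap.neg_apply, neg_eq_zero] at h1
    simp [h1, hs.eq_zero_comm (hxT a ha)]
  have h1 := Submodule.finrank_mono hker
  have h2 := finrank_inf_perp hs I T
  have h3 := Submodule.finrank_mono (le_inf hUT (hs.le_perp_comm hIU))
  omega

end QuadMat

/-! ### Complements on which the form is definite or semidefinite. -/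

namespace QuadMat

open Module

variable {V : Type*} [AddCommGroup V] [Module ℂ V] {h : V →ₗ⋆[ℂ] V →ₗ[ℂ] ℂ}

theorem exists_pos_quadratic {a : ℝ} (ha : 0 < a) (b c : ℝ) :
    ∃ t : ℝ, t ≠ 0 ∧ 0 < a + 2 * t * b + t ^ 2 * c := by
  have hs : 0 < a + 2 * |b| + |c| := by positivity
  set s := a + 2 * |b| + |c| with hsd
  have ht : 0 < a / s := by positivity
  have hts : a / s * s = a := by field_simp
  have ht1 : a / s ≤ 1 := by
    rw [div_le_one hs]; have := abs_nonneg b; have := abs_nonneg c; linarith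
  -- Since `t = a/s ≤ 1`, the value is at least `a - t(2|b| + |c|) = a - t(s - a) = ta > 0`.
  refine ⟨a / s, ht.ne', ?_⟩
  set t := a / s
  have h1 : t ^ 2 * |c| ≤ t * |c| := by
    apply mul_le_mul_of_nonneg_right _ (abs_nonneg c); nlinarith
  have h2 : -(t ^ 2 * |c|) ≤ t ^ 2 * c := by
    have := mul_le_mul_of_nonneg_left (neg_abs_le c) (sq_nonneg t); linarith
  have h3 : -(t * |b|) ≤ t * b := by
    have := mul_le_mul_of_nonneg_left (neg_abs_le b) ht.le; linarith
  have h4 : 0 < t * a := by positivity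
  rw [hsd] at hts
  nlinarith

/-- Positivity is an open condition, so a positive vector can be pushed off a proper subspace. -/
theorem exists_pos_notMem (hs : IsHerm h) {y z : V} {L : Submodule ℂ V} (hy : 0 < (h y y).re)
    (hz : z ∉ L) : ∃ t : ℝ, 0 < (h (y + (t : ℂ) • z) (y + (t : ℂ) • z)).re ∧
      y + (t : ℂ) • z ∉ L := by
  by_cases hyL : y ∈ L
  · obtain ⟨t, ht, H⟩ := exists_pos_quadratic hy (h y z).re (h z z).re
    refine ⟨t, by rwa [hs.re_add_smul], fun hc => hz ?_⟩
    have := (Submodule.add_mem_iff_right L hyL).1 hc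
    exact (Submodule.smul_mem_iff _ (by exact_mod_cast ht)).1 this
  · exact ⟨0, by simpa using hy, by simpa using hyL⟩

theorem sup_span_inf_eq_bot {K W : Submodule ℂ V} {x : V} (hKW : K ⊓ W = ⊥) (hx : x ∉ K ⊔ W) :
    (K ⊔ ℂ ∙ x) ⊓ W = ⊥ := by
  rw [eq_bot_iff]
  rintro y ⟨h1, h2⟩
  obtain ⟨k, hk, b, hb, rfl⟩ := Submodule.mem_sup.1 h1
  obtain ⟨c, rfl⟩ := Submodule.mem_span_singleton.1 hb
  by_cases hc : c = 0
  · subst hc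
    rw [← hKW]
    exact ⟨by simpa using hk, h2⟩
  · refine absurd ((Submodule.smul_mem_iff _ hc).1 ?_) hx
    have : c • x = -k + (k + c • x) := by abel
    rw [this]
    exact Submodule.add_mem_sup (K.neg_mem hk) h2

/-- Since `h u u ≠ 0`, `Z` is the sum of the line of `u` and `Z ⊓ u^⊥`. A vector orthogonal to both
summands is orthogonal to `Z`, so the cut creates no new degenerate part in `W`. -/
theorem inf_perp_hyperplane_le {Z W : Submodule ℂ V} {u : V} (hu : u ∈ Z)
    (huu : h u u ≠ 0) :
    (W ⊓ perp h (ℂ ∙ u)) ⊓ perp h (Z ⊓ perp h (ℂ ∙ u)) ≤ W ⊓ perp h Z := by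
  rintro x ⟨⟨hxW, hxu⟩, hx⟩
  refine ⟨hxW, fun z hz => ?_⟩
  have h1 : z - (h u z / h u u) • u ∈ Z ⊓ perp h (ℂ ∙ u) := by
    refine ⟨Z.sub_mem hz (Z.smul_mem _ hu), mem_perp_span.2 ?_⟩
    simp [huu]
  have h2 := hx _ h1
  simpa [mem_perp_span.1 hxu] using h2

theorem exists_notMem_perp (hs : IsHerm h) {Z W : Submodule ℂ V}
    (hd : finrank ℂ ↥(W ⊓ perp h Z) < finrank ℂ W) : ∃ y ∈ Z, y ∉ perp h W := by
  by_contra hc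
  push Not at hc
  have : W ⊓ perp h Z = W := inf_eq_left.2 (hs.le_perp_comm hc)
  rw [this] at hd
  exact lt_irrefl _ hd

variable [FiniteDimensional ℂ V]

/-- A positive definite subspace `K` disjoint from `W` extends to a positive definite complement of
`W` as soon as some positive definite subspace is large enough. -/
theorem exists_posOn_complement (hs : IsHerm h) {K W U : Submodule ℂ V} (hK : PosOn h K)
    (hKW : K ⊓ W = ⊥) (hU : PosOn h U) (hd : finrank ℂ V ≤ finrank ℂ U + finrank ℂ W) :
    ∃ G, K ≤ G ∧ PosOn h G ∧ G ⊓ W = ⊥ ∧ finrank ℂ G + finrank ℂ W = finrank ℂ V := by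
  have hle := finrank_add_le_of_inf_eq_bot hKW
  induction he : finrank ℂ V - (finrank ℂ K + finrank ℂ W) generalizing K with
  | zero => exact ⟨K, le_rfl, hK, hKW, by omega⟩
  | succ e ih =>
    have h1 := finrank_inf_perp hs U K
    -- As `K` and `W` do not yet fill the space, `dim K < dim U`, so `U` contains a nonzero, hence
    -- positive, vector orthogonal to `K`.
    obtain ⟨y, ⟨hyU, hyK⟩, hy0⟩ := Submodule.exists_mem_ne_zero_of_ne_bot
      (p := U ⊓ perp h K) (fun hb => by rw [hb, finrank_bot] at h1; omega)
    have hKker : K ⊓ perp h ⊤ = ⊥ := by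
      rw [eq_bot_iff, ← hK.inf_perp]; exact inf_le_inf_left _ (perp_anti le_top)
    have h2 := finrank_perp hs K
    rw [hKker, finrank_bot] at h2
    have htop : K ⊔ perp h K = ⊤ := by
      apply Submodule.eq_top_of_finrank_eq
      rw [finrank_sup_of_inf_eq_bot hK.inf_perp]; omega
    -- Definiteness of `K` gives `K ⊔ perp h K = ⊤`, so `perp h K` cannot lie inside the proper
    -- subspace `K ⊔ W`. Adding a multiple of `z` moves `y` off `K ⊔ W`.
    obtain ⟨z, hz, hzn⟩ : ∃ z ∈ perp h K, z ∉ K ⊔ W := by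
      by_contra hc
      push Not at hc
      have : K ⊔ W = ⊤ := by
        rw [eq_top_iff, ← htop]; exact sup_le le_sup_left hc
      have h3 := finrank_sup_of_inf_eq_bot hKW
      rw [this, finrank_top] at h3
      omega
    obtain ⟨t, ht, hn⟩ := exists_pos_notMem hs (hU y hyU hy0) hzn
    set x := y + (t : ℂ) • z
    have hx : x ∈ perp h K := Submodule.add_mem _ hyK (Submodule.smul_mem _ _ hz)
    have hxle : (ℂ ∙ x) ≤ perp h K := by simpa using hx
    have hx0 : x ≠ 0 := fun h0 => hn (h0 ▸ Submodule.zero_mem _)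
    have hinf : K ⊓ (ℂ ∙ x) = ⊥ := by
      rw [eq_bot_iff, ← hK.inf_perp]; exact inf_le_inf_left _ hxle
    have hfr := finrank_sup_of_inf_eq_bot hinf
    rw [finrank_span_singleton hx0] at hfr
    have hdis := sup_span_inf_eq_bot hKW hn
    obtain ⟨G, hG, hrest⟩ := ih (hK.sup hs (posOn_span hs ht) hxle) hdis
      (finrank_add_le_of_inf_eq_bot hdis) (by omega)
    exact ⟨G, le_sup_left.trans hG, hrest⟩

theorem PosOn.add_span (hs : IsHerm h) {U : Submodule ℂ V} {u : V} (hU : PosOn h U)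
    (hu : 0 < (h u u).re) (hUu : U ≤ perp h (ℂ ∙ u)) :
    PosOn h (U ⊔ ℂ ∙ u) ∧ finrank ℂ ↥(U ⊔ ℂ ∙ u) = finrank ℂ U + 1 := by
  have hle := hs.le_perp_comm hUu
  refine ⟨hU.sup hs (posOn_span hs hu) hle, ?_⟩
  have hu0 : u ≠ 0 := by rintro rfl; simp at hu
  rw [finrank_sup_of_inf_eq_bot, finrank_span_singleton hu0]
  rw [eq_bot_iff, ← hU.inf_perp]; exact inf_le_inf_left _ hle

/-- When `u` is not orthogonal to `W`, the hyperplane `u^⊥` removes one dimension from each of `W`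
and `Z`, so the codimension of `W` is unchanged. -/
theorem complement_of_hyperplane (hs : IsHerm h) {Z W G : Submodule ℂ V} {u : V} (hWZ : W ≤ Z)
    (hu : u ∉ perp h W) (hGZ : G ≤ Z ⊓ perp h (ℂ ∙ u))
    (hGW : G ⊓ (W ⊓ perp h (ℂ ∙ u)) = ⊥)
    (hd : finrank ℂ G + finrank ℂ ↥(W ⊓ perp h (ℂ ∙ u)) = finrank ℂ ↥(Z ⊓ perp h (ℂ ∙ u))) :
    G ≤ Z ∧ G ⊓ W = ⊥ ∧ finrank ℂ G + finrank ℂ W = finrank ℂ Z := by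
  refine ⟨hGZ.trans inf_le_left, ?_, ?_⟩
  · rw [eq_bot_iff, ← hGW]
    exact fun x hx => ⟨hx.1, hx.2, (hGZ hx.1).2⟩
  · have h1 := finrank_inf_perp_span hs hu
    have h2 := finrank_inf_perp_span hs (fun hc => hu (perp_anti hWZ hc))
    omega

/-- If `Z` has a negative vector, the bound forces `W` not to be orthogonal to `Z`, so there is a
negative `u` in `Z` that is not orthogonal to `W`. Cutting with `u^⊥` lowers `dim W` by one, and
every negative definite subspace of the cut gains a dimension from `u`, so the bound is inherited.
-/
theorem exists_nonnegOn_complement_rel (hs : IsHerm h) {Z W : Submodule ℂ V} (hWZ : W ≤ Z)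
    (hd : ∀ U ≤ Z, PosOn (-h) U → finrank ℂ U + finrank ℂ ↥(W ⊓ perp h Z) ≤ finrank ℂ W) :
    ∃ G ≤ Z, NonnegOn h G ∧ G ⊓ W = ⊥ ∧ finrank ℂ G + finrank ℂ W = finrank ℂ Z := by
  induction hw : finrank ℂ W generalizing Z W with
  | zero =>
    refine ⟨Z, le_rfl, ?_, ?_, by simp⟩
    · intro x hx
      by_contra hneg
      have hpos : 0 < ((-h) x x).re := by simpa using hneg
      have h1 := hd (ℂ ∙ x) (by simpa using hx) (posOn_span hs.neg hpos)
      have hx0 : x ≠ 0 := by rintro rfl; simp at hpos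
      rw [finrank_span_singleton hx0] at h1
      omega
    · rw [Submodule.finrank_eq_zero.1 hw, inf_bot_eq]
  | succ w ih =>
    by_cases hnn : NonnegOn h Z
    · obtain ⟨G, hG, hinf, hsup⟩ := exists_relative_complement hWZ
      refine ⟨G, hG, hnn.mono hG, by rw [inf_comm, hinf], ?_⟩
      have := finrank_sup_of_inf_eq_bot hinf
      rw [hsup] at this; omega
    · simp only [NonnegOn, not_forall, not_le] at hnn
      obtain ⟨x, hx, hneg⟩ := hnn
      have hpos : 0 < ((-h) x x).re := by simpa using hneg
      have hx0 : x ≠ 0 := by rintro rfl; simp at hpos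
      have h1 := hd (ℂ ∙ x) (by simpa using hx) (posOn_span hs.neg hpos)
      rw [finrank_span_singleton hx0] at h1
      obtain ⟨y, hyZ, hy⟩ := exists_notMem_perp hs (Z := Z) (W := W) (by omega)
      obtain ⟨t, ht, hn⟩ := exists_pos_notMem hs.neg hpos hy
      set u := x + (t : ℂ) • y
      have huZ : u ∈ Z := Z.add_mem hx (Z.smul_mem _ hyZ)
      have huu : h u u ≠ 0 := fun h0 => by simp [h0] at ht
      have hW1 := finrank_inf_perp_span hs hn
      obtain ⟨G, hGZ, hG, hGW, hGd⟩ := ih (Z := Z ⊓ perp h (ℂ ∙ u)) (W := W ⊓ perp h (ℂ ∙ u))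
        (inf_le_inf_right _ hWZ) (fun U hU hUn => by
          obtain ⟨h2, h3⟩ := hUn.add_span hs.neg ht
            (by rw [perp_neg]; exact hU.trans inf_le_right)
          have h4 := hd _ (sup_le (hU.trans inf_le_left) (by simpa using huZ)) h2
          have h5 := Submodule.finrank_mono (inf_perp_hyperplane_le (W := W) huZ huu)
          omega) (by omega)
      obtain ⟨h6, h7, h8⟩ := complement_of_hyperplane hs hWZ hn hGZ hGW (by omega)
      exact ⟨G, h6, hG, h7, by omega⟩

end QuadMat

/-! ### Isotropic complements, and complements containing a prescribed subspace. -/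

namespace QuadMat

open Module

variable {V : Type*} [AddCommGroup V] [Module ℂ V] {h : V →ₗ⋆[ℂ] V →ₗ[ℂ] ℂ}

/-- `S` is isotropic for `h`. -/
def IsoOn (h : V →ₗ⋆[ℂ] V →ₗ[ℂ] ℂ) (S : Submodule ℂ V) : Prop := ∀ x ∈ S, (h x x).re = 0

theorem IsoOn.nonnegOn {S : Submodule ℂ V} (H : IsoOn h S) : NonnegOn h S := fun x hx => (H x hx).ge

theorem IsoOn.neg {S : Submodule ℂ V} (H : IsoOn h S) : IsoOn (-h) S := fun x hx => by
  simp [H x hx]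

theorem NonnegOn.isoOn {S : Submodule ℂ V} (H : NonnegOn h S) (H' : NonnegOn (-h) S) :
    IsoOn h S := fun x hx => by
  have h1 := H x hx
  have h2 := H' x hx
  simp at h2
  linarith

theorem exists_two_roots {a b c : ℝ} (hac : a * c < 0) :
    ∃ t s : ℝ, t ≠ s ∧ a + 2 * t * b + t ^ 2 * c = 0 ∧ a + 2 * s * b + s ^ 2 * c = 0 := by
  have hc : c ≠ 0 := by rintro rfl; simp at hac
  have hD : 0 < b ^ 2 - a * c := by nlinarith [sq_nonneg b]
  have hr := Real.sq_sqrt hD.le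
  have hr0 := Real.sqrt_pos.2 hD
  set r := √(b ^ 2 - a * c)
  refine ⟨(-b + r) / c, (-b - r) / c, ?_, ?_, ?_⟩
  · intro he
    rw [div_left_inj' hc] at he
    linarith
  · field_simp
    linear_combination hr
  · field_simp
    linear_combination hr

theorem mem_of_two_mem {L : Submodule ℂ V} {x y : V} {t s : ℝ} (hts : t ≠ s)
    (ht : x + (t : ℂ) • y ∈ L) (hs : x + (s : ℂ) • y ∈ L) : x ∈ L ∧ y ∈ L := by
  have hne : ((t : ℂ) - s) ≠ 0 := by rw [sub_ne_zero]; exact_mod_cast hts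
  have hy : y ∈ L := by
    rw [← Submodule.smul_mem_iff L hne]
    have : ((t : ℂ) - s) • y = (x + (t : ℂ) • y) - (x + (s : ℂ) • y) := by module
    rw [this]; exact L.sub_mem ht hs
  exact ⟨(Submodule.add_mem_iff_left L (L.smul_mem _ hy)).1 ht, hy⟩

/-- If `z` is not itself isotropic, a real line from `z` in the direction of a vector of opposite
sign meets the isotropic cone twice; two points in `L` would force `z` into `L`. -/
theorem exists_iso_notMem (hs : IsHerm h) {Z L : Submodule ℂ V} {x y z : V} (hx : x ∈ Z)
    (hqx : 0 < (h x x).re) (hy : y ∈ Z) (hqy : (h y y).re < 0) (hz : z ∈ Z) (hzL : z ∉ L) :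
    ∃ u ∈ Z, (h u u).re = 0 ∧ u ∉ L := by
  have key : ∀ w ∈ Z, (h z z).re * (h w w).re < 0 → ∃ u ∈ Z, (h u u).re = 0 ∧ u ∉ L := by
    intro w hw hneg
    obtain ⟨t, s, hts, h1, h2⟩ := exists_two_roots (b := (h z w).re) hneg
    by_contra hc
    push Not at hc
    refine hzL (mem_of_two_mem hts (hc _ (Z.add_mem hz (Z.smul_mem _ hw)) ?_)
      (hc _ (Z.add_mem hz (Z.smul_mem _ hw)) ?_)).1
    · rw [hs.re_add_smul, h1]
    · rw [hs.re_add_smul, h2]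
  rcases lt_trichotomy (h z z).re 0 with hq | hq | hq
  · exact key x hx (mul_neg_of_neg_of_pos hq hqx)
  · exact ⟨z, hz, hq, hzL⟩
  · exact key y hy (mul_neg_of_pos_of_neg hq hqy)

/-- With the phase of `y` chosen so that `Re h(x, cy) = 0`, the whole real line `x + t(cy)` is
isotropic. Each of `L` and `M` contains at most one of its points, so three values of `t` suffice.
-/
theorem exists_iso_notMem_two (hs : IsHerm h) {Z L M : Submodule ℂ V} {x y : V} (hx : x ∈ Z)
    (hqx : (h x x).re = 0) (hxL : x ∉ L) (hy : y ∈ Z) (hqy : (h y y).re = 0) (hyM : y ∉ M) :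
    ∃ u ∈ Z, (h u u).re = 0 ∧ u ∉ L ∧ u ∉ M := by
  obtain ⟨c, hc, hre⟩ : ∃ c : ℂ, c ≠ 0 ∧ (c * h x y).re = 0 := by
    by_cases h0 : h x y = 0
    · exact ⟨1, one_ne_zero, by simp [h0]⟩
    · refine ⟨Complex.I * star (h x y), by simp [h0], ?_⟩
      simp; ring
  have hq : ∀ t : ℝ, (h (x + (t : ℂ) • c • y) (x + (t : ℂ) • c • y)).re = 0 := by
    intro t
    have hcy : (h (c • y) (c • y)).re = 0 := by
      simp only [map_smulₛₗ, LinearMap.smul_apply, smul_eq_mul]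
      rw [hs.self_eq y, hqy]; simp
    have h2 : (h x (c • y)).re = 0 := by simpa using hre
    rw [hs.re_add_smul, hqx, hcy, h2]; ring
  have hyM' : c • y ∉ M := fun hm => hyM ((Submodule.smul_mem_iff M hc).1 hm)
  have hL : ∀ t s : ℝ, t ≠ s → x + (t : ℂ) • c • y ∈ L → x + (s : ℂ) • c • y ∉ L :=
    fun t s hts h1 h2 => hxL (mem_of_two_mem hts h1 h2).1
  have hM : ∀ t s : ℝ, t ≠ s → x + (t : ℂ) • c • y ∈ M → x + (s : ℂ) • c • y ∉ M :=
    fun t s hts h1 h2 => hyM' (mem_of_two_mem hts h1 h2).2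
  by_contra hcon
  push Not at hcon
  have hall : ∀ t : ℝ, x + (t : ℂ) • c • y ∈ L ∨ x + (t : ℂ) • c • y ∈ M := fun t =>
    or_iff_not_imp_left.2 (hcon _ (Z.add_mem hx (Z.smul_mem _ (Z.smul_mem _ hy))) (hq t))
  have n12 : (1 : ℝ) ≠ 2 := by norm_num
  have n13 : (1 : ℝ) ≠ 3 := by norm_num
  have n23 : (2 : ℝ) ≠ 3 := by norm_num
  rcases hall 1 with a1 | a1
  · exact hM 2 3 n23 ((hall 2).resolve_left (hL 1 2 n12 a1)) ((hall 3).resolve_left (hL 1 3 n13 a1))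
  · exact hL 2 3 n23 ((hall 2).resolve_right (hM 1 2 n12 a1))
      ((hall 3).resolve_right (hM 1 3 n13 a1))

/-- The counterpart of `inf_perp_hyperplane_le` usable when `h u u = 0`. A functional on `Z`
vanishing on `u^⊥` is a multiple of that of `u`, so `x - cu` lies in the radical of `Z`; `c ≠ 0`
would put `u` in `W` plus that radical. -/
theorem inf_perp_isotropic_hyperplane_le {Z W : Submodule ℂ V} {u : V} (hWZ : W ≤ Z)
    (hu : u ∈ Z) (hs : IsHerm h) (huZ : u ∉ perp h Z) (huW : u ∉ W ⊔ (Z ⊓ perp h Z)) :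
    (W ⊓ perp h (ℂ ∙ u)) ⊓ perp h (Z ⊓ perp h (ℂ ∙ u)) ≤ W ⊓ perp h Z := by
  rintro x ⟨⟨hxW, -⟩, hx⟩
  refine ⟨hxW, ?_⟩
  simp only [mem_perp, not_forall] at huZ
  obtain ⟨z₀, hz₀, hne⟩ := huZ
  have hne' : h u z₀ ≠ 0 := fun h0 => hne (hs.eq_zero_comm h0)
  set c := star (h x z₀ / h u z₀)
  have hz : x - c • u ∈ Z ⊓ perp h Z := by
    refine ⟨Z.sub_mem (hWZ hxW) (Z.smul_mem _ hu), fun z hz => ?_⟩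
    have hz1 : z - (h u z / h u z₀) • z₀ ∈ Z ⊓ perp h (ℂ ∙ u) := by
      refine ⟨Z.sub_mem hz (Z.smul_mem _ hz₀), mem_perp_span.2 ?_⟩
      simp [hne']
    have h2 := hs.eq_zero_comm (hx _ hz1)
    apply hs.eq_zero_comm
    simp only [map_sub, map_smul, smul_eq_mul, sub_eq_zero] at h2
    simp only [map_sub, LinearMap.sub_apply, h2, map_smulₛₗ, LinearMap.smul_apply, smul_eq_mul, c]
    simp
    field_simp
    ring
  by_cases hc : c = 0
  · simpa [hc] using hz.2
  · refine absurd ((Submodule.smul_mem_iff _ hc).1 ?_) huW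
    have : c • u = x + -(x - c • u) := by abel
    rw [this]
    exact Submodule.add_mem_sup hxW (Submodule.neg_mem _ hz)

variable [FiniteDimensional ℂ V]

/-- If `Z` is semidefinite, a complement semidefinite of the opposite sign is isotropic; if `W` and
the radical span `Z`, the complement is found in the radical. Otherwise `Z` is indefinite and has an
isotropic `u`, not orthogonal to `W` and outside `W` plus the radical, along which to cut. -/
theorem exists_isoOn_complement_rel (hs : IsHerm h) {Z W : Submodule ℂ V} (hWZ : W ≤ Z)
    (hd : ∀ U ≤ Z, PosOn h U ∨ PosOn (-h) U →
      finrank ℂ U + finrank ℂ ↥(W ⊓ perp h Z) ≤ finrank ℂ W) :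
    ∃ G ≤ Z, IsoOn h G ∧ G ⊓ W = ⊥ ∧ finrank ℂ G + finrank ℂ W = finrank ℂ Z := by
  induction hw : finrank ℂ W using Nat.strong_induction_on generalizing Z W with
  | _ w ih =>
  by_cases hnn : NonnegOn h Z
  · obtain ⟨G, hG, h1, h2, h3⟩ := exists_nonnegOn_complement_rel hs.neg hWZ
      (fun U hU hp => by rw [perp_neg]; exact hd U hU (Or.inl (by simpa using hp)))
    exact ⟨G, hG, (hnn.mono hG).isoOn h1, h2, by omega⟩
  by_cases hnp : NonnegOn (-h) Z
  · obtain ⟨G, hG, h1, h2, h3⟩ := exists_nonnegOn_complement_rel hs hWZ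
      (fun U hU hp => hd U hU (Or.inr hp))
    exact ⟨G, hG, h1.isoOn (hnp.mono hG), h2, by omega⟩
  by_cases hker : Z ≤ W ⊔ (Z ⊓ perp h Z)
  · have hle : W ⊓ perp h Z ≤ Z ⊓ perp h Z := inf_le_inf_right _ hWZ
    obtain ⟨G, hG, hinf, hsup⟩ := exists_relative_complement hle
    refine ⟨G, hG.trans inf_le_left, fun x hx => ?_, ?_, ?_⟩
    · rw [(hG hx).2 x (hG hx).1]; simp
    · rw [eq_bot_iff, ← hinf]
      exact fun x hx => ⟨⟨hx.2, (hG hx.1).2⟩, hx.1⟩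
    · have e1 := finrank_sup_of_inf_eq_bot hinf
      have e2 := Submodule.finrank_sup_add_finrank_inf_eq W (Z ⊓ perp h Z)
      have e3 : W ⊔ (Z ⊓ perp h Z) = Z := le_antisymm (sup_le hWZ inf_le_left) hker
      have e4 : W ⊓ (Z ⊓ perp h Z) = W ⊓ perp h Z := by
        rw [← inf_assoc, inf_eq_left.2 hWZ]
      rw [hsup] at e1
      rw [e3, e4] at e2
      omega
  simp only [NonnegOn, not_forall, not_le, LinearMap.neg_apply, Complex.neg_re,
    Left.neg_neg_iff] at hnn hnp
  obtain ⟨y, hy, hqy⟩ := hnn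
  obtain ⟨x, hx, hqx⟩ := hnp
  have hx0 : x ≠ 0 := by rintro rfl; simp at hqx
  have h1 := hd (ℂ ∙ x) (by simpa using hx) (Or.inl (posOn_span hs hqx))
  rw [finrank_span_singleton hx0] at h1
  obtain ⟨z, hz, hzn⟩ := exists_notMem_perp hs (Z := Z) (W := W) (by omega)
  obtain ⟨z', hz', hzn'⟩ := SetLike.not_le_iff_exists.1 hker
  obtain ⟨a, ha, hqa, hna⟩ := exists_iso_notMem hs hx hqx hy hqy hz hzn
  obtain ⟨b, hb, hqb, hnb⟩ := exists_iso_notMem hs hx hqx hy hqy hz' hzn'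
  obtain ⟨u, hu, hqu, hnW, hnk⟩ := exists_iso_notMem_two hs ha hqa hna hb hqb hnb
  have huZ : u ∉ perp h Z := fun hc => hnW (perp_anti hWZ hc)
  have hu0 : u ≠ 0 := by rintro rfl; exact huZ (Submodule.zero_mem _)
  have hW1 := finrank_inf_perp_span hs hnW
  have hmono := Submodule.finrank_mono (inf_perp_isotropic_hyperplane_le hWZ hu hs huZ hnk)
  have hspan : ∀ g : V →ₗ⋆[ℂ] V →ₗ[ℂ] ℂ, (g u u).re = 0 → IsHerm g → IsoOn g (ℂ ∙ u) := by
    intro g hg hsg x hx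
    obtain ⟨c, rfl⟩ := Submodule.mem_span_singleton.1 hx
    simp only [map_smulₛₗ, LinearMap.smul_apply, smul_eq_mul]
    rw [hsg.self_eq u, hg]; simp
  have hinf : (ℂ ∙ u) ⊓ perp h Z = ⊥ := by
    rw [eq_bot_iff]
    rintro x ⟨h1, h2⟩
    obtain ⟨c, rfl⟩ := Submodule.mem_span_singleton.1 h1
    by_cases hc : c = 0
    · simp [hc]
    · exact absurd ((Submodule.smul_mem_iff _ hc).1 h2) huZ
  obtain ⟨G, hGZ, hG, hGW, hGd⟩ := ih (finrank ℂ ↥(W ⊓ perp h (ℂ ∙ u))) (by omega)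
    (Z := Z ⊓ perp h (ℂ ∙ u)) (W := W ⊓ perp h (ℂ ∙ u))
    (inf_le_inf_right _ hWZ) (fun U hU hUn => by
      have hUZ := hU.trans inf_le_left
      have hUp := hs.le_perp_comm (hU.trans inf_le_right)
      have hUle : (ℂ ∙ u) ≤ Z := by simpa using hu
      -- The isotropic `u` is not in `U`'s sign, but being orthogonal to `U` and not to `Z` it still
      -- allows a definite subspace of `Z` one dimension larger, which passes the bound on to the
      -- cut.
      have : ∃ T ≤ Z, (PosOn h T ∨ PosOn (-h) T) ∧
          finrank ℂ U + finrank ℂ (ℂ ∙ u) ≤ finrank ℂ T + finrank ℂ ↥((ℂ ∙ u) ⊓ perp h Z) := by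
        rcases hUn with hUn | hUn
        · obtain ⟨T, h1, h2, h3⟩ := exists_posOn_of_isotropic hs hUZ hUn hUle (hspan h hqu hs) hUp
          exact ⟨T, h1, Or.inl h2, h3⟩
        · obtain ⟨T, h1, h2, h3⟩ := exists_posOn_of_isotropic hs.neg hUZ hUn hUle
            (hspan (-h) (by simp [hqu]) hs.neg) (by rwa [perp_neg])
          rw [perp_neg] at h3
          exact ⟨T, h1, Or.inr h2, h3⟩
      obtain ⟨T, hT, hT1, hT2⟩ := this
      have := hd T hT hT1
      rw [hinf, finrank_bot, finrank_span_singleton hu0] at hT2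
      omega) rfl
  obtain ⟨h6, h7, h8⟩ := complement_of_hyperplane hs hWZ hnW hGZ hGW (by omega)
  exact ⟨G, h6, hG, h7, by omega⟩

theorem finrank_sup_inf_perp (hs : IsHerm h) {K W : Submodule ℂ V} (hKW : K ⊓ W = ⊥)
    (hK : K ⊓ perp h (K ⊔ W) ≤ perp h ⊤) :
    finrank ℂ ↥((K ⊔ W) ⊓ perp h K) = finrank ℂ W + finrank ℂ ↥(K ⊓ perp h ⊤) := by
  have h1 := finrank_inf_perp hs (K ⊔ W) K
  have h2 := finrank_sup_of_inf_eq_bot hKW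
  have h3 : K ⊓ perp h (K ⊔ W) = K ⊓ perp h ⊤ :=
    le_antisymm (le_inf inf_le_left hK) (inf_le_inf_left _ (perp_anti le_top))
  rw [h3] at h1
  omega

/-- The bound on the whole space descends to `perp h K`: a definite `U` there is orthogonal to the
isotropic `K ⊓ perp h K`, which enlarges it by its dimension modulo the radical. -/
theorem finrank_bound_perp (hs : IsHerm h) {K W : Submodule ℂ V} (hKW : K ⊓ W = ⊥)
    (hK : K ⊓ perp h (K ⊔ W) ≤ perp h ⊤)
    (hd : ∀ U, PosOn h U → finrank ℂ U + finrank ℂ ↥(perp h ⊤ ⊓ (K ⊔ W))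
      ≤ finrank ℂ W + finrank ℂ ↥(K ⊓ perp h ⊤))
    {U : Submodule ℂ V} (hUK : U ≤ perp h K) (hU : PosOn h U) :
    finrank ℂ U + finrank ℂ ↥(((K ⊔ W) ⊓ perp h K) ⊓ perp h (perp h K))
      ≤ finrank ℂ ↥((K ⊔ W) ⊓ perp h K) := by
  obtain ⟨T, -, hT, hTd⟩ := exists_posOn_of_isotropic hs (Z := ⊤) (I := K ⊓ perp h K) le_top hU
    le_top (fun x hx => by rw [hx.2 x hx.1]; simp) (inf_le_left.trans (hs.le_perp_comm hUK))
  have h1 := hd T hT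
  have h2 := finrank_sup_inf_perp hs hKW hK
  have hk : K ⊓ perp h K ⊓ perp h ⊤ = K ⊓ perp h ⊤ := by
    rw [inf_assoc, inf_eq_right.2 (perp_anti le_top : perp h ⊤ ≤ perp h K)]
  have h3 : ((K ⊔ W) ⊓ perp h K) ⊓ perp h (perp h K)
      ≤ (K ⊓ perp h K) ⊔ (perp h ⊤ ⊓ (K ⊔ W)) := by
    rw [perp_perp hs]
    rintro x ⟨⟨hx1, hx2⟩, hx3⟩
    obtain ⟨k, hk, r, hr, rfl⟩ := Submodule.mem_sup.1 hx3
    refine Submodule.add_mem_sup ⟨hk, ?_⟩ ⟨hr, ?_⟩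
    · exact (Submodule.add_mem_iff_left _ (perp_anti le_top hr)).1 hx2
    · exact (Submodule.add_mem_iff_right _ (le_sup_left (a := K) (b := W) hk)).1 hx1
  have h4 := Submodule.finrank_mono h3
  have h5 := Submodule.finrank_sup_add_finrank_inf_eq (K ⊓ perp h K) (perp h ⊤ ⊓ (K ⊔ W))
  have h6 : (K ⊓ perp h K) ⊓ (perp h ⊤ ⊓ (K ⊔ W)) = K ⊓ perp h ⊤ := by
    rw [← inf_assoc, hk, inf_eq_left]
    exact inf_le_left.trans le_sup_left
  rw [h6] at h5
  rw [hk] at hTd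
  omega

theorem complement_sup (hs : IsHerm h) {K W G : Submodule ℂ V} (hKW : K ⊓ W = ⊥)
    (hK : K ⊓ perp h (K ⊔ W) ≤ perp h ⊤) (hGK : G ≤ perp h K)
    (hG : G ⊓ ((K ⊔ W) ⊓ perp h K) = ⊥)
    (hd : finrank ℂ G + finrank ℂ ↥((K ⊔ W) ⊓ perp h K) = finrank ℂ ↥(perp h K)) :
    (K ⊔ G) ⊓ W = ⊥ ∧ finrank ℂ ↥(K ⊔ G) + finrank ℂ W = finrank ℂ V := by
  constructor
  · rw [eq_bot_iff]
    rintro x ⟨hx, hxW⟩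
    obtain ⟨k, hk, g, hg, rfl⟩ := Submodule.mem_sup.1 hx
    have hg0 : g ∈ G ⊓ ((K ⊔ W) ⊓ perp h K) := by
      refine ⟨hg, ?_, hGK hg⟩
      have : g = -k + (k + g) := by abel
      rw [this]
      exact Submodule.add_mem_sup (K.neg_mem hk) hxW
    rw [hG, Submodule.mem_bot] at hg0
    subst hg0
    rw [← hKW]
    exact ⟨by simpa using hk, hxW⟩
  · have hKG : K ⊓ G = ⊥ := by
      rw [eq_bot_iff, ← hG]
      exact fun x hx => ⟨hx.2, Submodule.mem_sup_left hx.1, hGK hx.2⟩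
    have h1 := finrank_sup_of_inf_eq_bot hKG
    have h2 := finrank_sup_inf_perp hs hKW hK
    have h3 := finrank_perp hs K
    omega

/-- A complement found inside `perp h K` is orthogonal to `K`, so adding `K` keeps the form
semidefinite. -/
theorem exists_nonnegOn_complement (hs : IsHerm h) {K W : Submodule ℂ V} (hKW : K ⊓ W = ⊥)
    (hpos : NonnegOn h K) (hK : K ⊓ perp h (K ⊔ W) ≤ perp h ⊤)
    (hd : ∀ U, PosOn (-h) U → finrank ℂ U + finrank ℂ ↥(perp h ⊤ ⊓ (K ⊔ W))
      ≤ finrank ℂ W + finrank ℂ ↥(K ⊓ perp h ⊤)) :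
    ∃ G, K ≤ G ∧ NonnegOn h G ∧ G ⊓ W = ⊥ ∧ finrank ℂ G + finrank ℂ W = finrank ℂ V := by
  obtain ⟨G, hGK, hG, hGW, hGd⟩ := exists_nonnegOn_complement_rel hs
    (Z := perp h K) (W := (K ⊔ W) ⊓ perp h K) inf_le_right
    (fun U hU hUn => by
      have := finrank_bound_perp hs.neg hKW (by rwa [perp_neg]) (by rwa [perp_neg])
        (by rwa [perp_neg]) hUn
      rwa [perp_neg] at this)
  obtain ⟨h1, h2⟩ := complement_sup hs hKW hK hGK hGW hGd
  exact ⟨K ⊔ G, le_sup_left, hpos.sup hs hG hGK, h1, h2⟩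

theorem exists_isoOn_complement (hs : IsHerm h) {K W : Submodule ℂ V} (hKW : K ⊓ W = ⊥)
    (hiso : IsoOn h K) (hK : K ⊓ perp h (K ⊔ W) ≤ perp h ⊤)
    (hd : ∀ U, PosOn h U ∨ PosOn (-h) U → finrank ℂ U + finrank ℂ ↥(perp h ⊤ ⊓ (K ⊔ W))
      ≤ finrank ℂ W + finrank ℂ ↥(K ⊓ perp h ⊤)) :
    ∃ G, K ≤ G ∧ IsoOn h G ∧ G ⊓ W = ⊥ ∧ finrank ℂ G + finrank ℂ W = finrank ℂ V := by
  obtain ⟨G, hGK, hG, hGW, hGd⟩ := exists_isoOn_complement_rel hs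
    (Z := perp h K) (W := (K ⊔ W) ⊓ perp h K) inf_le_right
    (fun U hU hUn => by
      rcases hUn with hUn | hUn
      · exact finrank_bound_perp hs hKW hK (fun U hU => hd U (Or.inl hU)) hU hUn
      · have := finrank_bound_perp hs.neg hKW (by rwa [perp_neg])
          (by rw [perp_neg]; exact fun U hU => hd U (Or.inr hU)) (by rwa [perp_neg]) hUn
        rwa [perp_neg] at this)
  obtain ⟨h1, h2⟩ := complement_sup hs hKW hK hGK hGW hGd
  exact ⟨K ⊔ G, le_sup_left, (hiso.nonnegOn.sup hs hG.nonnegOn hGK).isoOn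
    (hiso.neg.nonnegOn.sup hs.neg hG.neg.nonnegOn (by rwa [perp_neg])), h1, h2⟩

/-- Necessary conditions for the existence of a positive semidefinite complement of `W`
containing `K`. -/
theorem NonnegOn.complement_conditions (hs : IsHerm h) {K W G : Submodule ℂ V} (hKG : K ≤ G)
    (hG : NonnegOn h G) (hGW : G ⊓ W = ⊥) (hd : finrank ℂ G + finrank ℂ W = finrank ℂ V) :
    K ⊓ perp h (K ⊔ W) ≤ perp h ⊤ ∧
    ∀ U, PosOn (-h) U → finrank ℂ U + finrank ℂ ↥(perp h ⊤ ⊓ (K ⊔ W))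
      ≤ finrank ℂ W + finrank ℂ ↥(K ⊓ perp h ⊤) := by
  have htop : G ⊔ W = ⊤ := by
    apply Submodule.eq_top_of_finrank_eq
    rw [finrank_sup_of_inf_eq_bot hGW, hd]
  constructor
  · rintro x ⟨hxK, hx⟩
    rw [perp_sup] at hx
    rw [← htop, perp_sup]
    refine ⟨fun g hg => hs.eq_zero_comm (hG.apply_eq_zero hs (hKG hxK) hg ?_), hx.2⟩
    rw [hx.1 x hxK]; simp
  · intro U hU
    -- Radical vectors can be added to `G` at no cost. The enlarged space meets `U` trivially, which
    -- bounds `dim U`.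
    have hnn : NonnegOn (- -h) (G ⊔ (perp h ⊤ ⊓ (K ⊔ W))) := by
      rw [neg_neg]
      refine hG.sup hs ?_ (inf_le_left.trans (perp_anti le_top))
      intro x hx
      rw [hx.1 x trivial]; simp
    have h1 := finrank_add_le_of_inf_eq_bot (hU.inf_eq_bot hnn)
    have h2 := Submodule.finrank_sup_add_finrank_inf_eq G (perp h ⊤ ⊓ (K ⊔ W))
    have h3 : G ⊓ (perp h ⊤ ⊓ (K ⊔ W)) ≤ K ⊓ perp h ⊤ := by
      rintro x ⟨hx1, hx2, hx3⟩
      refine ⟨?_, hx2⟩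
      obtain ⟨k, hk, w, hw, rfl⟩ := Submodule.mem_sup.1 hx3
      have : w ∈ G ⊓ W := ⟨(Submodule.add_mem_iff_right _ (hKG hk)).1 hx1, hw⟩
      rw [hGW, Submodule.mem_bot] at this
      simpa [this] using hk
    have h4 := Submodule.finrank_mono h3
    omega

end QuadMat

/-! ### Isotropic subspaces and the size of definite ones. -/

namespace QuadMat

open Module

section Abstract

variable {V : Type*} [AddCommGroup V] [Module ℂ V] {h : V →ₗ⋆[ℂ] V →ₗ[ℂ] ℂ}

theorem posOn_bot : PosOn h ⊥ := fun _ hx h0 => absurd ((Submodule.mem_bot ℂ).1 hx) h0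

variable [FiniteDimensional ℂ V]

theorem exists_posOn_of_isoOn (hs : IsHerm h) {I : Submodule ℂ V} (hI : IsoOn h I) :
    ∃ T, PosOn h T ∧ finrank ℂ I ≤ finrank ℂ T + finrank ℂ ↥(I ⊓ perp h ⊤) := by
  obtain ⟨T, -, hT, hd⟩ := exists_posOn_of_isotropic hs (Z := ⊤) (U := ⊥) bot_le posOn_bot
    le_top hI (fun x _ s hs' => by rw [(Submodule.mem_bot ℂ).1 hs']; simp)
  rw [finrank_bot, zero_add] at hd
  exact ⟨T, hT, hd⟩

/-- An isotropic subspace attains the maximal positive dimension exactly when the form is negative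
semidefinite on its orthogonal subspace. -/
theorem forall_posOn_le_iff (hs : IsHerm h) {I : Submodule ℂ V} (hI : IsoOn h I) :
    (∀ T, PosOn h T → finrank ℂ T + finrank ℂ ↥(I ⊓ perp h ⊤) ≤ finrank ℂ I) ↔
      NonnegOn (-h) (perp h I) := by
  constructor
  · intro H x hx
    by_contra hneg
    have hpos : 0 < (h x x).re := by simpa using hneg
    have hx0 : x ≠ 0 := by rintro rfl; simp at hpos
    obtain ⟨T, -, hT, hd⟩ := exists_posOn_of_isotropic hs (Z := ⊤) le_top (posOn_span hs hpos)
      le_top hI (hs.le_perp_comm (by simpa using hx))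
    rw [finrank_span_singleton hx0] at hd
    have := H T hT
    omega
  · intro H T hT
    have h1 := finrank_add_le_of_inf_eq_bot (hT.inf_eq_bot H)
    have h2 := finrank_perp hs I
    omega

/-- Otherwise `I` together with `x` would be a negative semidefinite subspace too large to avoid
`T`. -/
theorem pos_of_large_posOn (hs : IsHerm h) {I T : Submodule ℂ V} (hI : IsoOn h I) (hT : PosOn h T)
    (hd : finrank ℂ V ≤ finrank ℂ T + finrank ℂ I) {x : V} (hx : x ∈ perp h I) (hxI : x ∉ I) :
    0 < (h x x).re := by
  by_contra hneg
  have hnn : NonnegOn (-h) (ℂ ∙ x) := by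
    intro y hy
    obtain ⟨c, rfl⟩ := Submodule.mem_span_singleton.1 hy
    simp only [map_smulₛₗ, LinearMap.smul_apply, smul_eq_mul, LinearMap.neg_apply]
    rw [hs.self_eq x]
    have he : (c * ((starRingEnd ℂ) c * -((h x x).re : ℂ))).re
        = Complex.normSq c * -(h x x).re := by
      simp [Complex.normSq_apply]; ring
    have := mul_nonneg (Complex.normSq_nonneg c) (neg_nonneg.2 (not_lt.1 hneg))
    rw [← he] at this
    simpa only [RingHom.id_apply] using this
  have h1 : NonnegOn (-h) (I ⊔ ℂ ∙ x) := hI.neg.nonnegOn.sup hs.neg hnn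
    (by rw [perp_neg]; simpa using hx)
  have h2 := finrank_add_le_of_inf_eq_bot (hT.inf_eq_bot h1)
  have h3 := Submodule.finrank_lt_finrank_of_lt
    (lt_of_le_of_ne (le_sup_left : I ≤ I ⊔ ℂ ∙ x) (fun he => hxI (by
      rw [he]; exact Submodule.mem_sup_right (Submodule.mem_span_singleton_self x))))
  omega

theorem PosOn.finrank_add_le {I T : Submodule ℂ V} (hI : IsoOn h I)
    (hT : PosOn h T) : finrank ℂ T + finrank ℂ I ≤ finrank ℂ V :=
  finrank_add_le_of_inf_eq_bot (hT.inf_eq_bot hI.neg.nonnegOn)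

end Abstract

/-! ### Forms of matrices; inertia as the maximal dimension of a definite subspace. -/

section MatrixForm

variable {ι κ : Type*} [Fintype ι] [Fintype κ]

/-- The sesquilinear form of a square matrix. -/
def hform (N : Matrix ι ι ℂ) : (ι → ℂ) →ₗ⋆[ℂ] (ι → ℂ) →ₗ[ℂ] ℂ :=
  LinearMap.mk₂'ₛₗ (starRingEnd ℂ) (RingHom.id ℂ) (fun x y => star x ⬝ᵥ N *ᵥ y)
    (fun x y z => by simp [add_dotProduct]) (fun c x y => by simp)
    (fun x y z => by simp [Matrix.mulVec_add]) (fun c x y => by simp [Matrix.mulVec_smul])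

@[simp]
theorem hform_apply (N : Matrix ι ι ℂ) (x y : ι → ℂ) : hform N x y = star x ⬝ᵥ N *ᵥ y := rfl

theorem hform_neg (N : Matrix ι ι ℂ) : hform (-N) = -hform N := by
  ext x y; simp [Matrix.neg_mulVec]

theorem star_star_dotProduct (x y : ι → ℂ) : star (star x ⬝ᵥ y) = star y ⬝ᵥ x := by
  rw [← Matrix.star_dotProduct_star, star_star, dotProduct_comm]

theorem star_mulVec_dotProduct (S : Matrix ι κ ℂ) (x : κ → ℂ) (y : ι → ℂ) :
    star (S *ᵥ x) ⬝ᵥ y = star x ⬝ᵥ Sᴴ *ᵥ y := by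
  rw [Matrix.star_mulVec, Matrix.dotProduct_mulVec]

theorem isHerm_hform {N : Matrix ι ι ℂ} (hN : N.IsHermitian) : IsHerm (hform N) := by
  intro x y
  rw [hform_apply, hform_apply, star_star_dotProduct, star_mulVec_dotProduct, hN.eq]

theorem star_dotProduct_eq_zero_iff (y : ι → ℂ) : (∀ x : ι → ℂ, star x ⬝ᵥ y = 0) ↔ y = 0 :=
  ⟨fun H => dotProduct_star_self_eq_zero.1 (H y), fun H => by simp [H]⟩

theorem mem_perp_top {N : Matrix ι ι ℂ} {y : ι → ℂ} : y ∈ perp (hform N) ⊤ ↔ N *ᵥ y = 0 := by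
  rw [← star_dotProduct_eq_zero_iff]
  exact ⟨fun H x => H x trivial, fun H x _ => H x⟩

theorem hform_congr (N : Matrix ι ι ℂ) (S : Matrix ι κ ℂ) (x y : κ → ℂ) :
    hform N (S *ᵥ x) (S *ᵥ y) = hform (Sᴴ * N * S) x y := by
  simp only [hform_apply, Matrix.star_mulVec, ← Matrix.mulVec_mulVec, Matrix.dotProduct_mulVec]

theorem posSemidef_iff_nonnegOn {N : Matrix ι ι ℂ} (hN : N.IsHermitian) :
    N.PosSemidef ↔ NonnegOn (hform N) ⊤ := by
  rw [Matrix.posSemidef_iff_dotProduct_mulVec, and_iff_right hN]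
  refine ⟨fun H x _ => (Complex.le_def.1 (H x)).1, fun H x => ?_⟩
  have h1 := (isHerm_hform hN).self_eq x
  have h2 := H x trivial
  rw [hform_apply] at h1 h2
  rw [h1]
  exact_mod_cast h2

theorem posDef_iff_posOn {N : Matrix ι ι ℂ} (hN : N.IsHermitian) :
    N.PosDef ↔ PosOn (hform N) ⊤ := by
  rw [Matrix.posDef_iff_dotProduct_mulVec, and_iff_right hN]
  refine ⟨fun H x _ hx => (Complex.lt_def.1 (H hx)).1, fun H x hx => ?_⟩
  have h1 := (isHerm_hform hN).self_eq x
  have h2 := H x trivial hx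
  rw [hform_apply] at h1 h2
  rw [h1]
  exact_mod_cast h2

theorem eq_zero_iff_isoOn {N : Matrix ι ι ℂ} (hN : N.IsHermitian) :
    N = 0 ↔ IsoOn (hform N) ⊤ := by
  classical
  refine ⟨fun H x _ => by simp [H], fun H => ?_⟩
  have : ∀ y, N *ᵥ y = 0 := fun y => (star_dotProduct_eq_zero_iff _).1 fun x =>
    H.nonnegOn.apply_eq_zero (isHerm_hform hN) trivial trivial (H x trivial)
  exact Matrix.mulVec_injective (funext fun y => by simp [this y])

theorem rank_add_finrank_ker {μ : Type*} (M : Matrix μ κ ℂ) :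
    M.rank + finrank ℂ (LinearMap.ker M.mulVecLin) = Fintype.card κ := by
  rw [Matrix.rank, M.mulVecLin.finrank_range_add_finrank_ker, finrank_fintype_fun_eq_card]

theorem rank_add_finrank_ker_conjTranspose (M : Matrix ι κ ℂ) :
    M.rank + finrank ℂ (LinearMap.ker Mᴴ.mulVecLin) = Fintype.card ι := by
  rw [← Matrix.rank_conjTranspose, rank_add_finrank_ker]

variable [DecidableEq ι]

/-- The span of the eigenvectors selected by `p`, on which the form is diagonal. Complementary
choices of `p` give both bounds in the variational description of inertia. -/
theorem exists_eigen_subspace {N : Matrix ι ι ℂ} (hN : N.IsHermitian) (p : ι → Prop)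
    [DecidablePred p] : ∃ T : Submodule ℂ (ι → ℂ), finrank ℂ T = Fintype.card {i // p i} ∧
      ∀ x ∈ T, ∃ c : {i // p i} → ℂ, (x ≠ 0 → c ≠ 0) ∧
        (hform N x x).re = ∑ i : {i // p i}, hN.eigenvalues i * Complex.normSq (c i) := by
  set U : Matrix ι ι ℂ := (hN.eigenvectorUnitary : Matrix ι ι ℂ) with hU
  have hUU : Uᴴ * U = 1 := Matrix.mem_unitaryGroup_iff'.1 hN.eigenvectorUnitary.2
  have hdiag : Uᴴ * N * U = Matrix.diagonal (fun i => (hN.eigenvalues i : ℂ)) := by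
    have hsp := hN.spectral_theorem
    rw [Unitary.conjStarAlgAut_apply] at hsp
    have : N = U * Matrix.diagonal (fun i => (hN.eigenvalues i : ℂ)) * Uᴴ := hsp
    conv_lhs => rw [this]
    calc Uᴴ * (U * Matrix.diagonal (fun i => (hN.eigenvalues i : ℂ)) * Uᴴ) * U
        = (Uᴴ * U) * Matrix.diagonal (fun i => (hN.eigenvalues i : ℂ)) * (Uᴴ * U) := by
          simp only [Matrix.mul_assoc]
      _ = _ := by rw [hUU, Matrix.one_mul, Matrix.mul_one]
  let S : Matrix ι {i // p i} ℂ := U.submatrix id Subtype.val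
  have hSS : Sᴴ * S = 1 := by
    have : Sᴴ * S = (Uᴴ * U).submatrix Subtype.val Subtype.val := by
      rw [Matrix.submatrix_mul _ _ _ id _ Function.bijective_id]; rfl
    rw [this, hUU]
    exact Matrix.submatrix_one _ Subtype.val_injective
  have hSN : Sᴴ * N * S = Matrix.diagonal (fun i : {i // p i} => (hN.eigenvalues i : ℂ)) := by
    have : Sᴴ * N * S = (Uᴴ * N * U).submatrix Subtype.val Subtype.val := by
      rw [Matrix.submatrix_mul _ _ _ id _ Function.bijective_id,
        Matrix.submatrix_mul _ _ _ id _ Function.bijective_id]; rfl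
    rw [this, hdiag]
    exact Matrix.submatrix_diagonal _ _ Subtype.val_injective
  have hinj : Function.Injective S.mulVecLin := by
    intro x y hxy
    have := congrArg (Sᴴ *ᵥ ·) hxy
    simpa [Matrix.mulVec_mulVec, hSS] using this
  refine ⟨LinearMap.range S.mulVecLin, ?_, ?_⟩
  · rw [LinearMap.finrank_range_of_inj hinj]; simp
  · rintro _ ⟨c, rfl⟩
    refine ⟨c, fun h0 hc => h0 (by simp [hc]), ?_⟩
    rw [Matrix.mulVecLin_apply, hform_congr, hSN, hform_apply]
    simp only [dotProduct, Matrix.mulVec_diagonal, Pi.star_apply, Complex.re_sum]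
    refine Finset.sum_congr rfl fun i _ => ?_
    simp [Complex.normSq_apply]; ring

theorem exists_posOn_posInertia {N : Matrix ι ι ℂ} (hN : N.IsHermitian) :
    ∃ U, PosOn (hform N) U ∧ finrank ℂ U = posInertia hN := by
  obtain ⟨T, hT, H⟩ := exists_eigen_subspace hN (fun i => 0 < hN.eigenvalues i)
  refine ⟨T, fun x hx h0 => ?_, by rw [hT, posInertia, Fintype.card_subtype]⟩
  obtain ⟨c, hc, he⟩ := H x hx
  rw [he]
  obtain ⟨i, hi⟩ := Function.ne_iff.1 (hc h0)
  exact Finset.sum_pos' (fun j _ => mul_nonneg j.2.le (Complex.normSq_nonneg _))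
    ⟨i, Finset.mem_univ _, mul_pos i.2 (Complex.normSq_pos.2 hi)⟩

theorem exists_negOn_negInertia {N : Matrix ι ι ℂ} (hN : N.IsHermitian) :
    ∃ U, PosOn (-hform N) U ∧ finrank ℂ U = negInertia hN := by
  obtain ⟨T, hT, H⟩ := exists_eigen_subspace hN (fun i => hN.eigenvalues i < 0)
  refine ⟨T, fun x hx h0 => ?_, by rw [hT, negInertia, Fintype.card_subtype]⟩
  obtain ⟨c, hc, he⟩ := H x hx
  rw [LinearMap.neg_apply, LinearMap.neg_apply, Complex.neg_re, he, ← Finset.sum_neg_distrib]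
  obtain ⟨i, hi⟩ := Function.ne_iff.1 (hc h0)
  exact Finset.sum_pos' (fun j _ => by
      have := mul_nonneg (neg_nonneg.2 j.2.le) (Complex.normSq_nonneg (c j)); linarith)
    ⟨i, Finset.mem_univ _, by
      have := mul_pos (neg_pos.2 i.2) (Complex.normSq_pos.2 hi); linarith⟩

theorem PosOn.finrank_le_posInertia {N : Matrix ι ι ℂ} (hN : N.IsHermitian)
    {U : Submodule ℂ (ι → ℂ)} (hU : PosOn (hform N) U) : finrank ℂ U ≤ posInertia hN := by
  obtain ⟨T, hT, H⟩ := exists_eigen_subspace hN (fun i => ¬ 0 < hN.eigenvalues i)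
  have hTn : NonnegOn (-hform N) T := fun x hx => by
    obtain ⟨c, hc, he⟩ := H x hx
    rw [LinearMap.neg_apply, LinearMap.neg_apply, Complex.neg_re, he, ← Finset.sum_neg_distrib]
    exact Finset.sum_nonneg fun j _ => by
      have := mul_nonneg (neg_nonneg.2 (not_lt.1 j.2)) (Complex.normSq_nonneg (c j)); linarith
  have h1 := finrank_add_le_of_inf_eq_bot (hU.inf_eq_bot hTn)
  rw [hT, Fintype.card_subtype_compl, Fintype.card_subtype, finrank_fintype_fun_eq_card] at h1
  have h2 := Finset.card_le_univ (Finset.univ.filter fun i => 0 < hN.eigenvalues i)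
  rw [posInertia]
  omega

theorem PosOn.finrank_le_negInertia {N : Matrix ι ι ℂ} (hN : N.IsHermitian)
    {U : Submodule ℂ (ι → ℂ)} (hU : PosOn (-hform N) U) : finrank ℂ U ≤ negInertia hN := by
  obtain ⟨T, hT, H⟩ := exists_eigen_subspace hN (fun i => ¬ hN.eigenvalues i < 0)
  have hTn : NonnegOn (- -hform N) T := fun x hx => by
    obtain ⟨c, hc, he⟩ := H x hx
    rw [neg_neg, he]
    exact Finset.sum_nonneg fun j _ => mul_nonneg (not_lt.1 j.2) (Complex.normSq_nonneg (c j))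
  have h1 := finrank_add_le_of_inf_eq_bot (hU.inf_eq_bot hTn)
  rw [hT, Fintype.card_subtype_compl, Fintype.card_subtype, finrank_fintype_fun_eq_card] at h1
  have h2 := Finset.card_le_univ (Finset.univ.filter fun i => hN.eigenvalues i < 0)
  rw [negInertia]
  omega

theorem rank_eq_posInertia_add_negInertia {N : Matrix ι ι ℂ} (hN : N.IsHermitian) :
    N.rank = posInertia hN + negInertia hN := by
  rw [hN.rank_eq_card_non_zero_eigs, Fintype.card_subtype, posInertia, negInertia,
    ← Finset.card_union_of_disjoint]
  · congr 1
    ext i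
    simp only [Finset.mem_filter, Finset.mem_univ, true_and, Finset.mem_union]
    rw [ne_iff_lt_or_gt, or_comm]
  · rw [Finset.disjoint_filter]
    intro i _ h1 h2
    exact lt_asymm h1 h2

/-- `perp_perp` for the standard inner product, whose radical is zero. -/
theorem mem_colSpace_iff (A : Matrix ι κ ℂ) (x : ι → ℂ) :
    x ∈ colSpace A ↔ ∀ v, Aᴴ *ᵥ v = 0 → star v ⬝ᵥ x = 0 := by
  have h1 : (1 : Matrix ι ι ℂ).IsHermitian := Matrix.isHermitian_one
  have hp : ∀ v, v ∈ perp (hform (1 : Matrix ι ι ℂ)) (colSpace A) ↔ Aᴴ *ᵥ v = 0 := by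
    intro v
    rw [← star_dotProduct_eq_zero_iff, mem_perp]
    constructor
    · intro H y
      have := H (A *ᵥ y) ⟨y, rfl⟩
      rwa [hform_apply, Matrix.one_mulVec, Matrix.star_mulVec, ← Matrix.dotProduct_mulVec] at this
    · rintro H _ ⟨y, rfl⟩
      have := H y
      rwa [hform_apply, Matrix.one_mulVec, Matrix.mulVecLin_apply, Matrix.star_mulVec,
        ← Matrix.dotProduct_mulVec]
  have hpp := perp_perp (isHerm_hform h1) (colSpace A)
  have hbot : perp (hform (1 : Matrix ι ι ℂ)) ⊤ = ⊥ := by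
    rw [eq_bot_iff]; intro y hy
    simpa using mem_perp_top.1 hy
  rw [hbot, sup_bot_eq] at hpp
  rw [← hpp, mem_perp]
  simp only [hp, hform_apply, Matrix.one_mulVec]

theorem colSpace_le_iff {μ : Type*} [Fintype μ] (S : Matrix ι κ ℂ) (T : Matrix ι μ ℂ) :
    colSpace S ≤ colSpace T ↔ ∀ v, Tᴴ *ᵥ v = 0 → Sᴴ *ᵥ v = 0 := by
  constructor
  · intro H v hv
    rw [← star_dotProduct_eq_zero_iff]
    intro y
    have := (mem_colSpace_iff T (S *ᵥ y)).1 (H ⟨y, rfl⟩) v hv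
    rw [← star_mulVec_dotProduct, ← star_eq_zero, star_star_dotProduct]
    exact this
  · rintro H _ ⟨y, rfl⟩
    rw [mem_colSpace_iff]
    intro v hv
    have := H v hv
    rw [Matrix.mulVecLin_apply, ← star_eq_zero, star_star_dotProduct, star_mulVec_dotProduct, this,
      dotProduct_zero]

end MatrixForm

end QuadMat

/-! ### Block vectors, and ranks of block matrices as dimensions. -/

namespace QuadMat

open Module Matrix

variable {ι κ π : Type*}

/-- The first component of a vector indexed by a sum. -/
def fstL : (ι ⊕ κ → ℂ) →ₗ[ℂ] (ι → ℂ) := LinearMap.funLeft ℂ ℂ Sum.inl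

/-- The second component of a vector indexed by a sum. -/
def sndL : (ι ⊕ κ → ℂ) →ₗ[ℂ] (κ → ℂ) := LinearMap.funLeft ℂ ℂ Sum.inr

/-- The inclusion of the first component. -/
def inlL : (ι → ℂ) →ₗ[ℂ] (ι ⊕ κ → ℂ) where
  toFun v := Sum.elim v 0
  map_add' v w := by ext (i | i) <;> simp
  map_smul' c v := by ext (i | i) <;> simp

/-- The inclusion of the second component. -/
def inrL : (κ → ℂ) →ₗ[ℂ] (ι ⊕ κ → ℂ) where
  toFun v := Sum.elim 0 v
  map_add' v w := by ext (i | i) <;> simp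
  map_smul' c v := by ext (i | i) <;> simp


@[simp] theorem fstL_elim (v : ι → ℂ) (w : κ → ℂ) : fstL (Sum.elim v w) = v := rfl
@[simp] theorem sndL_elim (v : ι → ℂ) (w : κ → ℂ) : sndL (Sum.elim v w) = w := rfl
theorem inlL_apply (v : ι → ℂ) : (inlL v : ι ⊕ κ → ℂ) = Sum.elim v 0 := rfl
theorem inrL_apply (w : κ → ℂ) : (inrL w : ι ⊕ κ → ℂ) = Sum.elim (0 : ι → ℂ) w := rfl

theorem elim_fstL_sndL (x : ι ⊕ κ → ℂ) : Sum.elim (fstL x) (sndL x) = x :=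
  Sum.elim_comp_inl_inr x

theorem eq_zero_iff_fstL_sndL {x : ι ⊕ κ → ℂ} : x = 0 ↔ fstL x = 0 ∧ sndL x = 0 := by
  refine ⟨fun h => by simp [h], fun h => ?_⟩
  rw [← elim_fstL_sndL x, h.1, h.2]; exact Sum.elim_zero_zero

theorem finrank_comap_fstL_inf (J : Submodule ℂ (ι → ℂ)) :
    finrank ℂ ↥(J.comap fstL ⊓ LinearMap.ker (sndL : (ι ⊕ κ → ℂ) →ₗ[ℂ] _)) = finrank ℂ J := by
  have hinj : Function.Injective (inlL : (ι → ℂ) →ₗ[ℂ] (ι ⊕ κ → ℂ)) := fun v w hvw => by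
    simpa [inlL_apply] using congrArg fstL hvw
  have : J.comap fstL ⊓ LinearMap.ker (sndL : (ι ⊕ κ → ℂ) →ₗ[ℂ] _) = J.map inlL := by
    ext x
    constructor
    · rintro ⟨h1, h2⟩
      refine ⟨fstL x, h1, ?_⟩
      rw [inlL_apply, ← LinearMap.mem_ker.1 h2, elim_fstL_sndL]
    · rintro ⟨v, hv, rfl⟩
      exact ⟨hv, rfl⟩
  rw [this, ← LinearEquiv.finrank_eq (Submodule.equivMapOfInjective _ hinj J)]

theorem finrank_comap_sndL_inf (J : Submodule ℂ (κ → ℂ)) :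
    finrank ℂ ↥(J.comap sndL ⊓ LinearMap.ker (fstL : (ι ⊕ κ → ℂ) →ₗ[ℂ] _)) = finrank ℂ J := by
  have hinj : Function.Injective (inrL : (κ → ℂ) →ₗ[ℂ] (ι ⊕ κ → ℂ)) := fun v w hvw => by
    simpa [inrL_apply] using congrArg sndL hvw
  have : J.comap sndL ⊓ LinearMap.ker (fstL : (ι ⊕ κ → ℂ) →ₗ[ℂ] _) = J.map inrL := by
    ext x
    constructor
    · rintro ⟨h1, h2⟩
      refine ⟨sndL x, h1, ?_⟩
      rw [inrL_apply, ← LinearMap.mem_ker.1 h2, elim_fstL_sndL]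
    · rintro ⟨v, hv, rfl⟩
      exact ⟨hv, rfl⟩
  rw [this, ← LinearEquiv.finrank_eq (Submodule.equivMapOfInjective _ hinj J)]

/-- The vectors `(0, w)`. -/
def spaceW (ι κ : Type*) : Submodule ℂ (ι ⊕ κ → ℂ) := LinearMap.ker fstL

theorem mem_spaceW {x : ι ⊕ κ → ℂ} : x ∈ spaceW ι κ ↔ fstL x = 0 := Iff.rfl

variable [Fintype ι]

/-- The vectors `(v, 0)` with `A* v = 0`. -/
def spaceK (κ : Type*) (A : Matrix ι π ℂ) : Submodule ℂ (ι ⊕ κ → ℂ) :=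
  (LinearMap.ker Aᴴ.mulVecLin).comap fstL ⊓ LinearMap.ker sndL

theorem mem_spaceK {A : Matrix ι π ℂ} {x : ι ⊕ κ → ℂ} :
    x ∈ spaceK κ A ↔ Aᴴ *ᵥ fstL x = 0 ∧ sndL x = 0 := Iff.rfl

theorem mem_spaceK_sup_spaceW {A : Matrix ι π ℂ} {x : ι ⊕ κ → ℂ} :
    x ∈ spaceK κ A ⊔ spaceW ι κ ↔ Aᴴ *ᵥ fstL x = 0 := by
  constructor
  · intro hx
    obtain ⟨k, hk, w, hw, rfl⟩ := Submodule.mem_sup.1 hx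
    rw [map_add, mem_spaceW.1 hw, add_zero]
    exact hk.1
  · intro hx
    have : x = Sum.elim (fstL x) (0 : κ → ℂ) + Sum.elim (0 : ι → ℂ) (sndL x) := by
      rw [← Sum.elim_add_add, add_zero, zero_add, elim_fstL_sndL]
    rw [this]
    exact Submodule.add_mem_sup ⟨hx, rfl⟩ rfl

theorem spaceK_inf_spaceW (A : Matrix ι π ℂ) : spaceK κ A ⊓ spaceW ι κ = ⊥ := by
  rw [eq_bot_iff]
  rintro x ⟨h1, h2⟩
  rw [Submodule.mem_bot, ← elim_fstL_sndL x, (mem_spaceK.1 h1).2, mem_spaceW.1 h2]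
  exact Sum.elim_zero_zero

variable [Fintype κ] [Fintype π]

theorem finrank_map_fstL_add (S : Submodule ℂ (ι ⊕ κ → ℂ)) :
    finrank ℂ ↥(S.map fstL) + finrank ℂ ↥(S ⊓ LinearMap.ker fstL) = finrank ℂ S := by
  have h1 := (fstL.domRestrict S).finrank_range_add_finrank_ker
  rw [LinearMap.range_domRestrict, LinearMap.ker_domRestrict] at h1
  have h2 := LinearEquiv.finrank_eq (Submodule.comapSubtypeEquivOfLe
    (inf_le_right : LinearMap.ker fstL ⊓ S ≤ S))
  rw [Submodule.comap_inf, Submodule.comap_subtype_self, inf_top_eq] at h2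
  rw [← h1, h2, inf_comm]

theorem finrank_spaceW : finrank ℂ (spaceW ι κ) = Fintype.card κ := by
  have := finrank_comap_sndL_inf (ι := ι) (⊤ : Submodule ℂ (κ → ℂ))
  rwa [Submodule.comap_top, top_inf_eq, finrank_top, finrank_fintype_fun_eq_card] at this

theorem finrank_spaceK (A : Matrix ι π ℂ) :
    A.rank + finrank ℂ (spaceK κ A) = Fintype.card ι := by
  rw [spaceK, finrank_comap_fstL_inf, rank_add_finrank_ker_conjTranspose]

theorem star_elim_dotProduct (x y : ι ⊕ κ → ℂ) :
    star x ⬝ᵥ y = star (fstL x) ⬝ᵥ fstL y + star (sndL x) ⬝ᵥ sndL y := by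
  simp only [dotProduct, Fintype.sum_sum_type]; rfl

theorem fstL_fromBlocks_mulVec {ι' κ' : Type*} (P : Matrix ι' ι ℂ) (R : Matrix ι' κ ℂ)
    (S : Matrix κ' ι ℂ) (Q : Matrix κ' κ ℂ) (x : ι ⊕ κ → ℂ) :
    fstL (fromBlocks P R S Q *ᵥ x) = P *ᵥ fstL x + R *ᵥ sndL x := by
  rw [fromBlocks_mulVec]; rfl

theorem sndL_fromBlocks_mulVec {ι' κ' : Type*} (P : Matrix ι' ι ℂ) (R : Matrix ι' κ ℂ)
    (S : Matrix κ' ι ℂ) (Q : Matrix κ' κ ℂ) (x : ι ⊕ κ → ℂ) :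
    sndL (fromBlocks P R S Q *ᵥ x) = S *ᵥ fstL x + Q *ᵥ sndL x := by
  rw [fromBlocks_mulVec]; rfl

theorem fromCols_conjTranspose_mulVec_eq_zero {σ ρ : Type*} (S : Matrix ι σ ℂ) (T : Matrix ι ρ ℂ)
    (v : ι → ℂ) : (fromCols S T)ᴴ *ᵥ v = 0 ↔ Sᴴ *ᵥ v = 0 ∧ Tᴴ *ᵥ v = 0 := by
  rw [conjTranspose_fromCols_eq_fromRows_conjTranspose, fromRows_mulVec, ← Sum.elim_zero_zero,
    Sum.elim_eq_iff]

theorem fromRows_conjTranspose_mulVec {ρ : Type*} (S : Matrix ι ρ ℂ) (T : Matrix κ ρ ℂ)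
    (x : ι ⊕ κ → ℂ) : (fromRows S T)ᴴ *ᵥ x = Sᴴ *ᵥ fstL x + Tᴴ *ᵥ sndL x := by
  rw [conjTranspose_fromRows_eq_fromCols_conjTranspose]
  conv_lhs => rw [← elim_fstL_sndL x]
  rw [fromCols_mulVec_sumElim]

variable {P : Matrix ι ι ℂ} {R : Matrix ι κ ℂ} {Q : Matrix κ κ ℂ} {A : Matrix ι π ℂ}

theorem hform_fromBlocks (P : Matrix ι ι ℂ) (R : Matrix ι κ ℂ) (S : Matrix κ ι ℂ)
    (Q : Matrix κ κ ℂ) (x y : ι ⊕ κ → ℂ) :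
    hform (fromBlocks P R S Q) x y = star (fstL x) ⬝ᵥ (P *ᵥ fstL y + R *ᵥ sndL y)
      + star (sndL x) ⬝ᵥ (S *ᵥ fstL y + Q *ᵥ sndL y) := by
  rw [hform_apply, star_elim_dotProduct, fstL_fromBlocks_mulVec, sndL_fromBlocks_mulVec]

/-- A vector `v` killed by `P`, `R*` and `A*` is the same as `(v, 0)` in `K` and in the radical, so
the rank of `N₀` measures that intersection. -/
theorem finrank_spaceK_inf_ker [DecidableEq ι] (hP : P.IsHermitian) (R : Matrix ι κ ℂ)
    (Q : Matrix κ κ ℂ) (A : Matrix ι π ℂ) :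
    (fromCols (fromCols P R) A).rank
      + finrank ℂ ↥(spaceK κ A ⊓ perp (hform (fromBlocks P R Rᴴ Q)) ⊤) = Fintype.card ι := by
  suffices H : spaceK κ A ⊓ perp (hform (fromBlocks P R Rᴴ Q)) ⊤
      = (LinearMap.ker (fromCols (fromCols P R) A)ᴴ.mulVecLin).comap fstL
        ⊓ LinearMap.ker sndL by
    rw [H, finrank_comap_fstL_inf, rank_add_finrank_ker_conjTranspose]
  ext x
  rw [Submodule.mem_inf, mem_spaceK, mem_perp_top, eq_zero_iff_fstL_sndL, fstL_fromBlocks_mulVec,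
    sndL_fromBlocks_mulVec, Submodule.mem_inf, Submodule.mem_comap, LinearMap.mem_ker,
    mulVecLin_apply, fromCols_conjTranspose_mulVec_eq_zero, fromCols_conjTranspose_mulVec_eq_zero,
    hP.eq, LinearMap.mem_ker]
  constructor
  · rintro ⟨⟨h1, h2⟩, h3, h4⟩
    rw [h2] at h3 h4
    simp_all
  · rintro ⟨⟨⟨h1, h2⟩, h3⟩, h4⟩
    rw [h4]
    simp_all

theorem finrank_ker_inf_sup (hP : P.IsHermitian) (R : Matrix ι κ ℂ)
    (hQ : Q.IsHermitian) (A : Matrix ι π ℂ) :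
    (fromRows (fromCols (fromCols P R) A) (fromCols (fromCols Rᴴ Q) 0)).rank
      + finrank ℂ ↥(perp (hform (fromBlocks P R Rᴴ Q)) ⊤ ⊓ (spaceK κ A ⊔ spaceW ι κ))
      = Fintype.card ι + Fintype.card κ := by
  rw [← Fintype.card_sum, ← rank_add_finrank_ker_conjTranspose
    (fromRows (fromCols (fromCols P R) A) (fromCols (fromCols Rᴴ Q) 0))]
  suffices H : perp (hform (fromBlocks P R Rᴴ Q)) ⊤ ⊓ (spaceK κ A ⊔ spaceW ι κ)
      = LinearMap.ker (fromRows (fromCols (fromCols P R) A)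
        (fromCols (fromCols Rᴴ Q) (0 : Matrix κ π ℂ)))ᴴ.mulVecLin by rw [H]
  ext x
  rw [Submodule.mem_inf, mem_spaceK_sup_spaceW, mem_perp_top, eq_zero_iff_fstL_sndL,
    fstL_fromBlocks_mulVec, sndL_fromBlocks_mulVec, LinearMap.mem_ker, mulVecLin_apply,
    fromRows_conjTranspose_mulVec]
  simp only [conjTranspose_fromCols_eq_fromRows_conjTranspose, fromRows_mulVec,
    ← Sum.elim_add_add, conjTranspose_zero, zero_mulVec, add_zero, hP.eq, hQ.eq,
    conjTranspose_conjTranspose]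
  rw [← Sum.elim_zero_zero, Sum.elim_eq_iff, ← Sum.elim_zero_zero, Sum.elim_eq_iff]

/-- The vectors `v` with `A* v = 0` and `P v` in the column space of `A`. -/
def spaceJ (P : Matrix ι ι ℂ) (A : Matrix ι π ℂ) : Submodule ℂ (ι → ℂ) :=
  LinearMap.ker Aᴴ.mulVecLin ⊓ (colSpace A).comap P.mulVecLin

theorem mem_spaceJ {v : ι → ℂ} : v ∈ spaceJ P A ↔ Aᴴ *ᵥ v = 0 ∧ P *ᵥ v ∈ colSpace A := Iff.rfl

/-- Project `(v, y)` to `v`: the image is `spaceJ P A ⊓ J`, and each fibre is a translate of the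
kernel of `A`. -/
theorem finrank_bordered_kernel (P : Matrix ι ι ℂ) (A : Matrix ι π ℂ)
    (J : Submodule ℂ (ι → ℂ)) (S : Submodule ℂ (ι ⊕ π → ℂ))
    (hS : ∀ x, x ∈ S ↔ P *ᵥ fstL x + A *ᵥ sndL x = 0 ∧ Aᴴ *ᵥ fstL x = 0 ∧ fstL x ∈ J) :
    finrank ℂ S + A.rank = finrank ℂ ↥(spaceJ P A ⊓ J) + Fintype.card π := by
  have h1 : S.map fstL = spaceJ P A ⊓ J := by
    ext v
    constructor
    · rintro ⟨x, hx, rfl⟩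
      obtain ⟨h1, h2, h3⟩ := (hS x).1 hx
      refine ⟨⟨h2, -sndL x, ?_⟩, h3⟩
      rw [mulVecLin_apply, mulVec_neg, mulVecLin_apply, eq_comm, eq_neg_iff_add_eq_zero, h1]
    · rintro ⟨⟨h1, y, hy⟩, h2⟩
      refine ⟨Sum.elim v (-y), (hS _).2 ⟨?_, h1, h2⟩, rfl⟩
      rw [fstL_elim, sndL_elim, mulVec_neg]
      rw [mulVecLin_apply, mulVecLin_apply] at hy
      rw [hy, add_neg_cancel]
  have h2 : S ⊓ LinearMap.ker fstL
      = (LinearMap.ker A.mulVecLin).comap sndL ⊓ LinearMap.ker (fstL : (ι ⊕ π → ℂ) →ₗ[ℂ] _) := by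
    ext x
    rw [Submodule.mem_inf, Submodule.mem_inf, hS, Submodule.mem_comap, LinearMap.mem_ker,
      LinearMap.mem_ker, mulVecLin_apply]
    constructor
    · rintro ⟨⟨h1, h2, h3⟩, h4⟩
      rw [h4] at h1
      exact ⟨by simpa using h1, h4⟩
    · rintro ⟨h1, h2⟩
      rw [h1, h2]
      simp
  have h3 := finrank_map_fstL_add S
  rw [h1, h2, finrank_comap_sndL_inf] at h3
  have h4 := rank_add_finrank_ker A
  omega

/-- Orthogonality of `(v, 0)` to `K` says that `Pv` is orthogonal to the kernel of `A*`, that is,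
lies in the column space of `A`; orthogonality to `W` says `R*v = 0`. -/
theorem spaceK_inf_perp_sup [DecidableEq ι] (P : Matrix ι ι ℂ) (R : Matrix ι κ ℂ)
    (Q : Matrix κ κ ℂ) (A : Matrix ι π ℂ) :
    spaceK κ A ⊓ perp (hform (fromBlocks P R Rᴴ Q)) (spaceK κ A ⊔ spaceW ι κ)
      = (spaceJ P A ⊓ LinearMap.ker Rᴴ.mulVecLin).comap fstL ⊓ LinearMap.ker sndL := by
  ext x
  rw [Submodule.mem_inf, Submodule.mem_inf, Submodule.mem_comap, Submodule.mem_inf, mem_spaceJ,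
    mem_colSpace_iff, mem_spaceK, perp_sup, Submodule.mem_inf, mem_perp, mem_perp, LinearMap.mem_ker,
    LinearMap.mem_ker, mulVecLin_apply]
  constructor
  · rintro ⟨⟨h1, h2⟩, h3, h4⟩
    refine ⟨⟨⟨h1, fun v hv => ?_⟩, ?_⟩, h2⟩
    · have := h3 (Sum.elim v 0) ⟨hv, rfl⟩
      rw [hform_fromBlocks] at this
      simpa [h2] using this
    · rw [← star_dotProduct_eq_zero_iff]
      intro w
      have := h4 (Sum.elim 0 w) rfl
      rw [hform_fromBlocks] at this
      simpa [h2] using this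
  · rintro ⟨⟨⟨h1, h2⟩, h3⟩, h4⟩
    refine ⟨⟨h1, h4⟩, fun y hy => ?_, fun y hy => ?_⟩
    · rw [hform_fromBlocks, h4, (mem_spaceK.1 hy).2]
      simpa using h2 _ hy.1
    · rw [hform_fromBlocks, h4, mem_spaceW.1 hy, h3]
      simp

theorem finrank_spaceK_inf_perp_sup [DecidableEq ι] (hP : P.IsHermitian) (R : Matrix ι κ ℂ)
    (Q : Matrix κ κ ℂ) (A : Matrix ι π ℂ) :
    (fromRows (fromCols (fromCols P R) A) (fromCols (fromCols Aᴴ 0) 0)).rank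
      + finrank ℂ ↥(spaceK κ A ⊓ perp (hform (fromBlocks P R Rᴴ Q)) (spaceK κ A ⊔ spaceW ι κ))
      = Fintype.card ι + A.rank := by
  rw [spaceK_inf_perp_sup, finrank_comap_fstL_inf]
  have h1 := rank_add_finrank_ker_conjTranspose
    (fromRows (fromCols (fromCols P R) A) (fromCols (fromCols Aᴴ (0 : Matrix π κ ℂ)) 0))
  have h2 := finrank_bordered_kernel P A (LinearMap.ker Rᴴ.mulVecLin) (LinearMap.ker
    (fromRows (fromCols (fromCols P R) A)
      (fromCols (fromCols Aᴴ (0 : Matrix π κ ℂ)) (0 : Matrix π π ℂ)))ᴴ.mulVecLin) (fun x => by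
    rw [LinearMap.mem_ker, mulVecLin_apply, fromRows_conjTranspose_mulVec]
    simp only [conjTranspose_fromCols_eq_fromRows_conjTranspose, fromRows_mulVec,
      ← Sum.elim_add_add, conjTranspose_zero, zero_mulVec, add_zero, hP.eq,
      conjTranspose_conjTranspose]
    rw [← Sum.elim_zero_zero, Sum.elim_eq_iff, ← Sum.elim_zero_zero, Sum.elim_eq_iff,
      LinearMap.mem_ker, mulVecLin_apply]
    tauto)
  rw [Fintype.card_sum] at h1
  omega

theorem rank_bordered (hP : P.IsHermitian) (A : Matrix ι π ℂ) :
    (fromBlocks P A Aᴴ 0).rank + finrank ℂ (spaceJ P A) = Fintype.card ι + A.rank := by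
  have h1 := rank_add_finrank_ker_conjTranspose (fromBlocks P A Aᴴ 0)
  have h2 := finrank_bordered_kernel P A ⊤ (LinearMap.ker (fromBlocks P A Aᴴ 0)ᴴ.mulVecLin)
    (fun x => by
      rw [fromBlocks_conjTranspose, LinearMap.mem_ker, mulVecLin_apply, eq_zero_iff_fstL_sndL,
        fstL_fromBlocks_mulVec, sndL_fromBlocks_mulVec]
      simp [hP.eq])
  rw [inf_top_eq] at h2
  rw [Fintype.card_sum] at h1
  omega

end QuadMat

/-! ### Inertia of the bordered matrix `N₁` and the translation of the rank conditions. -/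

namespace QuadMat

open Module Matrix

variable {ι κ π : Type*} [Fintype ι] [Fintype κ] [Fintype π]
variable {P : Matrix ι ι ℂ} {R : Matrix ι κ ℂ} {Q : Matrix κ κ ℂ} {A : Matrix ι π ℂ}

theorem isHermitian_blocks (hP : P.IsHermitian) (R : Matrix ι κ ℂ) (hQ : Q.IsHermitian) :
    (fromBlocks P R Rᴴ Q).IsHermitian := IsHermitian.fromBlocks hP rfl hQ

theorem isHermitian_bordered (hP : P.IsHermitian) (A : Matrix ι π ℂ) :
    (fromBlocks P A Aᴴ 0).IsHermitian := IsHermitian.fromBlocks hP rfl isHermitian_zero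

theorem isoOn_bordered (P : Matrix ι ι ℂ) (A : Matrix ι π ℂ) :
    IsoOn (hform (fromBlocks P A Aᴴ 0)) (spaceW ι π) := fun x hx => by
  rw [hform_fromBlocks, mem_spaceW.1 hx]; simp

theorem mem_perp_bordered {x : ι ⊕ π → ℂ} :
    x ∈ perp (hform (fromBlocks P A Aᴴ 0)) (spaceW ι π) ↔ Aᴴ *ᵥ fstL x = 0 := by
  rw [← star_dotProduct_eq_zero_iff]
  constructor
  · intro H y
    have := H (Sum.elim 0 y) rfl
    rw [hform_fromBlocks] at this
    simpa using this
  · intro H y hy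
    rw [hform_fromBlocks, mem_spaceW.1 hy]
    simp [H]

theorem finrank_spaceW_inf_ker_bordered (P : Matrix ι ι ℂ) (A : Matrix ι π ℂ) :
    finrank ℂ ↥(spaceW ι π ⊓ perp (hform (fromBlocks P A Aᴴ 0)) ⊤) + A.rank = Fintype.card π := by
  have : spaceW ι π ⊓ perp (hform (fromBlocks P A Aᴴ 0)) ⊤
      = (LinearMap.ker A.mulVecLin).comap sndL ⊓ LinearMap.ker fstL := by
    ext x
    rw [Submodule.mem_inf, mem_spaceW, mem_perp_top, eq_zero_iff_fstL_sndL, fstL_fromBlocks_mulVec,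
      sndL_fromBlocks_mulVec, Submodule.mem_inf, Submodule.mem_comap, LinearMap.mem_ker,
      LinearMap.mem_ker, mulVecLin_apply]
    constructor
    · rintro ⟨h1, h2, -⟩
      rw [h1] at h2
      exact ⟨by simpa using h2, h1⟩
    · rintro ⟨h1, h2⟩
      rw [h2]
      simp [h1]
  rw [this, finrank_comap_sndL_inf, add_comm, rank_add_finrank_ker]

theorem hform_spaceK {x : ι ⊕ κ → ℂ} (hx : x ∈ spaceK κ A) :
    hform (fromBlocks P R Rᴴ Q) x x = star (fstL x) ⬝ᵥ P *ᵥ fstL x := by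
  rw [hform_fromBlocks, (mem_spaceK.1 hx).2]; simp

theorem hform_perp_bordered {x : ι ⊕ π → ℂ} (hx : Aᴴ *ᵥ fstL x = 0) :
    hform (fromBlocks P A Aᴴ 0) x x = star (fstL x) ⬝ᵥ P *ᵥ fstL x := by
  have h1 : star (fstL x) ⬝ᵥ A *ᵥ sndL x = 0 := by
    rw [← star_eq_zero, star_star_dotProduct, star_mulVec_dotProduct, hx, dotProduct_zero]
  rw [hform_fromBlocks, hx, dotProduct_add, h1]; simp

theorem elim_mem_spaceK {v : ι → ℂ} (hv : Aᴴ *ᵥ v = 0) :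
    Sum.elim v 0 ∈ spaceK κ A := ⟨hv, rfl⟩

theorem nonnegOn_spaceK_iff :
    NonnegOn (hform (fromBlocks P R Rᴴ Q)) (spaceK κ A) ↔
      ∀ v, Aᴴ *ᵥ v = 0 → 0 ≤ (star v ⬝ᵥ P *ᵥ v).re := by
  constructor
  · intro H v hv
    have := H _ (elim_mem_spaceK hv)
    rwa [hform_spaceK (elim_mem_spaceK hv)] at this
  · intro H x hx
    rw [hform_spaceK hx]
    exact H _ hx.1

theorem neg_nonnegOn_spaceK_iff :
    NonnegOn (-hform (fromBlocks P R Rᴴ Q)) (spaceK κ A) ↔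
      ∀ v, Aᴴ *ᵥ v = 0 → (star v ⬝ᵥ P *ᵥ v).re ≤ 0 := by
  rw [← hform_neg, fromBlocks_neg, ← conjTranspose_neg, nonnegOn_spaceK_iff]
  simp only [neg_mulVec, dotProduct_neg, Complex.neg_re, Left.nonneg_neg_iff]

/-- The factor `s` is used with the values `1` and `-1`, to treat both signs at once. -/
theorem nonnegOn_perp_bordered_iff (s : ℝ) :
    (∀ x ∈ perp (hform (fromBlocks P A Aᴴ 0)) (spaceW ι π),
      0 ≤ s * (hform (fromBlocks P A Aᴴ 0) x x).re) ↔
      ∀ v, Aᴴ *ᵥ v = 0 → 0 ≤ s * (star v ⬝ᵥ P *ᵥ v).re := by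
  constructor
  · intro H v hv
    have := H (Sum.elim v 0) (mem_perp_bordered.2 hv)
    rwa [hform_perp_bordered (by simpa using hv)] at this
  · intro H x hx
    rw [mem_perp_bordered] at hx
    rw [hform_perp_bordered hx]
    exact H _ hx

section Inertia

variable [DecidableEq ι] [DecidableEq κ] [DecidableEq π]

/-- The vectors `(0, y)` form an isotropic subspace of dimension `r(A)` modulo the radical, and this
forces as many negative directions. -/
theorem rank_le_negInertia_bordered (hP : P.IsHermitian) (A : Matrix ι π ℂ) :
    A.rank ≤ negInertia (isHermitian_bordered hP A) := by
  have hs := isHerm_hform (isHermitian_bordered hP A)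
  obtain ⟨T, hT, hd⟩ := exists_posOn_of_isoOn hs.neg (isoOn_bordered P A).neg
  have h1 := hT.finrank_le_negInertia (isHermitian_bordered hP A)
  have h2 := finrank_spaceW_inf_ker_bordered P A
  rw [finrank_spaceW, perp_neg] at hd
  omega

theorem rank_le_posInertia_bordered (hP : P.IsHermitian) (A : Matrix ι π ℂ) :
    A.rank ≤ posInertia (isHermitian_bordered hP A) := by
  have hs := isHerm_hform (isHermitian_bordered hP A)
  obtain ⟨T, hT, hd⟩ := exists_posOn_of_isoOn hs (isoOn_bordered P A)
  have h1 := hT.finrank_le_posInertia (isHermitian_bordered hP A)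
  have h2 := finrank_spaceW_inf_ker_bordered P A
  rw [finrank_spaceW] at hd
  omega

theorem negInertia_bordered_le_iff (hP : P.IsHermitian) (R : Matrix ι κ ℂ) (Q : Matrix κ κ ℂ)
    (A : Matrix ι π ℂ) : negInertia (isHermitian_bordered hP A) ≤ A.rank ↔
      NonnegOn (hform (fromBlocks P R Rᴴ Q)) (spaceK κ A) := by
  have hs := isHerm_hform (isHermitian_bordered hP A)
  have h1 := forall_posOn_le_iff hs.neg (isoOn_bordered P A).neg
  have h2 := finrank_spaceW_inf_ker_bordered P A
  rw [finrank_spaceW, perp_neg, neg_neg] at h1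
  have h3 := nonnegOn_perp_bordered_iff (P := P) (A := A) 1
  simp only [one_mul] at h3
  rw [nonnegOn_spaceK_iff, ← h3]
  refine Iff.trans ?_ h1
  constructor
  · intro H T hT
    have := hT.finrank_le_negInertia (isHermitian_bordered hP A)
    omega
  · intro H
    obtain ⟨T, hT, hd⟩ := exists_negOn_negInertia (isHermitian_bordered hP A)
    have := H T hT
    omega

theorem posInertia_bordered_le_iff (hP : P.IsHermitian) (R : Matrix ι κ ℂ) (Q : Matrix κ κ ℂ)
    (A : Matrix ι π ℂ) : posInertia (isHermitian_bordered hP A) ≤ A.rank ↔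
      NonnegOn (-hform (fromBlocks P R Rᴴ Q)) (spaceK κ A) := by
  have hs := isHerm_hform (isHermitian_bordered hP A)
  have h1 := forall_posOn_le_iff hs (isoOn_bordered P A)
  have h2 := finrank_spaceW_inf_ker_bordered P A
  rw [finrank_spaceW] at h1
  have h3 := nonnegOn_perp_bordered_iff (P := P) (A := A) (-1)
  simp only [neg_mul, one_mul, Left.nonneg_neg_iff] at h3
  rw [neg_nonnegOn_spaceK_iff, ← h3]
  refine Iff.trans ?_ (h1.trans (by simp [NonnegOn]))
  constructor
  · intro H T hT
    have := hT.finrank_le_posInertia (isHermitian_bordered hP A)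
    omega
  · intro H
    obtain ⟨T, hT, hd⟩ := exists_posOn_posInertia (isHermitian_bordered hP A)
    have := H T hT
    omega

theorem posInertia_bordered_le_card (hP : P.IsHermitian) (A : Matrix ι π ℂ) :
    posInertia (isHermitian_bordered hP A) ≤ Fintype.card ι := by
  obtain ⟨T, hT, hd⟩ := exists_posOn_posInertia (isHermitian_bordered hP A)
  have := hT.finrank_add_le (isoOn_bordered P A)
  rw [finrank_spaceW, finrank_fintype_fun_eq_card, Fintype.card_sum] at this
  omega

theorem negInertia_bordered_le_card (hP : P.IsHermitian) (A : Matrix ι π ℂ) :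
    negInertia (isHermitian_bordered hP A) ≤ Fintype.card ι := by
  obtain ⟨T, hT, hd⟩ := exists_negOn_negInertia (isHermitian_bordered hP A)
  have := hT.finrank_add_le (isoOn_bordered P A).neg
  rw [finrank_spaceW, finrank_fintype_fun_eq_card, Fintype.card_sum] at this
  omega

/-- The bordered form has a positive definite subspace of dimension `card ι` iff the form is
positive definite on `spaceK`. -/
theorem exists_large_posOn_bordered_iff (s : ℝ) (g : (ι ⊕ π → ℂ) →ₗ⋆[ℂ] (ι ⊕ π → ℂ) →ₗ[ℂ] ℂ)
    (hs : IsHerm g) (hg : ∀ x, (g x x).re = s * (hform (fromBlocks P A Aᴴ 0) x x).re)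
    (hperp : ∀ S, perp g S = perp (hform (fromBlocks P A Aᴴ 0)) S) :
    (∃ T, PosOn g T ∧ Fintype.card ι ≤ finrank ℂ T) ↔
      ∀ v, Aᴴ *ᵥ v = 0 → v ≠ 0 → 0 < s * (star v ⬝ᵥ P *ᵥ v).re := by
  have hI : IsoOn g (spaceW ι π) := fun x hx => by
    rw [hg, isoOn_bordered P A x hx, mul_zero]
  constructor
  · rintro ⟨T, hT, hd⟩ v hv hv0
    have := pos_of_large_posOn hs hI hT (x := Sum.elim v 0)
      (by rw [finrank_spaceW, finrank_fintype_fun_eq_card, Fintype.card_sum]; omega)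
      (by rw [hperp]; exact mem_perp_bordered.2 hv) (fun hc => hv0 (mem_spaceW.1 hc))
    rwa [hg, hform_perp_bordered (by simpa using hv)] at this
  · intro H
    have hK : PosOn g (spaceK π A) := fun x hx hx0 => by
      rw [hg, hform_perp_bordered hx.1]
      refine H _ hx.1 fun hc => hx0 ?_
      rw [eq_zero_iff_fstL_sndL]
      exact ⟨hc, hx.2⟩
    -- `spaceK` contributes `card ι - r(A)` dimensions and the isotropic vectors `(0, y)` the
    -- remaining `r(A)`.
    obtain ⟨T, -, hT, hd⟩ := exists_posOn_of_isotropic hs (Z := ⊤) (U := spaceK π A) le_top hK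
      le_top hI (hs.le_perp_comm fun x hx => by
        rw [hperp]; exact mem_perp_bordered.2 hx.1)
    have h1 := finrank_spaceK (κ := π) A
    have h2 := finrank_spaceW_inf_ker_bordered P A
    rw [finrank_spaceW, hperp] at hd
    exact ⟨T, hT, by omega⟩

theorem posOn_spaceK_iff :
    PosOn (hform (fromBlocks P R Rᴴ Q)) (spaceK κ A) ↔
      ∀ v, Aᴴ *ᵥ v = 0 → v ≠ 0 → 0 < (star v ⬝ᵥ P *ᵥ v).re := by
  constructor
  · intro H v hv hv0
    have := H _ (elim_mem_spaceK hv) (fun hc => hv0 (by simpa using congrArg fstL hc))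
    rwa [hform_spaceK (elim_mem_spaceK hv)] at this
  · intro H x hx hx0
    rw [hform_spaceK hx]
    refine H _ hx.1 fun hc => hx0 ?_
    rw [eq_zero_iff_fstL_sndL]
    exact ⟨hc, hx.2⟩

theorem card_le_posInertia_bordered_iff (hP : P.IsHermitian) (R : Matrix ι κ ℂ) (Q : Matrix κ κ ℂ)
    (A : Matrix ι π ℂ) : Fintype.card ι ≤ posInertia (isHermitian_bordered hP A) ↔
      PosOn (hform (fromBlocks P R Rᴴ Q)) (spaceK κ A) := by
  have h1 := exists_large_posOn_bordered_iff (P := P) (A := A) 1 _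
    (isHerm_hform (isHermitian_bordered hP A)) (fun x => (one_mul _).symm) (fun _ => rfl)
  simp only [one_mul] at h1
  rw [posOn_spaceK_iff, ← h1]
  constructor
  · intro H
    obtain ⟨T, hT, hd⟩ := exists_posOn_posInertia (isHermitian_bordered hP A)
    exact ⟨T, hT, by omega⟩
  · rintro ⟨T, hT, hd⟩
    exact hd.trans (hT.finrank_le_posInertia _)

theorem card_le_negInertia_bordered_iff (hP : P.IsHermitian) (R : Matrix ι κ ℂ) (Q : Matrix κ κ ℂ)
    (A : Matrix ι π ℂ) : Fintype.card ι ≤ negInertia (isHermitian_bordered hP A) ↔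
      PosOn (-hform (fromBlocks P R Rᴴ Q)) (spaceK κ A) := by
  have h1 := exists_large_posOn_bordered_iff (P := P) (A := A) (-1) _
    (isHerm_hform (isHermitian_bordered hP A)).neg (fun x => by simp) (fun _ => by rw [perp_neg])
  rw [← hform_neg, fromBlocks_neg, ← conjTranspose_neg, posOn_spaceK_iff]
  simp only [neg_mul, one_mul] at h1
  simp only [neg_mulVec, dotProduct_neg, Complex.neg_re]
  rw [← h1]
  constructor
  · intro H
    obtain ⟨T, hT, hd⟩ := exists_negOn_negInertia (isHermitian_bordered hP A)
    exact ⟨T, hT, by omega⟩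
  · rintro ⟨T, hT, hd⟩
    exact hd.trans (hT.finrank_le_negInertia _)

theorem finrank_spaceK_inf_perp_le_iff (h : (ι ⊕ κ → ℂ) →ₗ⋆[ℂ] (ι ⊕ κ → ℂ) →ₗ[ℂ] ℂ)
    (K W : Submodule ℂ (ι ⊕ κ → ℂ)) :
    finrank ℂ ↥(K ⊓ perp h (K ⊔ W)) ≤ finrank ℂ ↥(K ⊓ perp h ⊤) ↔
      K ⊓ perp h (K ⊔ W) ≤ perp h ⊤ := by
  have hle : K ⊓ perp h ⊤ ≤ K ⊓ perp h (K ⊔ W) := inf_le_inf_left _ (perp_anti le_top)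
  constructor
  · intro H
    rw [← Submodule.eq_of_le_of_finrank_le hle H]
    exact inf_le_right
  · intro H
    exact Submodule.finrank_mono (le_inf inf_le_left H)

/-- After the dimension formulas the inequality reads `(i₋(N₁) - r(A)) + (dim (K ⊓ (K ⊔ W)^⊥) - dim
(K ⊓ rad)) ≤ 0`. Both brackets are nonnegative, so both vanish, and these are the two conditions on
the right. -/
theorem rank_add_negInertia_bordered_le_iff (hP : P.IsHermitian) (R : Matrix ι κ ℂ)
    (Q : Matrix κ κ ℂ) (A : Matrix ι π ℂ) :
    (fromCols (fromCols P R) A).rank + negInertia (isHermitian_bordered hP A)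
      ≤ (fromRows (fromCols (fromCols P R) A) (fromCols (fromCols Aᴴ 0) 0)).rank ↔
    NonnegOn (hform (fromBlocks P R Rᴴ Q)) (spaceK κ A) ∧
      spaceK κ A ⊓ perp (hform (fromBlocks P R Rᴴ Q)) (spaceK κ A ⊔ spaceW ι κ)
        ≤ perp (hform (fromBlocks P R Rᴴ Q)) ⊤ := by
  rw [← negInertia_bordered_le_iff hP R Q A, ← finrank_spaceK_inf_perp_le_iff]
  have h1 := finrank_spaceK_inf_ker hP R Q A
  have h2 := finrank_spaceK_inf_perp_sup hP R Q A
  have h3 := rank_le_negInertia_bordered hP A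
  have h4 : finrank ℂ ↥(spaceK κ A ⊓ perp (hform (fromBlocks P R Rᴴ Q)) ⊤) ≤
    finrank ℂ ↥(spaceK κ A ⊓ perp (hform (fromBlocks P R Rᴴ Q)) (spaceK κ A ⊔ spaceW ι κ)) :=
    Submodule.finrank_mono (inf_le_inf_left _ (perp_anti le_top))
  omega

theorem rank_add_posInertia_bordered_le_iff (hP : P.IsHermitian) (R : Matrix ι κ ℂ)
    (Q : Matrix κ κ ℂ) (A : Matrix ι π ℂ) :
    (fromCols (fromCols P R) A).rank + posInertia (isHermitian_bordered hP A)
      ≤ (fromRows (fromCols (fromCols P R) A) (fromCols (fromCols Aᴴ 0) 0)).rank ↔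
    NonnegOn (-hform (fromBlocks P R Rᴴ Q)) (spaceK κ A) ∧
      spaceK κ A ⊓ perp (hform (fromBlocks P R Rᴴ Q)) (spaceK κ A ⊔ spaceW ι κ)
        ≤ perp (hform (fromBlocks P R Rᴴ Q)) ⊤ := by
  rw [← posInertia_bordered_le_iff hP R Q A, ← finrank_spaceK_inf_perp_le_iff]
  have h1 := finrank_spaceK_inf_ker hP R Q A
  have h2 := finrank_spaceK_inf_perp_sup hP R Q A
  have h3 := rank_le_posInertia_bordered hP A
  have h4 : finrank ℂ ↥(spaceK κ A ⊓ perp (hform (fromBlocks P R Rᴴ Q)) ⊤) ≤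
    finrank ℂ ↥(spaceK κ A ⊓ perp (hform (fromBlocks P R Rᴴ Q)) (spaceK κ A ⊔ spaceW ι κ)) :=
    Submodule.finrank_mono (inf_le_inf_left _ (perp_anti le_top))
  omega

/-- The dimension condition on definite subspaces, `h` being the form of the block matrix or its
negative. -/
def DefiniteBound (h : (ι ⊕ κ → ℂ) →ₗ⋆[ℂ] (ι ⊕ κ → ℂ) →ₗ[ℂ] ℂ) (A : Matrix ι π ℂ) : Prop :=
  ∀ U, PosOn h U → finrank ℂ U + finrank ℂ ↥(perp h ⊤ ⊓ (spaceK κ A ⊔ spaceW ι κ))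
    ≤ finrank ℂ (spaceW ι κ) + finrank ℂ ↥(spaceK κ A ⊓ perp h ⊤)

theorem rank_add_negInertia_blocks_le_iff (hP : P.IsHermitian) (R : Matrix ι κ ℂ)
    (hQ : Q.IsHermitian) (A : Matrix ι π ℂ) :
    (fromCols (fromCols P R) A).rank + negInertia (isHermitian_blocks hP R hQ)
      ≤ (fromRows (fromCols (fromCols P R) A) (fromCols (fromCols Rᴴ Q) 0)).rank ↔
    DefiniteBound (-hform (fromBlocks P R Rᴴ Q)) A := by
  have h1 := finrank_spaceK_inf_ker hP R Q A
  have h2 := finrank_ker_inf_sup hP R hQ A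
  rw [DefiniteBound, finrank_spaceW, perp_neg]
  constructor
  · intro H U hU
    have := hU.finrank_le_negInertia (isHermitian_blocks hP R hQ)
    omega
  · intro H
    obtain ⟨T, hT, hd⟩ := exists_negOn_negInertia (isHermitian_blocks hP R hQ)
    have := H T hT
    omega

theorem rank_add_posInertia_blocks_le_iff (hP : P.IsHermitian) (R : Matrix ι κ ℂ)
    (hQ : Q.IsHermitian) (A : Matrix ι π ℂ) :
    (fromCols (fromCols P R) A).rank + posInertia (isHermitian_blocks hP R hQ)
      ≤ (fromRows (fromCols (fromCols P R) A) (fromCols (fromCols Rᴴ Q) 0)).rank ↔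
    DefiniteBound (hform (fromBlocks P R Rᴴ Q)) A := by
  have h1 := finrank_spaceK_inf_ker hP R Q A
  have h2 := finrank_ker_inf_sup hP R hQ A
  rw [DefiniteBound, finrank_spaceW]
  constructor
  · intro H U hU
    have := hU.finrank_le_posInertia (isHermitian_blocks hP R hQ)
    omega
  · intro H
    obtain ⟨T, hT, hd⟩ := exists_posOn_posInertia (isHermitian_blocks hP R hQ)
    have := H T hT
    omega

end Inertia

end QuadMat

/-! ### Graphs of `(AX)*` and existence of definite, semidefinite and zero values. -/

namespace QuadMat

open Module Matrix

variable {ι κ π : Type*} [Fintype ι] [Fintype κ] [Fintype π]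
variable {P : Matrix ι ι ℂ} {R : Matrix ι κ ℂ} {Q : Matrix κ κ ℂ} {A : Matrix ι π ℂ}

/-- `P + AXR* + RX*A* + AXQX*A*`. -/
def quadMap (P : Matrix ι ι ℂ) (R : Matrix ι κ ℂ) (Q : Matrix κ κ ℂ) (A : Matrix ι π ℂ)
    (X : Matrix π κ ℂ) : Matrix ι ι ℂ :=
  P + A * X * Rᴴ + R * (A * X)ᴴ + A * X * Q * (A * X)ᴴ

theorem quadMap_neg (P : Matrix ι ι ℂ) (R : Matrix ι κ ℂ) (Q : Matrix κ κ ℂ) (A : Matrix ι π ℂ)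
    (X : Matrix π κ ℂ) : quadMap (-P) (-R) (-Q) A X = -quadMap P R Q A X := by
  simp only [quadMap, conjTranspose_neg, Matrix.mul_neg, Matrix.neg_mul]
  abel

theorem isHermitian_quadMap (hP : P.IsHermitian) (R : Matrix ι κ ℂ) (hQ : Q.IsHermitian)
    (A : Matrix ι π ℂ) (X : Matrix π κ ℂ) : (quadMap P R Q A X).IsHermitian := by
  rw [IsHermitian, quadMap]
  simp only [conjTranspose_add, conjTranspose_mul, conjTranspose_conjTranspose, hP.eq, hQ.eq,
    Matrix.mul_assoc]
  abel

variable [DecidableEq ι]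

/-- The graph of `(AX)*`. -/
def graphMat (A : Matrix ι π ℂ) (X : Matrix π κ ℂ) : Matrix (ι ⊕ κ) ι ℂ := fromRows 1 (A * X)ᴴ

theorem graphMat_mulVec (A : Matrix ι π ℂ) (X : Matrix π κ ℂ) (v : ι → ℂ) :
    graphMat A X *ᵥ v = Sum.elim v ((A * X)ᴴ *ᵥ v) := by
  rw [graphMat, fromRows_mulVec, one_mulVec]

theorem graphMat_congr (P : Matrix ι ι ℂ) (R : Matrix ι κ ℂ) (Q : Matrix κ κ ℂ) (A : Matrix ι π ℂ)
    (X : Matrix π κ ℂ) :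
    (graphMat A X)ᴴ * fromBlocks P R Rᴴ Q * graphMat A X = quadMap P R Q A X := by
  rw [graphMat, quadMap, conjTranspose_fromRows_eq_fromCols_conjTranspose, conjTranspose_one,
    conjTranspose_conjTranspose, fromCols_mul_fromBlocks, fromCols_mul_fromRows]
  simp only [Matrix.one_mul, Matrix.mul_one, Matrix.add_mul, Matrix.mul_assoc]
  abel

theorem hform_graph (P : Matrix ι ι ℂ) (R : Matrix ι κ ℂ) (Q : Matrix κ κ ℂ) (A : Matrix ι π ℂ)
    (X : Matrix π κ ℂ) (v w : ι → ℂ) :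
    hform (fromBlocks P R Rᴴ Q) (graphMat A X *ᵥ v) (graphMat A X *ᵥ w)
      = hform (quadMap P R Q A X) v w := by
  rw [hform_congr, graphMat_congr]

theorem graphMat_injective (A : Matrix ι π ℂ) (X : Matrix π κ ℂ) :
    Function.Injective (graphMat A X).mulVecLin := fun v w hvw => by
  rw [mulVecLin_apply, mulVecLin_apply, graphMat_mulVec, graphMat_mulVec] at hvw
  simpa using congrArg fstL hvw

theorem spaceK_le_graph (A : Matrix ι π ℂ) (X : Matrix π κ ℂ) :
    spaceK κ A ≤ LinearMap.range (graphMat A X).mulVecLin := fun x hx => by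
  refine ⟨fstL x, ?_⟩
  rw [mulVecLin_apply, graphMat_mulVec, conjTranspose_mul, ← mulVec_mulVec, (mem_spaceK.1 hx).1,
    mulVec_zero, ← (mem_spaceK.1 hx).2, elim_fstL_sndL]

theorem graph_inf_spaceW (A : Matrix ι π ℂ) (X : Matrix π κ ℂ) :
    LinearMap.range (graphMat A X).mulVecLin ⊓ spaceW ι κ = ⊥ := by
  rw [eq_bot_iff]
  rintro _ ⟨⟨v, rfl⟩, hv⟩
  rw [mulVecLin_apply, graphMat_mulVec, SetLike.mem_coe, mem_spaceW, fstL_elim] at hv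
  simp [hv]

theorem finrank_graph_add (A : Matrix ι π ℂ) (X : Matrix π κ ℂ) :
    finrank ℂ (LinearMap.range (graphMat A X).mulVecLin) + finrank ℂ (spaceW ι κ)
      = finrank ℂ (ι ⊕ κ → ℂ) := by
  rw [LinearMap.finrank_range_of_inj (graphMat_injective A X), finrank_spaceW,
    finrank_fintype_fun_eq_card, finrank_fintype_fun_eq_card, Fintype.card_sum]

theorem exists_factor_of_ker_le {E F G : Type*} [AddCommGroup E] [Module ℂ E] [AddCommGroup F]
    [Module ℂ F] [AddCommGroup G] [Module ℂ G] (f : E →ₗ[ℂ] F) (g : E →ₗ[ℂ] G)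
    (hfg : LinearMap.ker f ≤ LinearMap.ker g) : ∃ k : F →ₗ[ℂ] G, k ∘ₗ f = g := by
  obtain ⟨k, hk⟩ := LinearMap.exists_extend
    ((LinearMap.ker f).liftQ g hfg ∘ₗ f.quotKerEquivRange.symm.toLinearMap)
  refine ⟨k, LinearMap.ext fun x => ?_⟩
  have h1 := LinearMap.congr_fun hk ⟨f x, LinearMap.mem_range_self f x⟩
  have h2 : f.quotKerEquivRange.symm ⟨f x, LinearMap.mem_range_self f x⟩
      = (LinearMap.ker f).mkQ x := f.quotKerEquivRange_symm_apply_image x _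
  simp only [LinearMap.comp_apply, Submodule.subtype_apply, LinearEquiv.coe_coe] at h1
  rw [LinearMap.comp_apply, h1, h2]
  exact Submodule.liftQ_apply _ _ _

/-- Every complement of `spaceW` containing `spaceK` is a graph of some `(AX)*`. -/
theorem exists_graph [DecidableEq κ] [DecidableEq π] {G : Submodule ℂ (ι ⊕ κ → ℂ)}
    (hK : spaceK κ A ≤ G) (hGW : G ⊓ spaceW ι κ = ⊥)
    (hd : finrank ℂ G + finrank ℂ (spaceW ι κ) = finrank ℂ (ι ⊕ κ → ℂ)) :
    ∃ X : Matrix π κ ℂ, ∀ v, graphMat A X *ᵥ v ∈ G := by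
  have hinj : Function.Injective (fstL.domRestrict G) := by
    rw [← LinearMap.ker_eq_bot, eq_bot_iff]
    intro x hx
    have : (x : ι ⊕ κ → ℂ) ∈ G ⊓ spaceW ι κ := ⟨x.2, hx⟩
    rw [hGW, Submodule.mem_bot] at this
    exact (Submodule.mem_bot ℂ).2 (Subtype.ext this)
  have hfin : finrank ℂ G = finrank ℂ (ι → ℂ) := by
    rw [finrank_spaceW, finrank_fintype_fun_eq_card, Fintype.card_sum] at hd
    rw [finrank_fintype_fun_eq_card]; omega
  -- A complement of `W` projects isomorphically onto the first component, hence is the graph of a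
  -- map `Y`.
  let e := LinearEquiv.ofInjectiveOfFinrankEq (fstL.domRestrict G) hinj hfin
  have he : ∀ x : G, e x = fstL (x : ι ⊕ κ → ℂ) := fun _ => rfl
  let Y : (ι → ℂ) →ₗ[ℂ] (κ → ℂ) := sndL ∘ₗ G.subtype ∘ₗ e.symm.toLinearMap
  have hY : ∀ v, Sum.elim v (Y v) ∈ G := by
    intro v
    have h1 : fstL (e.symm v : ι ⊕ κ → ℂ) = v := by rw [← he, e.apply_symm_apply]
    have h2 : Sum.elim v (Y v) = (e.symm v : ι ⊕ κ → ℂ) := by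
      conv_rhs => rw [← elim_fstL_sndL (e.symm v : ι ⊕ κ → ℂ), h1]
      rfl
    rw [h2]; exact (e.symm v).2
  -- Containing `K` means that `Y` kills the kernel of `A*`, so `Y` factors as `X*A*`.
  have hker : LinearMap.ker Aᴴ.mulVecLin ≤ LinearMap.ker Y := by
    intro v hv
    have h1 : Sum.elim v 0 ∈ spaceK κ A := elim_mem_spaceK hv
    have h2 : Sum.elim v (Y v) - Sum.elim v 0 ∈ G ⊓ spaceW ι κ :=
      ⟨G.sub_mem (hY v) (hK h1), by rw [SetLike.mem_coe, mem_spaceW, map_sub, fstL_elim, fstL_elim, sub_self]⟩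
    rw [hGW, Submodule.mem_bot] at h2
    simpa using congrArg sndL h2
  obtain ⟨k, hk⟩ := exists_factor_of_ker_le _ _ hker
  refine ⟨(LinearMap.toMatrix' k)ᴴ, fun v => ?_⟩
  rw [graphMat_mulVec, conjTranspose_mul, conjTranspose_conjTranspose, ← mulVec_mulVec,
    LinearMap.toMatrix'_mulVec]
  have := LinearMap.congr_fun hk v
  rw [LinearMap.comp_apply, mulVecLin_apply] at this
  rw [this]
  exact hY v

theorem graphMat_mulVec_ne_zero {X : Matrix π κ ℂ} {v : ι → ℂ} (hv : v ≠ 0) :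
    graphMat A X *ᵥ v ≠ 0 := fun h0 => hv (graphMat_injective A X (by simpa using h0))

section Existence

variable [DecidableEq κ] [DecidableEq π]

theorem exists_posDef_iff (hP : P.IsHermitian) (R : Matrix ι κ ℂ) (hQ : Q.IsHermitian)
    (A : Matrix ι π ℂ) : (∃ X, (quadMap P R Q A X).PosDef) ↔
      PosOn (hform (fromBlocks P R Rᴴ Q)) (spaceK κ A) ∧
        ∃ U, PosOn (hform (fromBlocks P R Rᴴ Q)) U ∧ Fintype.card ι ≤ finrank ℂ U := by
  have hs := isHerm_hform (isHermitian_blocks hP R hQ)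
  constructor
  · rintro ⟨X, hX⟩
    rw [posDef_iff_posOn (isHermitian_quadMap hP R hQ A X)] at hX
    have hG : PosOn (hform (fromBlocks P R Rᴴ Q)) (LinearMap.range (graphMat A X).mulVecLin) := by
      rintro _ ⟨v, rfl⟩ hv
      rw [mulVecLin_apply, hform_graph]
      exact hX v trivial (fun h0 => hv (by simp [h0]))
    refine ⟨hG.mono (spaceK_le_graph A X), _, hG, ?_⟩
    rw [LinearMap.finrank_range_of_inj (graphMat_injective A X), finrank_fintype_fun_eq_card]
  · rintro ⟨hK, U, hU, hd⟩
    obtain ⟨G, hKG, hG, hGW, hGd⟩ := exists_posOn_complement hs hK (spaceK_inf_spaceW A) hU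
      (by rw [finrank_spaceW, finrank_fintype_fun_eq_card, Fintype.card_sum]; omega)
    obtain ⟨X, hX⟩ := exists_graph hKG hGW hGd
    refine ⟨X, (posDef_iff_posOn (isHermitian_quadMap hP R hQ A X)).2 fun v _ hv => ?_⟩
    rw [← hform_graph]
    exact hG _ (hX v) (graphMat_mulVec_ne_zero hv)

theorem exists_posSemidef_iff (hP : P.IsHermitian) (R : Matrix ι κ ℂ) (hQ : Q.IsHermitian)
    (A : Matrix ι π ℂ) : (∃ X, (quadMap P R Q A X).PosSemidef) ↔
      (NonnegOn (hform (fromBlocks P R Rᴴ Q)) (spaceK κ A) ∧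
        spaceK κ A ⊓ perp (hform (fromBlocks P R Rᴴ Q)) (spaceK κ A ⊔ spaceW ι κ)
          ≤ perp (hform (fromBlocks P R Rᴴ Q)) ⊤) ∧
        DefiniteBound (-hform (fromBlocks P R Rᴴ Q)) A := by
  have hs := isHerm_hform (isHermitian_blocks hP R hQ)
  rw [DefiniteBound, perp_neg]
  constructor
  · rintro ⟨X, hX⟩
    rw [posSemidef_iff_nonnegOn (isHermitian_quadMap hP R hQ A X)] at hX
    have hG : NonnegOn (hform (fromBlocks P R Rᴴ Q))
        (LinearMap.range (graphMat A X).mulVecLin) := by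
      rintro _ ⟨v, rfl⟩
      rw [mulVecLin_apply, hform_graph]
      exact hX v trivial
    obtain ⟨h1, h2⟩ := hG.complement_conditions hs (spaceK_le_graph A X) (graph_inf_spaceW A X)
      (finrank_graph_add A X)
    exact ⟨⟨hG.mono (spaceK_le_graph A X), h1⟩, h2⟩
  · rintro ⟨⟨hK, hKW⟩, hd⟩
    obtain ⟨G, hKG, hG, hGW, hGd⟩ := exists_nonnegOn_complement hs (spaceK_inf_spaceW A) hK hKW hd
    obtain ⟨X, hX⟩ := exists_graph hKG hGW hGd
    refine ⟨X, (posSemidef_iff_nonnegOn (isHermitian_quadMap hP R hQ A X)).2 fun v _ => ?_⟩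
    rw [← hform_graph]
    exact hG _ (hX v)

theorem exists_eq_zero_iff (hP : P.IsHermitian) (R : Matrix ι κ ℂ) (hQ : Q.IsHermitian)
    (A : Matrix ι π ℂ) : (∃ X, quadMap P R Q A X = 0) ↔
      IsoOn (hform (fromBlocks P R Rᴴ Q)) (spaceK κ A) ∧
        spaceK κ A ⊓ perp (hform (fromBlocks P R Rᴴ Q)) (spaceK κ A ⊔ spaceW ι κ)
          ≤ perp (hform (fromBlocks P R Rᴴ Q)) ⊤ ∧
        DefiniteBound (hform (fromBlocks P R Rᴴ Q)) A ∧
        DefiniteBound (-hform (fromBlocks P R Rᴴ Q)) A := by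
  have hs := isHerm_hform (isHermitian_blocks hP R hQ)
  rw [DefiniteBound, DefiniteBound, perp_neg]
  constructor
  · rintro ⟨X, hX⟩
    have hG : IsoOn (hform (fromBlocks P R Rᴴ Q))
        (LinearMap.range (graphMat A X).mulVecLin) := by
      rintro _ ⟨v, rfl⟩
      rw [mulVecLin_apply, hform_graph, hX]
      simp
    obtain ⟨h1, h2⟩ := hG.nonnegOn.complement_conditions hs (spaceK_le_graph A X)
      (graph_inf_spaceW A X) (finrank_graph_add A X)
    obtain ⟨-, h3⟩ := hG.neg.nonnegOn.complement_conditions hs.neg (spaceK_le_graph A X)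
      (graph_inf_spaceW A X) (finrank_graph_add A X)
    rw [neg_neg, perp_neg] at h3
    exact ⟨fun x hx => hG x (spaceK_le_graph A X hx), h1, h3, h2⟩
  · rintro ⟨hK, hKW, hd, hd'⟩
    obtain ⟨G, hKG, hG, hGW, hGd⟩ := exists_isoOn_complement hs (spaceK_inf_spaceW A) hK hKW
      (fun U hU => hU.elim (hd U) (hd' U))
    obtain ⟨X, hX⟩ := exists_graph hKG hGW hGd
    refine ⟨X, (eq_zero_iff_isoOn (isHermitian_quadMap hP R hQ A X)).2 fun v _ => ?_⟩
    rw [← hform_graph]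
    exact hG _ (hX v)

/-- By `rank_bordered`, equality means that `P` maps the whole kernel of `A*` into its orthogonal
complement, the column space of `A`; by polarization the form then vanishes on `K`. -/
theorem rank_bordered_eq_iff (hP : P.IsHermitian) (R : Matrix ι κ ℂ) (hQ : Q.IsHermitian)
    (A : Matrix ι π ℂ) : (fromBlocks P A Aᴴ 0).rank = 2 * A.rank ↔
      IsoOn (hform (fromBlocks P R Rᴴ Q)) (spaceK κ A) := by
  have h1 := rank_bordered hP A
  have h2 := rank_add_finrank_ker_conjTranspose A
  have hle : spaceJ P A ≤ LinearMap.ker Aᴴ.mulVecLin := inf_le_left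
  have h3 := Submodule.finrank_mono hle
  have h4 : (fromBlocks P A Aᴴ 0).rank = 2 * A.rank ↔ spaceJ P A = LinearMap.ker Aᴴ.mulVecLin :=
    ⟨fun H => Submodule.eq_of_le_of_finrank_eq hle (by omega), fun H => by rw [H] at h1; omega⟩
  rw [h4]
  constructor
  · intro H x hx
    have h5 : fstL x ∈ spaceJ P A := by rw [H]; exact hx.1
    have h6 := (mem_colSpace_iff A _).1 h5.2 _ hx.1
    rw [mulVecLin_apply] at h6
    rw [hform_spaceK hx, h6, Complex.zero_re]
  · intro H
    refine le_antisymm hle fun v hv => ⟨hv, (mem_colSpace_iff A _).2 fun w hw => ?_⟩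
    have h5 := H.nonnegOn.apply_eq_zero (isHerm_hform (isHermitian_blocks hP R hQ))
      (elim_mem_spaceK hw) (elim_mem_spaceK hv) (H _ (elim_mem_spaceK hw))
    rw [hform_fromBlocks] at h5
    simpa using h5

theorem colSpace_le_fromCols_iff (hP : P.IsHermitian) (R : Matrix ι κ ℂ) (A : Matrix ι π ℂ) :
    colSpace P ≤ colSpace (fromCols A R) ↔ ∀ v, Aᴴ *ᵥ v = 0 → Rᴴ *ᵥ v = 0 → P *ᵥ v = 0 := by
  rw [colSpace_le_iff]
  simp only [fromCols_conjTranspose_mulVec_eq_zero, hP.eq, and_imp]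

/-- Lets `r[A, R]` stand in for `r(N₀)` in the condition for a zero value. -/
theorem rank_fromCols_of_colSpace_le (hP : P.IsHermitian) (R : Matrix ι κ ℂ) (A : Matrix ι π ℂ)
    (H : colSpace P ≤ colSpace (fromCols A R)) :
    (fromCols A R).rank = (fromCols (fromCols P R) A).rank := by
  rw [colSpace_le_fromCols_iff hP] at H
  have h1 := rank_add_finrank_ker_conjTranspose (fromCols A R)
  have h2 := rank_add_finrank_ker_conjTranspose (fromCols (fromCols P R) A)
  have h3 : LinearMap.ker (fromCols A R)ᴴ.mulVecLin
      = LinearMap.ker (fromCols (fromCols P R) A)ᴴ.mulVecLin := by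
    ext v
    rw [LinearMap.mem_ker, LinearMap.mem_ker, mulVecLin_apply, mulVecLin_apply,
      fromCols_conjTranspose_mulVec_eq_zero, fromCols_conjTranspose_mulVec_eq_zero,
      fromCols_conjTranspose_mulVec_eq_zero, hP.eq]
    exact ⟨fun h => ⟨⟨H v h.1 h.2, h.2⟩, h.1⟩, fun h => ⟨h.2, h.1.2⟩⟩
  rw [h3] at h1
  omega

/-- On an isotropic `K` orthogonality to `K` is automatic, so only `R*v = 0` remains to be tested.
-/
theorem inf_perp_sup_le_iff (hP : P.IsHermitian) (R : Matrix ι κ ℂ) (hQ : Q.IsHermitian)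
    (A : Matrix ι π ℂ) (hiso : IsoOn (hform (fromBlocks P R Rᴴ Q)) (spaceK κ A)) :
    spaceK κ A ⊓ perp (hform (fromBlocks P R Rᴴ Q)) (spaceK κ A ⊔ spaceW ι κ)
          ≤ perp (hform (fromBlocks P R Rᴴ Q)) ⊤ ↔ colSpace P ≤ colSpace (fromCols A R) := by
  rw [colSpace_le_fromCols_iff hP, spaceK_inf_perp_sup]
  constructor
  · intro H v hv hR
    have hJ : v ∈ spaceJ P A := by
      refine ⟨hv, (mem_colSpace_iff A _).2 fun w hw => ?_⟩
      have h5 := hiso.nonnegOn.apply_eq_zero (isHerm_hform (isHermitian_blocks hP R hQ))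
        (elim_mem_spaceK hw) (elim_mem_spaceK hv) (hiso _ (elim_mem_spaceK hw))
      rw [hform_fromBlocks] at h5
      simpa using h5
    have h1 : Sum.elim v 0 ∈ perp (hform (fromBlocks P R Rᴴ Q)) ⊤ := H ⟨⟨hJ, hR⟩, rfl⟩
    rw [mem_perp_top, eq_zero_iff_fstL_sndL, fstL_fromBlocks_mulVec] at h1
    simpa using h1.1
  · rintro H x ⟨⟨h1, h2⟩, h3⟩
    rw [SetLike.mem_coe, LinearMap.mem_ker, mulVecLin_apply] at h2
    rw [SetLike.mem_coe, LinearMap.mem_ker] at h3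
    rw [mem_perp_top, eq_zero_iff_fstL_sndL, fstL_fromBlocks_mulVec, sndL_fromBlocks_mulVec, h3,
      H _ h1.1 h2, h2]
    simp

theorem exists_eq_zero_iff_rank (hP : P.IsHermitian) (R : Matrix ι κ ℂ) (hQ : Q.IsHermitian)
    (A : Matrix ι π ℂ) : (∃ X, quadMap P R Q A X = 0) ↔
      colSpace P ≤ colSpace (fromCols A R) ∧
      (fromBlocks P A Aᴴ 0).rank = 2 * A.rank ∧
      (fromCols A R).rank + posInertia (isHermitian_blocks hP R hQ)
        ≤ (fromRows (fromCols (fromCols P R) A) (fromCols (fromCols Rᴴ Q) 0)).rank ∧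
      (fromCols A R).rank + negInertia (isHermitian_blocks hP R hQ)
        ≤ (fromRows (fromCols (fromCols P R) A) (fromCols (fromCols Rᴴ Q) 0)).rank := by
  rw [exists_eq_zero_iff hP R hQ, rank_bordered_eq_iff hP R hQ]
  constructor
  · rintro ⟨h1, h2, h3, h4⟩
    have h5 := (inf_perp_sup_le_iff hP R hQ A h1).1 h2
    rw [rank_fromCols_of_colSpace_le hP R A h5]
    exact ⟨h5, h1, (rank_add_posInertia_blocks_le_iff hP R hQ A).2 h3,
      (rank_add_negInertia_blocks_le_iff hP R hQ A).2 h4⟩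
  · rintro ⟨h5, h1, h3, h4⟩
    rw [rank_fromCols_of_colSpace_le hP R A h5] at h3 h4
    exact ⟨h1, (inf_perp_sup_le_iff hP R hQ A h1).2 h5,
      (rank_add_posInertia_blocks_le_iff hP R hQ A).1 h3,
      (rank_add_negInertia_blocks_le_iff hP R hQ A).1 h4⟩

end Existence

end QuadMat

/-! ### Values definite for all `X`, and existence of a nonsingular value. -/

namespace QuadMat

open Module Matrix

variable {ι κ π : Type*} [Fintype ι] [Fintype κ] [Fintype π]
variable {P : Matrix ι ι ℂ} {R : Matrix ι κ ℂ} {Q : Matrix κ κ ℂ} {A : Matrix ι π ℂ}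

theorem star_dotProduct_self_ne_zero {v : ι → ℂ} (hv : v ≠ 0) : star v ⬝ᵥ v ≠ 0 :=
  fun h => hv (dotProduct_star_self_eq_zero.1 h)

theorem exists_mulVec_eq {a : ι → ℂ} (ha : a ≠ 0) (w : κ → ℂ) :
    ∃ Z : Matrix κ ι ℂ, Z *ᵥ a = w := by
  refine ⟨(star a ⬝ᵥ a)⁻¹ • vecMulVec w (star a), ?_⟩
  rw [smul_mulVec, vecMulVec_mulVec]
  ext i
  have := star_dotProduct_self_ne_zero ha
  simp
  field_simp

theorem exists_conjTranspose_mulVec_ne_zero [DecidableEq ι] (hA : A ≠ 0) :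
    ∃ v, Aᴴ *ᵥ v ≠ 0 := by
  by_contra hc
  push Not at hc
  refine hA (conjTranspose_eq_zero.1 (mulVec_injective (funext fun v => ?_)))
  rw [hc v, zero_mulVec]

/-- A matrix has full row rank. -/
def FullRowRank {ι κ : Type*} [Fintype ι] (S : Matrix ι κ ℂ) : Prop :=
  ∀ u : ι → ℂ, Sᴴ *ᵥ u = 0 → u = 0

theorem fullRowRank_iff_rank (S : Matrix ι κ ℂ) : FullRowRank S ↔ S.rank = Fintype.card ι := by
  have h1 := rank_add_finrank_ker_conjTranspose S
  have h2 : FullRowRank S ↔ LinearMap.ker Sᴴ.mulVecLin = ⊥ := by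
    rw [Submodule.eq_bot_iff]; rfl
  rw [h2, ← Submodule.finrank_eq_zero]
  omega

/-- If `[E, R]` has full row rank and `[E; F]` has rank at least the number of rows of `E`, then
some `E + R Y F` has full row rank. -/
theorem exists_fullRowRank_add {ρ : Type*} [Fintype ρ] (E : Matrix ι ρ ℂ) (R : Matrix ι κ ℂ) (F : Matrix π ρ ℂ)
    (h1 : ∀ u, Eᴴ *ᵥ u = 0 → Rᴴ *ᵥ u = 0 → u = 0)
    (h2 : Fintype.card ι ≤ (fromRows E F).rank) :
    ∃ Y : Matrix κ π ℂ, FullRowRank (E + R * Y * F) := by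
  classical
  -- `Y` is chosen to maximize the rank; a rank-one change will improve it unless the rank is
  -- already full.
  let p : ℕ → Prop := fun d => ∃ Y : Matrix κ π ℂ, (E + R * Y * F).rank = d
  have hbd : ∀ d, p d → d ≤ Fintype.card ι := by
    rintro _ ⟨Y, rfl⟩; exact rank_le_card_height _
  have hp0 : p (E + R * (0 : Matrix κ π ℂ) * F).rank := ⟨0, rfl⟩
  obtain ⟨Y, hY⟩ := Nat.findGreatest_spec (hbd _ hp0) hp0
  have hmax : ∀ Y' : Matrix κ π ℂ, (E + R * Y' * F).rank ≤ (E + R * Y * F).rank := by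
    intro Y'
    rw [hY]
    exact Nat.le_findGreatest (hbd _ ⟨Y', rfl⟩) ⟨Y', rfl⟩
  refine ⟨Y, fun u hu => ?_⟩
  by_contra hu0
  set E' := E + R * Y * F with hE'
  have hRu : Rᴴ *ᵥ u ≠ 0 := by
    intro hR
    refine hu0 (h1 u ?_ hR)
    rw [hE', conjTranspose_add, conjTranspose_mul, conjTranspose_mul, add_mulVec, ← mulVec_mulVec,
      ← mulVec_mulVec, hR, mulVec_zero, mulVec_zero, add_zero] at hu
    exact hu
  -- Otherwise `E'` and `[E; F]` have the same kernel, and `E'` inherits the large rank.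
  obtain ⟨v, hv, hFv⟩ : ∃ v, E' *ᵥ v = 0 ∧ F *ᵥ v ≠ 0 := by
    by_contra hc
    push Not at hc
    have hker : LinearMap.ker E'.mulVecLin = LinearMap.ker (fromRows E F).mulVecLin := by
      ext x
      rw [LinearMap.mem_ker, LinearMap.mem_ker, mulVecLin_apply, mulVecLin_apply, fromRows_mulVec,
        ← Sum.elim_zero_zero, Sum.elim_eq_iff]
      have he : F *ᵥ x = 0 → E' *ᵥ x = E *ᵥ x := fun hF => by
        rw [hE', add_mulVec, ← mulVec_mulVec, hF, mulVec_zero, add_zero]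
      exact ⟨fun h => ⟨by rw [← he (hc x h), h], hc x h⟩, fun h => by rw [he h.2, h.1]⟩
    have e1 := rank_add_finrank_ker E'
    have e2 := rank_add_finrank_ker (fromRows E F)
    rw [hker] at e1
    have e3 := (fullRowRank_iff_rank E').2 (le_antisymm (rank_le_card_height _) (by omega))
    exact hu0 (e3 u hu)
  let Y₁ : Matrix κ π ℂ := vecMulVec (Rᴴ *ᵥ u) (star (F *ᵥ v))
  have happ : ∀ x, (E + R * (Y + Y₁) * F) *ᵥ x
      = E' *ᵥ x + (star (F *ᵥ v) ⬝ᵥ F *ᵥ x) • (R *ᵥ Rᴴ *ᵥ u) := by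
    intro x
    have : E + R * (Y + Y₁) * F = E' + R * Y₁ * F := by
      rw [hE', Matrix.mul_add, Matrix.add_mul, add_assoc]
    rw [this, add_mulVec, ← mulVec_mulVec, ← mulVec_mulVec, vecMulVec_mulVec, ← mulVec_smul]
    simp [mulVec_smul]
  have huR : star u ⬝ᵥ (R *ᵥ Rᴴ *ᵥ u) ≠ 0 := by
    rw [← star_ne_zero, star_star_dotProduct, star_mulVec_dotProduct]
    exact star_dotProduct_self_ne_zero hRu
  -- Pairing with `u`, which annihilates the range of `E'` but not `RR*u`, shows that the new kernel
  -- lies in the old one; `v` drops out of it.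
  have hlt : LinearMap.ker (E + R * (Y + Y₁) * F).mulVecLin < LinearMap.ker E'.mulVecLin := by
    refine lt_of_le_of_ne (fun x hx => ?_) fun he => ?_
    · rw [LinearMap.mem_ker, mulVecLin_apply, happ] at hx
      have e1 := congrArg (star u ⬝ᵥ ·) hx
      have e2 : star u ⬝ᵥ E' *ᵥ x = 0 := by
        rw [← star_eq_zero, star_star_dotProduct, star_mulVec_dotProduct, hu, dotProduct_zero]
      simp only [dotProduct_add, e2, zero_add, dotProduct_smul, dotProduct_zero, smul_eq_mul,
        mul_eq_zero, huR, or_false] at e1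
      rw [e1, zero_smul, add_zero] at hx
      exact hx
    · have hmem : v ∈ LinearMap.ker E'.mulVecLin := hv
      rw [← he, LinearMap.mem_ker, mulVecLin_apply, happ, hv, zero_add] at hmem
      rcases smul_eq_zero.1 hmem with h0 | h0
      · exact star_dotProduct_self_ne_zero hFv h0
      · rw [h0] at huR; simp at huR
  have e1 := Submodule.finrank_lt_finrank_of_lt hlt
  have e2 := rank_add_finrank_ker E'
  have e3 := rank_add_finrank_ker (E + R * (Y + Y₁) * F)
  have e4 := hmax (Y + Y₁)
  omega

variable [DecidableEq ι]

theorem exists_graphMat_mulVec_eq {x : ι ⊕ κ → ℂ} (hx : Aᴴ *ᵥ fstL x ≠ 0) :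
    ∃ X : Matrix π κ ℂ, graphMat A X *ᵥ fstL x = x := by
  obtain ⟨Z, hZ⟩ := exists_mulVec_eq hx (sndL x)
  refine ⟨Zᴴ, ?_⟩
  rw [graphMat_mulVec, conjTranspose_mul, conjTranspose_conjTranspose, ← mulVec_mulVec, hZ,
    elim_fstL_sndL]

/-- Vectors lying on graphs inherit the sign directly. A negative vector with `A*v = 0` could be
moved slightly, using `A ≠ 0`, to a negative vector on a graph. -/
theorem forall_posSemidef_iff (hP : P.IsHermitian) (R : Matrix ι κ ℂ) (hQ : Q.IsHermitian)
    (hA : A ≠ 0) :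
    (∀ X, (quadMap P R Q A X).PosSemidef) ↔ (fromBlocks P R Rᴴ Q).PosSemidef := by
  have hs := isHerm_hform (isHermitian_blocks hP R hQ)
  simp only [posSemidef_iff_nonnegOn (isHermitian_quadMap hP R hQ A _),
    posSemidef_iff_nonnegOn (isHermitian_blocks hP R hQ)]
  constructor
  · intro H
    have key : ∀ x : ι ⊕ κ → ℂ, Aᴴ *ᵥ fstL x ≠ 0 → 0 ≤ (hform (fromBlocks P R Rᴴ Q) x x).re := by
      intro x hx
      obtain ⟨X, hX⟩ := exists_graphMat_mulVec_eq hx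
      rw [← hX, hform_graph]
      exact H X _ trivial
    obtain ⟨v₀, hv₀⟩ := exists_conjTranspose_mulVec_ne_zero hA
    intro x _
    by_cases hx : Aᴴ *ᵥ fstL x = 0
    · by_contra hneg
      have hpos : 0 < -(hform (fromBlocks P R Rᴴ Q) x x).re := by linarith
      let y : ι ⊕ κ → ℂ := Sum.elim v₀ 0
      obtain ⟨t, ht, h1⟩ := exists_pos_quadratic hpos (-(hform (fromBlocks P R Rᴴ Q) x y).re)
        (-(hform (fromBlocks P R Rᴴ Q) y y).re)
      have h2 := key (x + (t : ℂ) • y) (by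
        rw [map_add, map_smul, mulVec_add, mulVec_smul, hx, zero_add]
        exact smul_ne_zero (by exact_mod_cast ht) hv₀)
      rw [hs.re_add_smul] at h2
      linarith
    · exact key x hx
  · intro H X v _
    rw [← hform_graph]
    exact H _ trivial

theorem forall_posDef_iff (hP : P.IsHermitian) (R : Matrix ι κ ℂ) (hQ : Q.IsHermitian)
    (hA : A ≠ 0) [DecidableEq κ] :
    (∀ X, (quadMap P R Q A X).PosDef) ↔ P.PosDef ∧ (fromBlocks P R Rᴴ Q).PosSemidef ∧
      colSpace (fromRows A (0 : Matrix κ π ℂ)) ≤ colSpace (fromBlocks P R Rᴴ Q) := by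
  have hN := isHermitian_blocks hP R hQ
  have hs := isHerm_hform hN
  rw [colSpace_le_iff]
  simp only [hN.eq, fromRows_conjTranspose_mulVec, conjTranspose_zero, zero_mulVec, add_zero]
  constructor
  · intro H
    refine ⟨?_, (forall_posSemidef_iff hP R hQ hA).1 fun X => (H X).posSemidef, fun x hx => ?_⟩
    · have := H 0
      simpa [quadMap] using this
    · by_contra hAx
      obtain ⟨X, hX⟩ := exists_graphMat_mulVec_eq hAx
      have h1 := (posDef_iff_posOn (isHermitian_quadMap hP R hQ A X)).1 (H X) (fstL x) trivial
        (fun h0 => hAx (by rw [h0, mulVec_zero]))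
      rw [← hform_graph, hX, hform_apply, hx] at h1
      simp at h1
  · rintro ⟨hPD, hN0, hker⟩ X
    rw [posSemidef_iff_nonnegOn hN] at hN0
    rw [posDef_iff_posOn hP] at hPD
    refine (posDef_iff_posOn (isHermitian_quadMap hP R hQ A X)).2 fun v _ hv => ?_
    rw [← hform_graph]
    refine lt_of_le_of_ne (hN0 _ trivial) fun h0 => ?_
    -- A null vector of a semidefinite form is in its kernel; the range condition then puts it in
    -- `K`, where the form is that of `P ≻ 0`.
    have h1 : fromBlocks P R Rᴴ Q *ᵥ (graphMat A X *ᵥ v) = 0 := by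
      rw [← mem_perp_top]
      exact fun y _ => hs.eq_zero_comm (hN0.apply_eq_zero hs trivial trivial h0.symm)
    have h2 := hker _ h1
    rw [graphMat_mulVec, fstL_elim] at h2
    have h3 : graphMat A X *ᵥ v ∈ spaceK κ A := by
      rw [mem_spaceK, graphMat_mulVec, fstL_elim, sndL_elim, conjTranspose_mul, ← mulVec_mulVec, h2,
        mulVec_zero]
      exact ⟨rfl, rfl⟩
    rw [hform_spaceK h3, graphMat_mulVec, fstL_elim] at h0
    exact (hPD v trivial hv).ne h0

theorem isUnit_iff_mulVec {S : Matrix ι ι ℂ} : IsUnit S ↔ ∀ u, S *ᵥ u = 0 → u = 0 := by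
  rw [← mulVec_injective_iff_isUnit]
  exact injective_iff_map_eq_zero S.mulVecLin

theorem FullRowRank.isUnit {S : Matrix ι ι ℂ} (hS : FullRowRank S) : IsUnit S := by
  rw [← isUnit_conjTranspose]
  exact isUnit_iff_mulVec.2 hS

theorem finite_det_quadratic_eq_zero (A₀ A₁ A₂ : Matrix ι ι ℂ) {s₀ : ℂ}
    (hs : (A₀ + s₀ • A₁ + s₀ ^ 2 • A₂).det ≠ 0) :
    {s : ℂ | (A₀ + s • A₁ + s ^ 2 • A₂).det = 0}.Finite := by
  let f : Polynomial ℂ := (A₀.map Polynomial.C + (Polynomial.X : Polynomial ℂ) •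
    A₁.map Polynomial.C + (Polynomial.X : Polynomial ℂ) ^ 2 • A₂.map Polynomial.C).det
  have hf : ∀ s : ℂ, f.eval s = (A₀ + s • A₁ + s ^ 2 • A₂).det := by
    intro s
    rw [← Polynomial.coe_evalRingHom, RingHom.map_det]
    congr 1
    ext i j
    simp
    ring
  have hf0 : f ≠ 0 := by
    intro h0
    apply hs
    rw [← hf, h0, Polynomial.eval_zero]
  refine (Polynomial.finite_setOfPred_isRoot hf0).subset fun s hs' => ?_
  rw [Set.mem_ofPred_eq, ← hf] at hs'
  exact hs'

/-- Multiplying by the fixed `J = (S + s₀T)*` makes the matrix square, and at `s₀` it is an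
invertible Gram matrix, so the determinant is a nonzero polynomial in `s`. -/
theorem finite_not_fullRowRank (S T : Matrix ι κ ℂ) {s₀ : ℂ}
    (hs : FullRowRank (S + s₀ • T)) : {s : ℂ | ¬ FullRowRank (S + s • T)}.Finite := by
  set J := (S + s₀ • T)ᴴ with hJ
  have hdet : (S * J + s₀ • (T * J) + s₀ ^ 2 • (0 : Matrix ι ι ℂ)).det ≠ 0 := by
    have he : S * J + s₀ • (T * J) + s₀ ^ 2 • (0 : Matrix ι ι ℂ) = (S + s₀ • T) * J := by
      rw [smul_zero, add_zero, Matrix.add_mul, Matrix.smul_mul]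
    rw [he, ← isUnit_iff_ne_zero, ← isUnit_iff_isUnit_det, isUnit_iff_mulVec]
    intro u hu
    refine hs u ?_
    rw [← mulVec_mulVec] at hu
    apply dotProduct_star_self_eq_zero.1
    have := congrArg (star u ⬝ᵥ ·) hu
    simp only [dotProduct_zero] at this
    rw [← star_eq_zero, star_star_dotProduct, star_mulVec_dotProduct, ← hJ] at this
    exact this
  refine (finite_det_quadratic_eq_zero _ _ _ hdet).subset fun s hs' => ?_
  by_contra hc
  refine hs' ?_
  rw [Set.mem_ofPred_eq, smul_zero, add_zero, ← Matrix.smul_mul, ← Matrix.add_mul] at hc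
  intro u hu
  have h1 : IsUnit ((S + s • T) * J)ᴴ :=
    (isUnit_conjTranspose _).2 ((isUnit_iff_isUnit_det _).2 (isUnit_iff_ne_zero.2 hc))
  refine isUnit_iff_mulVec.1 h1 u ?_
  rw [conjTranspose_mul, ← mulVec_mulVec, hu, mulVec_zero]

theorem exists_real_notMem {S : Set ℂ} (hS : S.Finite) : ∃ t : ℝ, (t : ℂ) ∉ S := by
  by_contra hc
  push Not at hc
  exact Set.infinite_range_of_injective Complex.ofReal_injective
    (hS.subset (by rintro _ ⟨t, rfl⟩; exact hc t))

/-- A version of `quadMap` with independent arguments in place of `X` and `X*`. -/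
def sesqMap (P : Matrix ι ι ℂ) (R : Matrix ι κ ℂ) (Q : Matrix κ κ ℂ) (A : Matrix ι π ℂ)
    (X : Matrix π κ ℂ) (Y : Matrix κ π ℂ) : Matrix ι ι ℂ :=
  P + R * Y * Aᴴ + A * X * (Rᴴ + Q * Y * Aᴴ)

theorem sesqMap_conjTranspose (P : Matrix ι ι ℂ) (R : Matrix ι κ ℂ) (Q : Matrix κ κ ℂ)
    (A : Matrix ι π ℂ) (X : Matrix π κ ℂ) : sesqMap P R Q A X Xᴴ = quadMap P R Q A X := by
  simp only [sesqMap, quadMap, conjTranspose_mul, Matrix.mul_add, Matrix.mul_assoc]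
  abel

/-- Put `X = U + V` and `Y = U* - V*`. The family `(U + sV, U* - sV*)` is `(X, Y)` at `s = 1` and
has the form `(Z, Z*)` for imaginary `s`. The determinant is a polynomial in `s`, nonzero at `1`,
hence nonzero at some imaginary `s`. -/
theorem exists_isUnit_quadMap_of_sesqMap {X : Matrix π κ ℂ} {Y : Matrix κ π ℂ}
    (h : IsUnit (sesqMap P R Q A X Y)) : ∃ X, IsUnit (quadMap P R Q A X) := by
  obtain ⟨U, V, hU, hV⟩ : ∃ U V : Matrix π κ ℂ, U + V = X ∧ Uᴴ - Vᴴ = Y := by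
    refine ⟨(1 / 2 : ℂ) • (X + Yᴴ), (1 / 2 : ℂ) • (X - Yᴴ), by module, ?_⟩
    rw [← conjTranspose_sub]
    have : (1 / 2 : ℂ) • (X + Yᴴ) - (1 / 2 : ℂ) • (X - Yᴴ) = Yᴴ := by module
    rw [this, conjTranspose_conjTranspose]
  have hexp : ∀ s : ℂ, sesqMap P R Q A (U + s • V) (Uᴴ - s • Vᴴ) = sesqMap P R Q A U Uᴴ
      + s • (A * V * (Rᴴ + Q * Uᴴ * Aᴴ) - R * Vᴴ * Aᴴ - A * U * (Q * Vᴴ * Aᴴ))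
      + s ^ 2 • (-(A * V * (Q * Vᴴ * Aᴴ))) := by
    intro s
    simp only [sesqMap, Matrix.mul_add, Matrix.add_mul, Matrix.mul_sub, Matrix.sub_mul,
      Matrix.mul_smul, Matrix.smul_mul]
    module
  have h1 : sesqMap P R Q A (U + (1 : ℂ) • V) (Uᴴ - (1 : ℂ) • Vᴴ) = sesqMap P R Q A X Y := by
    rw [one_smul, one_smul, hU, hV]
  have hfin := finite_det_quadratic_eq_zero (sesqMap P R Q A U Uᴴ)
    (A * V * (Rᴴ + Q * Uᴴ * Aᴴ) - R * Vᴴ * Aᴴ - A * U * (Q * Vᴴ * Aᴴ))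
    (-(A * V * (Q * Vᴴ * Aᴴ))) (s₀ := 1)
    (by rw [← hexp, h1, ← isUnit_iff_ne_zero, ← isUnit_iff_isUnit_det]; exact h)
  obtain ⟨t, ht⟩ := exists_real_notMem (hfin.preimage
    (f := fun z : ℂ => Complex.I * z) (fun a _ b _ hab => mul_left_cancel₀ Complex.I_ne_zero hab))
  refine ⟨U + (Complex.I * t) • V, ?_⟩
  rw [← sesqMap_conjTranspose, conjTranspose_add, conjTranspose_smul]
  have hst : star (Complex.I * (t : ℂ)) = -(Complex.I * t) := by simp
  rw [hst, neg_smul, ← sub_eq_add_neg, hexp, isUnit_iff_isUnit_det, isUnit_iff_ne_zero]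
  exact ht

theorem exists_isUnit_iff (hP : P.IsHermitian) (R : Matrix ι κ ℂ) (hQ : Q.IsHermitian)
    (A : Matrix ι π ℂ) :
    (∃ X, IsUnit (quadMap P R Q A X)) ↔ (fromCols (fromCols P R) A).rank = Fintype.card ι ∧
      Fintype.card ι ≤ (fromBlocks P A Aᴴ 0).rank ∧
      Fintype.card ι ≤ (fromBlocks P R Rᴴ Q).rank := by
  rw [← fullRowRank_iff_rank]
  constructor
  · rintro ⟨X, hX⟩
    have hr := rank_of_isUnit _ hX
    refine ⟨fun u hu => ?_, ?_, ?_⟩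
    · rw [fromCols_conjTranspose_mulVec_eq_zero, fromCols_conjTranspose_mulVec_eq_zero, hP.eq] at hu
      refine isUnit_iff_mulVec.1 hX u ?_
      simp only [quadMap, conjTranspose_mul, add_mulVec, ← mulVec_mulVec, hu.1.1, hu.1.2, hu.2,
        mulVec_zero, add_zero]
    · let Z : Matrix π ι ℂ := X * Rᴴ + (1 / 2 : ℂ) • (X * Q * Xᴴ * Aᴴ)
      have he : (fromRows (1 : Matrix ι ι ℂ) Z)ᴴ * fromBlocks P A Aᴴ 0 * fromRows (1 : Matrix ι ι ℂ) Z = quadMap P R Q A X := by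
        rw [conjTranspose_fromRows_eq_fromCols_conjTranspose, conjTranspose_one,
          fromCols_mul_fromBlocks, fromCols_mul_fromRows, quadMap]
        simp only [Z, conjTranspose_add, conjTranspose_smul, conjTranspose_mul,
          conjTranspose_conjTranspose, hQ.eq, Matrix.mul_add, Matrix.add_mul, Matrix.mul_smul,
          Matrix.smul_mul, Matrix.one_mul, Matrix.mul_one, Matrix.mul_zero, Matrix.mul_assoc,
          add_zero]
        have hh : star (1 / 2 : ℂ) = 1 / 2 := by simp
        rw [hh]
        module
      rw [← hr, ← he]
      exact (rank_mul_le_left _ _).trans (rank_mul_le_right _ _)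
    · rw [← hr, ← graphMat_congr]
      exact (rank_mul_le_left _ _).trans (rank_mul_le_right _ _)
  · rintro ⟨h0, h1, h2⟩
    have h0' : ∀ u, P *ᵥ u = 0 → Rᴴ *ᵥ u = 0 → Aᴴ *ᵥ u = 0 → u = 0 := fun u e1 e2 e3 => h0 u (by
      rw [fromCols_conjTranspose_mulVec_eq_zero, fromCols_conjTranspose_mulVec_eq_zero, hP.eq]
      exact ⟨⟨e1, e2⟩, e3⟩)
    -- Solving for `X` at fixed `Y` needs `[P + RYA*, A]` of full row rank and `[P + RYA*; R* +
    -- QYA*]` of full column rank. `Y₁` achieves the first and `X₂*` the second.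
    obtain ⟨Y₁, hY₁⟩ := exists_fullRowRank_add (fromCols P A) R (fromCols Aᴴ (0 : Matrix π π ℂ))
      (fun u hu hR => by
        rw [fromCols_conjTranspose_mulVec_eq_zero, hP.eq] at hu
        exact h0' u hu.1 hR hu.2)
      (by rw [fromRows_fromCols_eq_fromBlocks]; exact h1)
    obtain ⟨X₂, hX₂⟩ := exists_fullRowRank_add (fromCols P R) A (fromCols Rᴴ Q)
      (fun u hu hA => by
        rw [fromCols_conjTranspose_mulVec_eq_zero, hP.eq] at hu
        exact h0' u hu.1 hu.2 hA)
      (by rw [fromRows_fromCols_eq_fromBlocks]; exact h2)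
    -- On the line from `Y₁` to `X₂*` each condition fails only finitely often, so one real `t`
    -- satisfies both; `t` is real so that the same `t` appears in `Y*`.
    set D : Matrix π κ ℂ := X₂ - Y₁ᴴ with hD
    have hf1 := finite_not_fullRowRank (fromCols P A + R * Y₁ * fromCols Aᴴ (0 : Matrix π π ℂ))
      (R * Dᴴ * fromCols Aᴴ (0 : Matrix π π ℂ)) (s₀ := 0) (by rwa [zero_smul, add_zero])
    have hf2 := finite_not_fullRowRank (fromCols P R + A * Y₁ᴴ * fromCols Rᴴ Q)
      (A * D * fromCols Rᴴ Q) (s₀ := 1) (by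
        rw [one_smul, add_assoc, ← Matrix.add_mul, ← Matrix.mul_add, hD, add_sub_cancel]
        exact hX₂)
    obtain ⟨t, ht⟩ := exists_real_notMem (hf1.union hf2)
    simp only [Set.mem_union, Set.mem_ofPred_eq, not_or, not_not] at ht
    obtain ⟨ht1, ht2⟩ := ht
    set Y : Matrix κ π ℂ := Y₁ + (t : ℂ) • Dᴴ with hY
    have hYt : Yᴴ = Y₁ᴴ + (t : ℂ) • D := by
      rw [hY, conjTranspose_add, conjTranspose_smul, conjTranspose_conjTranspose]
      simp
    obtain ⟨X, hX⟩ := exists_fullRowRank_add (P + R * Y * Aᴴ) A (Rᴴ + Q * Y * Aᴴ)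
      (fun u hu hA => ht1 u (by
        have he : fromCols P A + R * Y₁ * fromCols Aᴴ (0 : Matrix π π ℂ)
            + (t : ℂ) • (R * Dᴴ * fromCols Aᴴ (0 : Matrix π π ℂ))
            = fromCols (P + R * Y * Aᴴ) A := by
          rw [add_assoc, ← Matrix.smul_mul, ← Matrix.mul_smul, ← Matrix.add_mul, ← Matrix.mul_add,
            ← hY, mul_fromCols, Matrix.mul_zero]
          ext i (j | j) <;> simp
        rw [he, fromCols_conjTranspose_mulVec_eq_zero]
        exact ⟨hu, hA⟩))
      (by
        have he : fromCols P R + A * Y₁ᴴ * fromCols Rᴴ Q + (t : ℂ) • (A * D * fromCols Rᴴ Q)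
            = (fromRows (P + R * Y * Aᴴ) (Rᴴ + Q * Y * Aᴴ))ᴴ := by
          rw [add_assoc, ← Matrix.smul_mul, ← Matrix.mul_smul, ← Matrix.add_mul, ← Matrix.mul_add,
            ← hYt, mul_fromCols, conjTranspose_fromRows_eq_fromCols_conjTranspose]
          simp only [conjTranspose_add, conjTranspose_mul, conjTranspose_conjTranspose, hP.eq,
            hQ.eq, Matrix.mul_assoc]
          ext i (j | j) <;> simp
        rw [he, fullRowRank_iff_rank, rank_conjTranspose] at ht2
        exact ht2.ge)
    exact exists_isUnit_quadMap_of_sesqMap (X := X) (Y := Y) hX.isUnit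

end QuadMat

/-! ### Nonsingularity for all `X`. -/

namespace QuadMat

open Module Matrix

variable {ι κ π : Type*} [Fintype ι] [Fintype κ] [Fintype π]
variable {P : Matrix ι ι ℂ} {R : Matrix ι κ ℂ} {Q : Matrix κ κ ℂ} {A : Matrix ι π ℂ}

/-- The hypothesis is the obvious compatibility `a*(Xu) = (X*a)*u`. Two rank-one terms meet one
requirement each, and the third removes their overlap. -/
theorem exists_mulVec_eq_and_conjTranspose_mulVec_eq {a z : π → ℂ} {u w : κ → ℂ} (ha : a ≠ 0)
    (hu : u ≠ 0) (h : star a ⬝ᵥ z = star w ⬝ᵥ u) :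
    ∃ X : Matrix π κ ℂ, X *ᵥ u = z ∧ Xᴴ *ᵥ a = w := by
  have ha' := star_dotProduct_self_ne_zero ha
  have hu' := star_dotProduct_self_ne_zero hu
  have h' : star z ⬝ᵥ a = star u ⬝ᵥ w := by
    rw [← star_star_dotProduct, h, star_star_dotProduct]
  have hsa : star (star a ⬝ᵥ a) = star a ⬝ᵥ a := star_star_dotProduct _ _
  have hsu : star (star u ⬝ᵥ u) = star u ⬝ᵥ u := star_star_dotProduct _ _
  refine ⟨(star u ⬝ᵥ u)⁻¹ • vecMulVec z (star u) + (star a ⬝ᵥ a)⁻¹ • vecMulVec a (star w)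
    - ((star a ⬝ᵥ a)⁻¹ * (star u ⬝ᵥ u)⁻¹ * (star a ⬝ᵥ z)) • vecMulVec a (star u), ?_, ?_⟩
  · rw [sub_mulVec, add_mulVec, smul_mulVec, smul_mulVec, smul_mulVec, vecMulVec_mulVec,
      vecMulVec_mulVec, vecMulVec_mulVec, ← h]
    ext i
    simp
    field_simp
    ring
  · rw [conjTranspose_sub, conjTranspose_add, conjTranspose_smul, conjTranspose_smul,
      conjTranspose_smul, conjTranspose_vecMulVec, conjTranspose_vecMulVec, conjTranspose_vecMulVec,
      star_star, star_star, sub_mulVec, add_mulVec, smul_mulVec, smul_mulVec, smul_mulVec,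
      vecMulVec_mulVec, vecMulVec_mulVec, vecMulVec_mulVec, star_mul', star_mul', star_inv₀,
      star_inv₀, hsa, hsu, star_star_dotProduct, h']
    ext i
    simp
    field_simp
    ring

variable [DecidableEq ι]

/-- For `v` in the kernel put `w = X*A*v` and `z = X(R*v + Qw)`; then `v = -P⁻¹(Az + Rw)`, and the
two vectors required to vanish are `A*v` and `R*v + Qw`. -/
theorem isUnit_quadMap_iff (hPu : IsUnit P) (R : Matrix ι κ ℂ) (Q : Matrix κ κ ℂ)
    (A : Matrix ι π ℂ) (X : Matrix π κ ℂ) :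
    IsUnit (quadMap P R Q A X) ↔ ∀ (z : π → ℂ) (w : κ → ℂ),
      X *ᵥ ((Q - Rᴴ * P⁻¹ * R) *ᵥ w - (Rᴴ * P⁻¹ * A) *ᵥ z) = z →
      Xᴴ *ᵥ (-((Aᴴ * P⁻¹ * A) *ᵥ z) - (Aᴴ * P⁻¹ * R) *ᵥ w) = w →
      -((Aᴴ * P⁻¹ * A) *ᵥ z) - (Aᴴ * P⁻¹ * R) *ᵥ w = 0 ∧
        (Q - Rᴴ * P⁻¹ * R) *ᵥ w - (Rᴴ * P⁻¹ * A) *ᵥ z = 0 := by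
  have hdet : IsUnit P.det := (isUnit_iff_isUnit_det P).1 hPu
  have hΦ : ∀ v, quadMap P R Q A X *ᵥ v = P *ᵥ v + A *ᵥ X *ᵥ (Rᴴ *ᵥ v + Q *ᵥ Xᴴ *ᵥ Aᴴ *ᵥ v)
      + R *ᵥ Xᴴ *ᵥ Aᴴ *ᵥ v := by
    intro v
    simp only [quadMap, conjTranspose_mul, add_mulVec, ← mulVec_mulVec, mulVec_add]
    abel
  have ha : ∀ z w, Aᴴ *ᵥ -(P⁻¹ *ᵥ (A *ᵥ z + R *ᵥ w))
      = -((Aᴴ * P⁻¹ * A) *ᵥ z) - (Aᴴ * P⁻¹ * R) *ᵥ w := by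
    intro z w
    simp only [← mulVec_mulVec, mulVec_add, mulVec_neg]
    abel
  have hu : ∀ z w, Rᴴ *ᵥ -(P⁻¹ *ᵥ (A *ᵥ z + R *ᵥ w)) + Q *ᵥ w
      = (Q - Rᴴ * P⁻¹ * R) *ᵥ w - (Rᴴ * P⁻¹ * A) *ᵥ z := by
    intro z w
    simp only [← mulVec_mulVec, mulVec_add, mulVec_neg, sub_mulVec]
    abel
  rw [isUnit_iff_mulVec]
  constructor
  · intro H z w hz hw
    rw [← ha] at hw
    rw [← hu] at hz
    set v := -(P⁻¹ *ᵥ (A *ᵥ z + R *ᵥ w)) with hv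
    have hPv : P *ᵥ v = -(A *ᵥ z + R *ᵥ w) := by
      rw [hv, mulVec_neg, mulVec_mulVec, mul_nonsing_inv _ hdet, one_mulVec]
    have h0 := H v (by rw [hΦ, hw, hz, hPv]; abel)
    rw [← ha, ← hu, ← hv, h0]
    rw [h0, mulVec_zero, mulVec_zero] at hw
    rw [← hw]
    simp
  · intro H v hv
    set w := Xᴴ *ᵥ Aᴴ *ᵥ v with hw
    set z := X *ᵥ (Rᴴ *ᵥ v + Q *ᵥ w) with hz
    rw [hΦ, ← hw, ← hz] at hv
    have hPv : v = -(P⁻¹ *ᵥ (A *ᵥ z + R *ᵥ w)) := by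
      have : P *ᵥ v = -(A *ᵥ z + R *ᵥ w) := by
        rw [eq_neg_iff_add_eq_zero, ← add_assoc]; exact hv
      rw [← mulVec_neg, ← this, mulVec_mulVec, nonsing_inv_mul _ hdet, one_mulVec]
    have h1 := H z w (by rw [← hu, ← hPv]) (by rw [← ha, ← hPv])
    rw [← ha, ← hu, ← hPv] at h1
    have hw0 : w = 0 := by rw [hw, h1.1, mulVec_zero]
    have hz0 : z = 0 := by rw [hz, h1.2, mulVec_zero]
    rw [hPv, hz0, hw0]
    simp

theorem ne_zero_exists_form_ne_zero {S : Matrix κ κ ℂ} (hS : S.IsHermitian) (h0 : S ≠ 0) :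
    ∃ z, (hform S z z).re ≠ 0 := by
  by_contra hc
  push Not at hc
  exact h0 ((eq_zero_iff_isoOn hS).2 fun x _ => hc x)

theorem hform_real_smul (S : Matrix κ κ ℂ) (t : ℝ) (x : κ → ℂ) :
    (hform S ((t : ℂ) • x) ((t : ℂ) • x)).re = t ^ 2 * (hform S x x).re := by
  simp
  ring

/-- If `SA` and `SQ` take values of opposite strict signs, then they take values `s` and `-s`. -/
theorem exists_form_add_eq_zero {S : Matrix π π ℂ} {T : Matrix κ κ ℂ} {z : π → ℂ} {w : κ → ℂ}
    (h : (hform S z z).re * (hform T w w).re < 0) :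
    ∃ w' : κ → ℂ, (hform T w' w').re = -(hform S z z).re := by
  have hw : (hform T w w).re ≠ 0 := by rintro h0; rw [h0, mul_zero] at h; exact lt_irrefl _ h
  have hpos : 0 ≤ -(hform S z z).re / (hform T w w).re := by
    have : -(hform S z z).re / (hform T w w).re
        = -((hform S z z).re * (hform T w w).re) / (hform T w w).re ^ 2 := by
      field_simp
    rw [this]
    exact div_nonneg (by linarith) (sq_nonneg _)
  refine ⟨((√(-(hform S z z).re / (hform T w w).re) : ℝ) : ℂ) • w, ?_⟩
  rw [hform_real_smul, Real.sq_sqrt hpos]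
  field_simp

theorem posSemidef_or_of_no_opposite [DecidableEq κ] [DecidableEq π] {S : Matrix π π ℂ}
    {T : Matrix κ κ ℂ} (hS : S.IsHermitian) (hT : T.IsHermitian) (hS0 : S ≠ 0) (hT0 : T ≠ 0)
    (h : ∀ z w, 0 ≤ (hform S z z).re * (hform T w w).re) :
    (S.PosSemidef ∧ T.PosSemidef) ∨ ((-S).PosSemidef ∧ (-T).PosSemidef) := by
  simp only [posSemidef_iff_nonnegOn hS, posSemidef_iff_nonnegOn hT,
    posSemidef_iff_nonnegOn hS.neg, posSemidef_iff_nonnegOn hT.neg, hform_neg, NonnegOn,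
    LinearMap.neg_apply, Complex.neg_re, Left.nonneg_neg_iff]
  obtain ⟨z₀, hz₀⟩ := ne_zero_exists_form_ne_zero hS hS0
  obtain ⟨w₀, hw₀⟩ := ne_zero_exists_form_ne_zero hT hT0
  rcases lt_or_gt_of_ne hz₀ with hz | hz
  · right
    have h1 : ∀ w, (hform T w w).re ≤ 0 := fun w => by
      by_contra hc
      have := mul_neg_of_neg_of_pos hz (not_le.1 hc)
      exact absurd (h z₀ w) (not_le.2 this)
    refine ⟨fun z _ => ?_, fun w _ => h1 w⟩
    by_contra hc
    have := mul_neg_of_pos_of_neg (not_le.1 hc) (lt_of_le_of_ne (h1 w₀) hw₀)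
    exact absurd (h z w₀) (not_le.2 this)
  · left
    have h1 : ∀ w, 0 ≤ (hform T w w).re := fun w => by
      by_contra hc
      have := mul_neg_of_pos_of_neg hz (not_le.1 hc)
      exact absurd (h z₀ w) (not_le.2 this)
    refine ⟨fun z _ => ?_, fun w _ => h1 w⟩
    by_contra hc
    have := mul_neg_of_neg_of_pos (not_le.1 hc) (lt_of_le_of_ne (h1 w₀) (Ne.symm hw₀))
    exact absurd (h z w₀) (not_le.2 this)

theorem mulVec_eq_zero_of_posSemidef {S : Matrix κ κ ℂ} (hS : S.PosSemidef) {x : κ → ℂ}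
    (hx : (hform S x x).re = 0) : S *ᵥ x = 0 := by
  have hs := isHerm_hform hS.1
  rw [posSemidef_iff_nonnegOn hS.1] at hS
  rw [← mem_perp_top]
  exact fun y _ => hs.eq_zero_comm (hS.apply_eq_zero hs trivial trivial hx)

theorem mulVec_eq_zero_pair {S : Matrix π π ℂ} {T : Matrix κ κ ℂ} (hS : S.PosSemidef)
    (hT : T.PosSemidef) {z : π → ℂ} {w : κ → ℂ}
    (h : (hform S z z).re + (hform T w w).re = 0) : S *ᵥ z = 0 ∧ T *ᵥ w = 0 := by
  have h1 := (posSemidef_iff_nonnegOn hS.1).1 hS z trivial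
  have h2 := (posSemidef_iff_nonnegOn hT.1).1 hT w trivial
  exact ⟨mulVec_eq_zero_of_posSemidef hS (by linarith),
    mulVec_eq_zero_of_posSemidef hT (by linarith)⟩

theorem mulVec_eq_zero_pair_neg {S : Matrix π π ℂ} {T : Matrix κ κ ℂ} (hS : (-S).PosSemidef)
    (hT : (-T).PosSemidef) {z : π → ℂ} {w : κ → ℂ}
    (h : (hform S z z).re + (hform T w w).re = 0) : S *ᵥ z = 0 ∧ T *ᵥ w = 0 := by
  have := mulVec_eq_zero_pair hS hT (z := z) (w := w) (by
    rw [hform_neg, hform_neg]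
    simp only [LinearMap.neg_apply, Complex.neg_re]
    linarith)
  simpa [neg_mulVec] using this

variable [DecidableEq κ] [DecidableEq π]

theorem forall_isUnit_iff (hP : P.IsHermitian) (R : Matrix ι κ ℂ) (hQ : Q.IsHermitian)
    (A : Matrix ι π ℂ) :
    (∀ X, IsUnit (quadMap P R Q A X)) ↔ P.rank = Fintype.card ι ∧
      ((Rᴴ * P⁻¹ * A = 0 ∧ Aᴴ * P⁻¹ * A = 0) ∨
        (Rᴴ * P⁻¹ * A = 0 ∧ Rᴴ * P⁻¹ * R = Q) ∨
        ((Aᴴ * P⁻¹ * A).PosSemidef ∧ (Q - Rᴴ * P⁻¹ * R).PosSemidef ∧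
          colSpace (Aᴴ * P⁻¹ * R) ≤ colSpace (Aᴴ * P⁻¹ * A) ∧
          colSpace (Rᴴ * P⁻¹ * A) ≤ colSpace (Q - Rᴴ * P⁻¹ * R)) ∨
        ((-(Aᴴ * P⁻¹ * A)).PosSemidef ∧ (-(Q - Rᴴ * P⁻¹ * R)).PosSemidef ∧
          colSpace (Aᴴ * P⁻¹ * R) ≤ colSpace (Aᴴ * P⁻¹ * A) ∧
          colSpace (Rᴴ * P⁻¹ * A) ≤ colSpace (Q - Rᴴ * P⁻¹ * R))) := by
  have hPrank : P.rank = Fintype.card ι ↔ IsUnit P := by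
    refine ⟨fun h => ((fullRowRank_iff_rank P).2 h).isUnit, fun h => rank_of_isUnit _ h⟩
  rw [hPrank]
  have hSA : (Aᴴ * P⁻¹ * A).IsHermitian := isHermitian_conjTranspose_mul_mul A hP.inv
  have hSQ : (Q - Rᴴ * P⁻¹ * R).IsHermitian := hQ.sub (isHermitian_conjTranspose_mul_mul R hP.inv)
  have hT : (Aᴴ * P⁻¹ * R)ᴴ = Rᴴ * P⁻¹ * A := by
    simp only [conjTranspose_mul, conjTranspose_conjTranspose, hP.inv.eq, Matrix.mul_assoc]
  have hT' : (Rᴴ * P⁻¹ * A)ᴴ = Aᴴ * P⁻¹ * R := by rw [← hT, conjTranspose_conjTranspose]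
  have hQeq : Rᴴ * P⁻¹ * R = Q ↔ Q - Rᴴ * P⁻¹ * R = 0 := by rw [sub_eq_zero, eq_comm]
  rw [colSpace_le_iff, colSpace_le_iff, hT, hT', hSA.eq, hSQ.eq, hQeq]
  have hunit : IsUnit P → ∀ X, _ := fun h X => isUnit_quadMap_iff h R Q A X
  generalize Aᴴ * P⁻¹ * A = SA at *
  generalize Q - Rᴴ * P⁻¹ * R = SQ at *
  generalize Aᴴ * P⁻¹ * R = T at *
  rw [← hT] at hunit ⊢
  clear hT hT' hQeq
  constructor
  · intro H
    have hPu : IsUnit P := by simpa [quadMap] using H 0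
    refine ⟨hPu, ?_⟩
    have H' := fun X => (hunit hPu X).1 (H X)
    -- A violation gives a nontrivial solution with `w = 0`: the second equation is then trivial,
    -- and `X` only has to send one nonzero vector to `z`.
    have hr1 : ∀ v, SA *ᵥ v = 0 → Tᴴ *ᵥ v = 0 := by
      intro z hz
      by_contra hne
      have hu : SQ *ᵥ (0 : κ → ℂ) - Tᴴ *ᵥ z ≠ 0 := by simpa using hne
      obtain ⟨X, hX⟩ := exists_mulVec_eq hu z
      exact hu (H' X z 0 hX (by simp [hz])).2
    have hr2 : ∀ v, SQ *ᵥ v = 0 → T *ᵥ v = 0 := by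
      intro w hw
      by_contra hne
      have ha : -(SA *ᵥ (0 : π → ℂ)) - T *ᵥ w ≠ 0 := by simpa using hne
      obtain ⟨X, hX⟩ := exists_mulVec_eq ha w
      refine ha (H' Xᴴ 0 w (by simp [hw]) ?_).1
      rwa [conjTranspose_conjTranspose]
    by_cases hSA0 : SA = 0
    · left
      refine ⟨mulVec_injective (funext fun v => ?_), hSA0⟩
      rw [hr1 v (by simp [hSA0]), zero_mulVec]
    by_cases hSQ0 : SQ = 0
    · right; left
      refine ⟨?_, hSQ0⟩
      rw [conjTranspose_eq_zero]
      refine mulVec_injective (funext fun v => ?_)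
      rw [hr2 v (by simp [hSQ0]), zero_mulVec]
    right; right
    -- With opposite signs, `w` can be scaled so that the two energies cancel. This is exactly the
    -- compatibility needed to find an `X` for which `(z, w)` solves the system.
    have hno : ∀ z w, 0 ≤ (hform SA z z).re * (hform SQ w w).re := by
      intro z w₀
      by_contra hneg
      obtain ⟨w, hw⟩ := exists_form_add_eq_zero (not_le.1 hneg)
      have hs0 : (hform SA z z).re ≠ 0 := by
        rintro h0; rw [h0, zero_mul] at hneg; exact hneg le_rfl
      have hA1 : star z ⬝ᵥ SA *ᵥ z = ((hform SA z z).re : ℂ) := (isHerm_hform hSA).self_eq z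
      have hQ1 : star w ⬝ᵥ SQ *ᵥ w = -((hform SA z z).re : ℂ) := by
        have := (isHerm_hform hSQ).self_eq w
        rw [hw] at this
        rw [← hform_apply, this, Complex.ofReal_neg]
      set s : ℝ := (hform SA z z).re
      have hsc : (s : ℂ) ≠ 0 := by exact_mod_cast hs0
      -- A sign change of `w` keeps its energy; as `s ≠ 0`, at least one sign makes the solution
      -- nontrivial.
      obtain ⟨c, hc1, hc2⟩ : ∃ c : ℂ, (star c * c = 1) ∧ c * (star z ⬝ᵥ T *ᵥ w) ≠ -s := by
        by_cases h1 : star z ⬝ᵥ T *ᵥ w = -s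
        · refine ⟨-1, by simp, ?_⟩
          rw [h1]
          intro h2
          apply hsc
          linear_combination (1 / 2 : ℂ) * h2
        · exact ⟨1, by simp, by rwa [one_mul]⟩
      have hQc : star (c • w) ⬝ᵥ SQ *ᵥ (c • w) = -s := by
        rw [mulVec_smul, star_smul, smul_dotProduct, dotProduct_smul, hQ1, smul_eq_mul, smul_eq_mul,
          ← mul_assoc, hc1, one_mul]
      have hTc : star z ⬝ᵥ T *ᵥ (c • w) = c * (star z ⬝ᵥ T *ᵥ w) := by
        rw [mulVec_smul, dotProduct_smul, smul_eq_mul]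
      have hTc' : star (c • w) ⬝ᵥ Tᴴ *ᵥ z = star (c * (star z ⬝ᵥ T *ᵥ w)) := by
        rw [← hTc, star_star_dotProduct, star_mulVec_dotProduct]
      have e1 : star z ⬝ᵥ (-(SA *ᵥ z) - T *ᵥ (c • w)) = -s - c * (star z ⬝ᵥ T *ᵥ w) := by
        rw [dotProduct_sub, dotProduct_neg, hA1, hTc]
      have e2 : star (c • w) ⬝ᵥ (SQ *ᵥ (c • w) - Tᴴ *ᵥ z)
          = star (-s - c * (star z ⬝ᵥ T *ᵥ w)) := by
        rw [dotProduct_sub, hQc, hTc', star_sub, star_neg]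
        simp
      have hne : -(s : ℂ) - c * (star z ⬝ᵥ T *ᵥ w) ≠ 0 := by
        rw [sub_ne_zero]; exact hc2.symm
      have ha : -(SA *ᵥ z) - T *ᵥ (c • w) ≠ 0 := fun h0 => hne (by rw [← e1, h0, dotProduct_zero])
      have hu : SQ *ᵥ (c • w) - Tᴴ *ᵥ z ≠ 0 := fun h0 => by
        rw [h0, dotProduct_zero] at e2
        exact hne (star_eq_zero.1 e2.symm)
      obtain ⟨X, hX1, hX2⟩ := exists_mulVec_eq_and_conjTranspose_mulVec_eq ha hu (z := z)
        (w := c • w) (by rw [e2, ← e1, star_star_dotProduct])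
      exact ha (H' X z (c • w) hX1 hX2).1
    rcases posSemidef_or_of_no_opposite hSA hSQ hSA0 hSQ0 hno with h | h
    · exact Or.inl ⟨h.1, h.2, hr1, hr2⟩
    · exact Or.inr ⟨h.1, h.2, hr1, hr2⟩
  · rintro ⟨hPu, H⟩ X
    refine (hunit hPu X).2 fun z w hz hw => ?_
    -- Moving `X` across the inner product equates the two equations; the cross terms in `T` cancel.
    have henergy : (hform SA z z).re + (hform SQ w w).re = 0 := by
      have h1 : star (-(SA *ᵥ z) - T *ᵥ w) ⬝ᵥ z = star w ⬝ᵥ (SQ *ᵥ w - Tᴴ *ᵥ z) := by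
        have e1 : star (-(SA *ᵥ z) - T *ᵥ w) ⬝ᵥ X *ᵥ (SQ *ᵥ w - Tᴴ *ᵥ z)
            = star (Xᴴ *ᵥ (-(SA *ᵥ z) - T *ᵥ w)) ⬝ᵥ (SQ *ᵥ w - Tᴴ *ᵥ z) := by
          rw [star_mulVec_dotProduct, conjTranspose_conjTranspose]
        rwa [hz, hw] at e1
      rw [star_sub, star_neg, sub_dotProduct, neg_dotProduct, star_mulVec_dotProduct,
        star_mulVec_dotProduct, hSA.eq, dotProduct_sub] at h1
      have h2 := congrArg Complex.re h1
      simp only [hform_apply, Complex.sub_re, Complex.neg_re] at h2 ⊢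
      linarith
    rcases H with ⟨h1, h2⟩ | ⟨h1, h2⟩ | ⟨h1, h2, h3, h4⟩ | ⟨h1, h2, h3, h4⟩
    · have hT0 : T = 0 := conjTranspose_eq_zero.1 h1
      rw [h2, hT0] at hw ⊢
      have hw0 : w = 0 := by simpa using hw.symm
      simp [hw0]
    · have hT0 : T = 0 := conjTranspose_eq_zero.1 h1
      rw [h2, hT0] at hz ⊢
      have hz0 : z = 0 := by simpa using hz.symm
      simp [hz0]
    · obtain ⟨h5, h6⟩ := mulVec_eq_zero_pair h1 h2 henergy
      simp [h5, h6, h3 z h5, h4 w h6]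
    · obtain ⟨h5, h6⟩ := mulVec_eq_zero_pair_neg h1 h2 henergy
      simp [h5, h6, h3 z h5, h4 w h6]

end QuadMat

/-! ### Final forms of the criteria, with negative versions by changing the sign of `P`, `R`, `Q`.
-/

namespace QuadMat

open Module Matrix

variable {ι κ π : Type*} [Fintype ι] [Fintype κ] [Fintype π] [DecidableEq ι] [DecidableEq κ]
  [DecidableEq π] {P : Matrix ι ι ℂ} {Q : Matrix κ κ ℂ} {A : Matrix ι π ℂ}

theorem quadMap_blocks_neg (P : Matrix ι ι ℂ) (R : Matrix ι κ ℂ) (Q : Matrix κ κ ℂ) :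
    fromBlocks (-P) (-R) (-R)ᴴ (-Q) = -fromBlocks P R Rᴴ Q := by
  rw [conjTranspose_neg, fromBlocks_neg]

theorem colSpace_neg (S : Matrix ι κ ℂ) : colSpace (-S) = colSpace S :=
  le_antisymm ((colSpace_le_iff _ _).2 fun v hv => by simp [neg_mulVec, hv])
    ((colSpace_le_iff _ _).2 fun v hv => by simpa [neg_mulVec] using hv)

theorem card_le_posInertia_iff {N : Matrix ι ι ℂ} (hN : N.IsHermitian) (k : ℕ) :
    (∃ U, PosOn (hform N) U ∧ k ≤ finrank ℂ U) ↔ k ≤ posInertia hN := by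
  constructor
  · rintro ⟨U, hU, hk⟩
    exact hk.trans (hU.finrank_le_posInertia hN)
  · intro hk
    obtain ⟨U, hU, hd⟩ := exists_posOn_posInertia hN
    exact ⟨U, hU, hd ▸ hk⟩

theorem card_le_negInertia_iff {N : Matrix ι ι ℂ} (hN : N.IsHermitian) (k : ℕ) :
    (∃ U, PosOn (-hform N) U ∧ k ≤ finrank ℂ U) ↔ k ≤ negInertia hN := by
  constructor
  · rintro ⟨U, hU, hk⟩
    exact hk.trans (hU.finrank_le_negInertia hN)
  · intro hk
    obtain ⟨U, hU, hd⟩ := exists_negOn_negInertia hN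
    exact ⟨U, hU, hd ▸ hk⟩

/-- Since `i₊(N₁) ≤ n` always, the disjunction amounts to `i₊(N₁) ≥ n` and `i₊(N₃) ≥ n`. -/
theorem exists_posDef_iff_inertia (hP : P.IsHermitian) (R : Matrix ι κ ℂ) (hQ : Q.IsHermitian)
    (A : Matrix ι π ℂ) : (∃ X, (quadMap P R Q A X).PosDef) ↔
      (posInertia (isHermitian_bordered hP A) = Fintype.card ι ∧
        Fintype.card ι ≤ posInertia (isHermitian_blocks hP R hQ)) ∨
      (Fintype.card ι ≤ posInertia (isHermitian_bordered hP A) ∧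
        posInertia (isHermitian_blocks hP R hQ) = Fintype.card ι) := by
  rw [exists_posDef_iff hP R hQ, ← card_le_posInertia_bordered_iff hP R Q A,
    card_le_posInertia_iff (isHermitian_blocks hP R hQ)]
  have := posInertia_bordered_le_card hP A
  omega

theorem exists_negDef_iff_inertia (hP : P.IsHermitian) (R : Matrix ι κ ℂ) (hQ : Q.IsHermitian)
    (A : Matrix ι π ℂ) : (∃ X, (-quadMap P R Q A X).PosDef) ↔
      (negInertia (isHermitian_bordered hP A) = Fintype.card ι ∧
        Fintype.card ι ≤ negInertia (isHermitian_blocks hP R hQ)) ∨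
      (Fintype.card ι ≤ negInertia (isHermitian_bordered hP A) ∧
        negInertia (isHermitian_blocks hP R hQ) = Fintype.card ι) := by
  simp only [← quadMap_neg]
  rw [exists_posDef_iff hP.neg (-R) hQ.neg, quadMap_blocks_neg, hform_neg,
    ← card_le_negInertia_bordered_iff hP R Q A,
    card_le_negInertia_iff (isHermitian_blocks hP R hQ)]
  have := negInertia_bordered_le_card hP A
  omega

theorem exists_posSemidef_iff_rank (hP : P.IsHermitian) (R : Matrix ι κ ℂ) (hQ : Q.IsHermitian)
    (A : Matrix ι π ℂ) : (∃ X, (quadMap P R Q A X).PosSemidef) ↔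
      (fromCols (fromCols P R) A).rank + negInertia (isHermitian_bordered hP A)
        ≤ (fromRows (fromCols (fromCols P R) A) (fromCols (fromCols Aᴴ 0) 0)).rank ∧
      (fromCols (fromCols P R) A).rank + negInertia (isHermitian_blocks hP R hQ)
        ≤ (fromRows (fromCols (fromCols P R) A) (fromCols (fromCols Rᴴ Q) 0)).rank := by
  rw [exists_posSemidef_iff hP R hQ, rank_add_negInertia_bordered_le_iff hP R Q,
    rank_add_negInertia_blocks_le_iff hP R hQ]

theorem exists_negSemidef_iff_rank (hP : P.IsHermitian) (R : Matrix ι κ ℂ) (hQ : Q.IsHermitian)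
    (A : Matrix ι π ℂ) : (∃ X, (-quadMap P R Q A X).PosSemidef) ↔
      (fromCols (fromCols P R) A).rank + posInertia (isHermitian_bordered hP A)
        ≤ (fromRows (fromCols (fromCols P R) A) (fromCols (fromCols Aᴴ 0) 0)).rank ∧
      (fromCols (fromCols P R) A).rank + posInertia (isHermitian_blocks hP R hQ)
        ≤ (fromRows (fromCols (fromCols P R) A) (fromCols (fromCols Rᴴ Q) 0)).rank := by
  simp only [← quadMap_neg]
  rw [exists_posSemidef_iff hP.neg (-R) hQ.neg, quadMap_blocks_neg, hform_neg, neg_neg, perp_neg,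
    rank_add_posInertia_bordered_le_iff hP R Q, rank_add_posInertia_blocks_le_iff hP R hQ]

theorem forall_negSemidef_iff (hP : P.IsHermitian) (R : Matrix ι κ ℂ) (hQ : Q.IsHermitian)
    (hA : A ≠ 0) :
    (∀ X, (-quadMap P R Q A X).PosSemidef) ↔ (-fromBlocks P R Rᴴ Q).PosSemidef := by
  simp only [← quadMap_neg]
  rw [forall_posSemidef_iff hP.neg (-R) hQ.neg hA, quadMap_blocks_neg]

theorem forall_negDef_iff (hP : P.IsHermitian) (R : Matrix ι κ ℂ) (hQ : Q.IsHermitian)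
    (hA : A ≠ 0) :
    (∀ X, (-quadMap P R Q A X).PosDef) ↔ (-P).PosDef ∧ (-fromBlocks P R Rᴴ Q).PosSemidef ∧
      colSpace (fromRows A (0 : Matrix κ π ℂ)) ≤ colSpace (fromBlocks P R Rᴴ Q) := by
  simp only [← quadMap_neg]
  rw [forall_posDef_iff hP.neg (-R) hQ.neg hA, quadMap_blocks_neg, colSpace_neg]

/-- As `r(N₃) = i₊(N₃) + i₋(N₃)`, the first integer inequality is the sum of the other two. -/
theorem exists_eq_zero_iff_int (hP : P.IsHermitian) (R : Matrix ι κ ℂ) (hQ : Q.IsHermitian)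
    (A : Matrix ι π ℂ) : (∃ X, quadMap P R Q A X = 0) ↔
      colSpace P ≤ colSpace (fromCols A R) ∧
      (fromBlocks P A Aᴴ 0).rank = 2 * A.rank ∧
      2 * ((fromCols A R).rank : ℤ) + (fromBlocks P R Rᴴ Q).rank
        - 2 * (fromRows (fromCols (fromCols P R) A) (fromCols (fromCols Rᴴ Q) 0)).rank ≤ 0 ∧
      ((fromCols A R).rank : ℤ) + posInertia (isHermitian_blocks hP R hQ)
        - (fromRows (fromCols (fromCols P R) A) (fromCols (fromCols Rᴴ Q) 0)).rank ≤ 0 ∧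
      ((fromCols A R).rank : ℤ) + negInertia (isHermitian_blocks hP R hQ)
        - (fromRows (fromCols (fromCols P R) A) (fromCols (fromCols Rᴴ Q) 0)).rank ≤ 0 := by
  rw [exists_eq_zero_iff_rank hP R hQ,
    rank_eq_posInertia_add_negInertia (isHermitian_blocks hP R hQ)]
  refine and_congr_right fun _ => and_congr_right fun _ => ?_
  push_cast
  omega

theorem phi_eq_quadMap {n p m q : ℕ}
    (A : Matrix (Fin n) (Fin p) ℂ) (B : Matrix (Fin m) (Fin q) ℂ) (C : Matrix (Fin n) (Fin q) ℂ)
    (D : Matrix (Fin n) (Fin n) ℂ) {M : Matrix (Fin q) (Fin q) ℂ} (hM : M.IsHermitian)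
    (X : Matrix (Fin p) (Fin m) ℂ) :
    phi A B C D M X = quadMap (D + C * M * Cᴴ) (C * M * Bᴴ) (B * M * Bᴴ) A X := by
  simp only [phi, quadMap, conjTranspose_add, conjTranspose_mul, conjTranspose_conjTranspose,
    hM.eq, Matrix.mul_add, Matrix.add_mul, Matrix.mul_assoc]
  abel

end QuadMat

open QuadMat
theorem corollary4p2 {n p m q : ℕ}
    (A : Matrix (Fin n) (Fin p) ℂ) (B : Matrix (Fin m) (Fin q) ℂ) (C : Matrix (Fin n) (Fin q) ℂ)
    (D : Matrix (Fin n) (Fin n) ℂ) (M : Matrix (Fin q) (Fin q) ℂ)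
    (hD : D.IsHermitian) (hM : M.IsHermitian) (hA : A ≠ 0) (hBMB : B * M * Bᴴ ≠ 0) :
    -- (a) existence of a nonsingular value
    ((∃ X, IsUnit (phi A B C D M X)) ↔
      (N0 A B C D M).rank = n ∧ n ≤ (N1 A C D M).rank ∧ n ≤ (N3 B C D M).rank) ∧
    -- (b) all values nonsingular
    ((∀ X, IsUnit (phi A B C D M X)) ↔
      (D + C * M * Cᴴ).rank = n ∧
      ((B * M * Cᴴ * (D + C * M * Cᴴ)⁻¹ * A = 0 ∧
          Aᴴ * (D + C * M * Cᴴ)⁻¹ * A = 0) ∨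
        (B * M * Cᴴ * (D + C * M * Cᴴ)⁻¹ * A = 0 ∧
          B * M * Cᴴ * (D + C * M * Cᴴ)⁻¹ * (C * M * Bᴴ) = B * M * Bᴴ) ∨
        (IsPSD (Aᴴ * (D + C * M * Cᴴ)⁻¹ * A) ∧
          IsPSD (B * M * Bᴴ - B * M * Cᴴ * (D + C * M * Cᴴ)⁻¹ * (C * M * Bᴴ)) ∧
          colSpace (Aᴴ * (D + C * M * Cᴴ)⁻¹ * (C * M * Bᴴ)) ≤
            colSpace (Aᴴ * (D + C * M * Cᴴ)⁻¹ * A) ∧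
          colSpace (B * M * Cᴴ * (D + C * M * Cᴴ)⁻¹ * A) ≤
            colSpace (B * M * Bᴴ - B * M * Cᴴ * (D + C * M * Cᴴ)⁻¹ * (C * M * Bᴴ))) ∨
        (IsNSD (Aᴴ * (D + C * M * Cᴴ)⁻¹ * A) ∧
          IsNSD (B * M * Bᴴ - B * M * Cᴴ * (D + C * M * Cᴴ)⁻¹ * (C * M * Bᴴ)) ∧
          colSpace (Aᴴ * (D + C * M * Cᴴ)⁻¹ * (C * M * Bᴴ)) ≤
            colSpace (Aᴴ * (D + C * M * Cᴴ)⁻¹ * A) ∧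
          colSpace (B * M * Cᴴ * (D + C * M * Cᴴ)⁻¹ * A) ≤
            colSpace (B * M * Bᴴ - B * M * Cᴴ * (D + C * M * Cᴴ)⁻¹ * (C * M * Bᴴ))))) ∧
    -- (c) solvability of `φ(X) = 0`
    ((∃ X, phi A B C D M X = 0) ↔
      colSpace (D + C * M * Cᴴ) ≤ colSpace (Matrix.fromCols A (C * M * Bᴴ)) ∧
      (N1 A C D M).rank = 2 * A.rank ∧
      2 * ((Matrix.fromCols A (C * M * Bᴴ)).rank : ℤ) + (N3 B C D M).rank
        - 2 * (N4 A B C D M).rank ≤ 0 ∧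
      ((Matrix.fromCols A (C * M * Bᴴ)).rank : ℤ) + posInertia (isHermitian_N3 B C hD hM)
        - (N4 A B C D M).rank ≤ 0 ∧
      ((Matrix.fromCols A (C * M * Bᴴ)).rank : ℤ) + negInertia (isHermitian_N3 B C hD hM)
        - (N4 A B C D M).rank ≤ 0) ∧
    -- (d) existence of a positive definite value
    ((∃ X, IsPD (phi A B C D M X)) ↔
      (posInertia (isHermitian_N1 A C hD hM) = n ∧ n ≤ posInertia (isHermitian_N3 B C hD hM)) ∨
      (n ≤ posInertia (isHermitian_N1 A C hD hM) ∧ posInertia (isHermitian_N3 B C hD hM) = n)) ∧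
    -- (e) existence of a negative definite value
    ((∃ X, IsND (phi A B C D M X)) ↔
      (negInertia (isHermitian_N1 A C hD hM) = n ∧ n ≤ negInertia (isHermitian_N3 B C hD hM)) ∨
      (n ≤ negInertia (isHermitian_N1 A C hD hM) ∧ negInertia (isHermitian_N3 B C hD hM) = n)) ∧
    -- (f) all values positive definite
    ((∀ X, IsPD (phi A B C D M X)) ↔
      IsPD (D + C * M * Cᴴ) ∧ IsPSD (N3 B C D M) ∧
      colSpace (Matrix.fromRows A (0 : Matrix (Fin m) (Fin p) ℂ)) ≤ colSpace (N3 B C D M)) ∧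
    -- (g) all values negative definite
    ((∀ X, IsND (phi A B C D M X)) ↔
      IsND (D + C * M * Cᴴ) ∧ IsNSD (N3 B C D M) ∧
      colSpace (Matrix.fromRows A (0 : Matrix (Fin m) (Fin p) ℂ)) ≤ colSpace (N3 B C D M)) ∧
    -- (h) existence of a positive semidefinite value
    ((∃ X, IsPSD (phi A B C D M X)) ↔
      (N0 A B C D M).rank + negInertia (isHermitian_N1 A C hD hM) ≤ (N2 A B C D M).rank ∧
      (N0 A B C D M).rank + negInertia (isHermitian_N3 B C hD hM) ≤ (N4 A B C D M).rank) ∧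
    -- (i) existence of a negative semidefinite value
    ((∃ X, IsNSD (phi A B C D M X)) ↔
      (N0 A B C D M).rank + posInertia (isHermitian_N1 A C hD hM) ≤ (N2 A B C D M).rank ∧
      (N0 A B C D M).rank + posInertia (isHermitian_N3 B C hD hM) ≤ (N4 A B C D M).rank) ∧
    -- (j) all values positive semidefinite
    ((∀ X, IsPSD (phi A B C D M X)) ↔ IsPSD (N3 B C D M)) ∧
    -- (k) all values negative semidefinite
    ((∀ X, IsNSD (phi A B C D M X)) ↔ IsNSD (N3 B C D M)) := by
  have hP := hD.add (Matrix.isHermitian_mul_mul_conjTranspose C hM)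
  have hQ := Matrix.isHermitian_mul_mul_conjTranspose B hM
  have hS : B * M * Cᴴ = (C * M * Bᴴ)ᴴ := by
    simp [Matrix.conjTranspose_mul, hM.eq, Matrix.mul_assoc]
  simp only [phi_eq_quadMap A B C D hM, N0, N1, N2, N3, N4, IsPD, IsPSD, IsND, IsNSD]
  -- The inertias depend on proofs that `N₁` and `N₃` are Hermitian; these become variables so that
  -- the blocks can be rewritten and abstracted.
  generalize_proofs h1 h2
  revert h1 h2
  rw [hS]
  generalize D + C * M * Cᴴ = P at *
  generalize C * M * Bᴴ = R at *
  generalize B * M * Bᴴ = Q at *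
  intro h1 h2
  have card := Fintype.card_fin n
  refine ⟨?_, ?_, exists_eq_zero_iff_int hP R hQ A, ?_, ?_, forall_posDef_iff hP R hQ hA,
    forall_negDef_iff hP R hQ hA, exists_posSemidef_iff_rank hP R hQ A,
    exists_negSemidef_iff_rank hP R hQ A, forall_posSemidef_iff hP R hQ hA,
    forall_negSemidef_iff hP R hQ hA⟩
  · rw [exists_isUnit_iff hP R hQ A, card]
  · rw [forall_isUnit_iff hP R hQ A, card]
  · rw [exists_posDef_iff_inertia hP R hQ A, card]
  · rw [exists_negDef_iff_inertia hP R hQ A, card]
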